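/- **Setting.** Let $U=(\rho,\rho\mathbf v,p_\parallel,E,\mathbf B,\Psi)\in\mathbb R^{10}$ with $\mathbf v=(v_x,v_y,v_z)$, $\mathbf B=(B_x,B_y,B_z)$, and let $p_\perp$ be defined by $E=\frac{\rho|\mathbf v|^2}{2}+\frac{|\mathbf B|^2}{2}+\frac{2p_\perp+p_\parallel}{2}+\frac{\Psi^2}{2}$. Call $U$ admissible if $\rho,p_\parallel,p_\perp>0$ and $\mathbf B\ne0$; put $\mathbf b=\mathbf B/|\mathbf B|$, $\Delta P=p_\parallel-p_\perp$, $e=E-\frac12\Psi^2$, $\beta_\perp=\rho/p_\perp$, $\beta_\parallel=\rho/p_\parallel$. Let $c_h\in\mathbb R$. The reformulated GLM-CGL system is $$\partial_tU+\sum_{d\in\{x,y\}}\Big(\partial_d f_d(U)+\Phi'(V)\,\partial_dB_d+\Upsilon_d\,\partial_d\Psi+C_d(U)\,\partial_dU\Big)=0,$$ where $f_d$ has the components $\rho v_d$; $\rho v_dv_i-B_dB_i+\delta_{id}(p_\perp+\frac12|\mathbf B|^2)$; $p_\parallel v_d$; $v_d(e+p_\perp+\frac12|\mathbf B|^2)-B_d(\mathbf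 B\cdot\mathbf v)+c_h\Psi B_d$; $v_dB_i-v_iB_d+\delta_{id}c_h\Psi$; $c_hB_d$; and $\Phi'(V)=(0,\mathbf B,0,\mathbf v\cdot\mathbf B,\mathbf v,0)$, $\Upsilon_d=(0,\mathbf 0,0,\Psi v_d,\mathbf 0,v_d)$, and $C_d(U)\partial_dU=(0,\ \partial_d(\Delta P\,b_d\mathbf b),\ 2p_\parallel b_d\,\mathbf b\cdot\partial_d\mathbf v,\ \partial_d(\Delta P\,b_d\,\mathbf b\cdot\mathbf v),\ \mathbf 0,\ 0)$. The entropy is $\mathcal E=-\rho s$, $s=\ln(p_\parallel p_\perp^2/\rho^5)$, with entropy variables $V=\partial\mathcal E/\partial U=(5-s-\beta_\perp|\mathbf v|^2,\,2\beta_\perp\mathbf v,\,\beta_\perp-\beta_\parallel,\,-2\beta_\perp,\,2\beta_\perp\mathbf B,\,2\beta_\perp\Psi)$; let $\Phi=2\beta_\perp\mathbf v\cdot\mathbf B$ and $\mathcal F_d=2\rho v_d+\beta_\perp v_d|\mathbf B|^2+2c_h\beta_\perp\Psi B_d$. **Scheme.** Let $k\in\{2,3,4\}$, with $p=1$ for $k=2$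 and $p=2$ for $k=3,4$. On the uniform grid with mesh sizes $\Delta x,\Delta y$ the scheme reads $$\frac{d}{dt}U_{i,j}+\frac{\hat f^k_{x,i+\frac12,j}-\hat f^k_{x,i-\frac12,j}}{\Delta x}+\frac{\hat f^k_{y,i,j+\frac12}-\hat f^k_{y,i,j-\frac12}}{\Delta y}+\sum_{d}\Big(\Phi'(V_{i,j})\,\delta_dB_d+\Upsilon_d\,\delta_d\Psi+C_d(U_{i,j})\,\delta_dU\Big)_{i,j}=0,$$ where $\delta_d$ is the central difference of order $2p$ in direction $d$. We describe the $x$-direction; the $y$-direction is obtained by exchanging the roles of $x$ and $y$. Write $\bar a$ for the arithmetic mean and $a^{\ln}=[\![a]\!]/[\![\ln a]\!]$ for the logarithmic mean of two values ($a^{\ln}=a$ if they are equal). *Entropy conservative part.* The two-point flux $\tilde f_x$ has the components $f^1=\rho^{\ln}\bar v_x$; $f^{m_i}=\bar v_if^1-\bar B_x\bar B_i+\delta_{ix}(\bar\rho/\bar\beta_\perp+\frac12\overline{|\mathbf B|^2})$; $f^5=f^1/\beta_\parallel^{\ln}$; $f^{B_i}=\frac1{\bar\beta_\perp}(\overline{\beta_\perp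 v_x}\,\bar B_i-\overline{\beta_\perp v_i}\,\bar B_x)+\delta_{ix}c_h\overline{\Psi\beta_\perp}/\bar\beta_\perp$; $f^{10}=c_h\bar B_x$; and energy component $\frac12\big(\frac{2}{\beta_\perp^{\ln}}-\overline{|\mathbf v|^2}\big)f^1+\sum_i\bar v_if^{m_i}+\frac12f^5+\sum_i\bar B_if^{B_i}-\frac12\bar v_x\overline{|\mathbf B|^2}+(\bar{\mathbf v}\cdot\bar{\mathbf B})\bar B_x$. Its numerical entropy flux is $\tilde q_x=\bar V\cdot\tilde f_x+\bar\Phi\bar B_x-\overline{\mathcal F}_x$. For $g\in\{\tilde f_x,\tilde q_x\}$ let $g^2_{i+\frac12}=g(U_i,U_{i+1})$ and $g^4_{i+\frac12}=\frac43g(U_i,U_{i+1})-\frac16\big(g(U_{i-1},U_{i+1})+g(U_i,U_{i+2})\big)$. *Diffusion.* At the interface let $U_{i+\frac12}=m_x(U_i,U_{i+1})$, where $m_x$ (and likewise $m_y$) is any smooth map that preserves positivity of $\rho,p_\parallel,p_\perp$ and satisfies $m_x(U,U)=U$. Put $a^2=2p_\perp/\rho$, $v_a^2=|\mathbf B|^2/\rho$,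 $v_{ax}^2=B_x^2/\rho$, $c_{f,s}^2=\frac12\big[v_a^2+a^2\pm\sqrt{(v_a^2+a^2)^2-4v_{ax}^2a^2}\big]$, $\alpha_f^2=\frac{a^2-c_s^2}{c_f^2-c_s^2}$, $\alpha_s^2=\frac{c_f^2-a^2}{c_f^2-c_s^2}$ (nonnegative roots), $(\beta_y,\beta_z)=(B_y,B_z)/\sqrt{B_y^2+B_z^2}$, $\sigma=\operatorname{sgn}B_x$, with the conventions $\alpha_f=\alpha_s=1/\sqrt2$ where $c_f=c_s$, $\beta_y=\beta_z=1/\sqrt2$ where $B_y=B_z=0$, and $\operatorname{sgn}0=1$. Let $R$ be the matrix whose columns, in the variables $w=(\rho,\mathbf v,p_\parallel,p_\perp,\mathbf B,\Psi)$ and in the order $v_x-c_f,\ v_x-c_s,\ v_x-c_h,\ v_x-v_{ax},\ v_x,\ v_x,\ v_x+v_{ax},\ v_x+c_h,\ v_x+c_s,\ v_x+c_f$, are $(\alpha_f\rho;\pm\alpha_fc_f,\mp\alpha_sc_s\beta_y\sigma,\mp\alpha_sc_s\beta_z\sigma;\alpha_fp_\parallel;\alpha_f\rho a^2;0,\alpha_sa\beta_y\sqrt\rho,\alpha_sa\beta_z\sqrt\rho;0)$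 for $v_x\pm c_f$, $(\alpha_s\rho;\pm\alpha_sc_s,\pm\alpha_fc_f\beta_y\sigma,\pm\alpha_fc_f\beta_z\sigma;\alpha_sp_\parallel;\alpha_s\rho a^2;0,-\alpha_fa\beta_y\sqrt\rho,-\alpha_fa\beta_z\sqrt\rho;0)$ for $v_x\pm c_s$, $(0;0,\pm\beta_z,\mp\beta_y;0;0;0,-\beta_z\sigma\sqrt\rho,\beta_y\sigma\sqrt\rho;0)$ for $v_x\pm v_{ax}$, $(0;\mathbf 0;0;0;\pm1,0,0;1)$ for $v_x\pm c_h$, and the unit vectors of $\rho$ and $p_\parallel$ for the two columns $v_x$. The entropy-scaled eigenvector matrix is $\tilde R_x=\frac{\partial U}{\partial w}RT$, where $T$ is the symmetric matrix with the diagonal entries $\frac1{2\sqrt{2\rho}}$ (columns $v_x\pm c_f,v_x\pm c_s$), $\frac12\sqrt{p_\perp/\rho}$ (columns $v_x\pm c_h$), $\frac{\sqrt{p_\perp}}{2\rho}$ (columns $v_x\pm v_{ax}$) and, with $\kappa=\sqrt{5p_\parallel^2+4p_\parallel\rho+\rho^2}$, the $2\times2$ block on the two columns $v_x$ with diagonal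 $\frac{\sqrt\rho(2p_\parallel+\rho)}{2\kappa},\ \frac{p_\parallel(5p_\parallel+2\rho)}{2\sqrt\rho\,\kappa}$ and off-diagonal $\frac{p_\parallel\sqrt\rho}{2\kappa}$. Let $\Lambda_x$ be the identity times the maximum of $|v_x|,|v_x\pm v_{ax}|,|v_x\pm c_h|,|v_x\pm c_f|,|v_x\pm c_s|$. Everything is evaluated at $U_{i+\frac12}$, and $D_{x,i+\frac12}=\tilde R_x\Lambda_x\tilde R_x^\top$. The components of the scaled entropy variables $\tilde R_{x,i+\frac12}^\top V_l$ ($l\in\mathbb Z$) are reconstructed in the cells $i$ and $i+1$, with MinMod slopes for $k=2$ and by the $k$-th order ENO procedure for $k=3,4$ (in either of its forms, matching the grid values as cell averages or as point values; the stencil is extended to the left exactly if the undivided difference there is strictly smaller in modulus); with $\hat W^+_i,\hat W^-_{i+1}$ their values at $x_{i+\frac12}$, let $[\![\hat V]\!]^k_{x,i+\frac12}=\tilde R_{x,i+\frac12}^{-\top}(\hat W^-_{i+1}-\hat W^+_i)$. Finally $$\hat f^k_{x,i+\frac12}=\tilde f^{2p}_{x,i+\frac12}-\tfrac12D_{x,i+\frac12}[\![\hat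 V]\!]^k_{x,i+\frac12},\qquad \hat q^k_{x,i+\frac12}=\tilde q^{2p}_{x,i+\frac12}-\tfrac12\bar V_{i+\frac12}^\top D_{x,i+\frac12}[\![\hat V]\!]^k_{x,i+\frac12}.$$ **Theorem.** For $k=2,3,4$ the scheme is $k$-th order accurate and entropy stable, in the following sense. 1. *Accuracy.* Let $u$ be a smooth admissible field on an open set $\Omega\subseteq\mathbb R^2$ and $K\subset\Omega$ compact. Let $\tau(z)$, for $z=(x,y)$, be the spatial truncation error, that is, the spatial operator of the scheme applied to the values of $u$ on the grid through $z$, minus the spatial operator of the system applied to $u$ at $z$. Then there are $C,\delta>0$ such that for all $0<\Delta x,\Delta y<\delta$: (a) there are functions $F,G,r$ such that for all $z\in K$ $$\tau(z)=\frac{F(x+\frac{\Delta x}2,y)-F(x-\frac{\Delta x}2,y)}{\Delta x}+\frac{G(x,y+\frac{\Delta y}2)-G(x,y-\frac{\Delta y}2)}{\Delta y}+r(z),$$ where the occurring values satisfy $|F|\le C\Delta x^k$, $|G|\le C\Delta y^k$, $|r|\le C(\Delta x^k+\Delta y^k)$: the numerical fluxes are $k$-th order accurate; (b) $|\tau(z)|\le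 C(\Delta x^k+\Delta y^k)$ for all $z\in K$, provided that every point of $K$ is regular in both directions. Here $z$ is regular in the direction $x$ if $B_x\ne0$ and $(B_y,B_z)\ne0$ at $z$, and no component of $\tilde R_x(u(z))^\top\partial_x^l(V\circ u)(z)$ vanishes for $1\le l\le k-1$; analogously for $y$. 2. *Entropy stability.* At all times at which $(U_{i,j})$ solves the scheme with admissible values, for all cells, $$\frac{d}{dt}\mathcal E(U_{i,j})+\frac{1}{\Delta x}\left(\hat q^k_{x,i+\frac12,j}-\hat q^k_{x,i-\frac12,j}\right)+\frac1{\Delta y}\left(\hat q^k_{y,i,j+\frac12}-\hat q^k_{y,i,j-\frac12}\right)\le0 .$$ -/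

import Mathlib

open scoped Matrix ContDiff

noncomputable section

namespace GLMCGL

/-! ## States of the GLM-CGL system -/

/-- Conservative variables `(ρ, ρv₁, ρv₂, ρv₃, p∥, E, B₁, B₂, B₃, Ψ)`. -/
abbrev State := Fin 10 → ℝ

/-- Assemble a vector of ten entries from its blocks (scalar, 3-vector, scalar, scalar, 3-vector,
scalar). -/
def pack (r : ℝ) (m : Fin 3 → ℝ) (p e : ℝ) (b : Fin 3 → ℝ) (s : ℝ) : State :=
  ![r, m 0, m 1, m 2, p, e, b 0, b 1, b 2, s]

/-- Density. -/
def rho (U : State) : ℝ := U 0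

/-- Velocity. -/
def vel (U : State) : Fin 3 → ℝ := ![U 1 / U 0, U 2 / U 0, U 3 / U 0]

/-- Parallel pressure `p∥`. -/
def ppar (U : State) : ℝ := U 4

/-- Magnetic field. -/
def mag (U : State) : Fin 3 → ℝ := ![U 6, U 7, U 8]

/-- The GLM variable `Ψ`. -/
def psi (U : State) : ℝ := U 9

/-- Perpendicular pressure `p⊥`, from the equation of state
`E = ρ|v|²/2 + |B|²/2 + (2p⊥ + p∥)/2 + Ψ²/2`. -/
def pperp (U : State) : ℝ :=
  U 5 - (rho U * (vel U ⬝ᵥ vel U) + mag U ⬝ᵥ mag U + ppar U + psi U ^ 2) / 2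

/-- Positive density and positive pressures. -/
def Positive (U : State) : Prop := 0 < rho U ∧ 0 < ppar U ∧ 0 < pperp U

/-- Admissible states: positive density and pressures, and a nonzero magnetic field, so that its
direction `b = B/|B|` is defined. -/
def Admissible (U : State) : Prop := Positive U ∧ mag U ≠ 0

/-- `β⊥ = ρ/p⊥`. -/
def betaPerp (U : State) : ℝ := rho U / pperp U

/-- `β∥ = ρ/p∥`. -/
def betaPar (U : State) : ℝ := rho U / ppar U

/-- `s = ln (p∥ p⊥² / ρ⁵)`. -/
def specificEntropy (U : State) : ℝ := Real.log (ppar U * pperp U ^ 2 / rho U ^ 5)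

/-- The entropy function `𝓔 = -ρ s`. -/
def entropy (U : State) : ℝ := -rho U * specificEntropy U

/-- The entropy variables `V = ∂𝓔/∂U`. -/
def entropyVar (U : State) : State :=
  pack (5 - specificEntropy U - betaPerp U * (vel U ⬝ᵥ vel U))
    (fun i => 2 * betaPerp U * vel U i)
    (betaPerp U - betaPar U)
    (-2 * betaPerp U)
    (fun i => 2 * betaPerp U * mag U i)
    (2 * betaPerp U * psi U)

/-! ## The partial differential equation

The index `d : Fin 2` is the coordinate direction, `0` for `x` and `1` for `y`. -/

/-- The component of a 3-vector normal to an interface in direction `d`. -/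
def nrm (d : Fin 2) : Fin 3 := ![0, 1] d

/-- The first tangential component; the second one is always `2`. -/
def tng (d : Fin 2) : Fin 3 := ![1, 0] d

/-- The conservative flux in direction `d` (with `e = E - Ψ²/2` in the energy component). -/
def flux (d : Fin 2) (ch : ℝ) (U : State) : State :=
  pack (rho U * vel U (nrm d))
    (fun i => rho U * vel U (nrm d) * vel U i - mag U (nrm d) * mag U i
      + if i = nrm d then pperp U + (mag U ⬝ᵥ mag U) / 2 else 0)
    (ppar U * vel U (nrm d))
    (vel U (nrm d) * ((U 5 - psi U ^ 2 / 2) + pperp U + (mag U ⬝ᵥ mag U) / 2)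
      - mag U (nrm d) * (mag U ⬝ᵥ vel U) + ch * psi U * mag U (nrm d))
    (fun i => vel U (nrm d) * mag U i - vel U i * mag U (nrm d)
      + if i = nrm d then ch * psi U else 0)
    (ch * mag U (nrm d))

/-- `Φ = 2ρ(v·B)/p⊥`. -/
def Phi (U : State) : ℝ := 2 * betaPerp U * (vel U ⬝ᵥ mag U)

/-- The Godunov vector `Φ'(V) = (0, B, 0, v·B, v, 0)`. -/
def godunov (U : State) : State :=
  pack 0 (mag U) 0 (vel U ⬝ᵥ mag U) (vel U) 0

/-- The GLM vector `Υ_d = (0, 0, 0, Ψ v_d, 0, v_d)`. -/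
def upsilon (d : Fin 2) (U : State) : State :=
  pack 0 0 0 (psi U * vel U (nrm d)) 0 (vel U (nrm d))

/-- The entropy potential `𝓕_d`. -/
def potential (d : Fin 2) (ch : ℝ) (U : State) : ℝ :=
  2 * rho U * vel U (nrm d) + betaPerp U * vel U (nrm d) * (mag U ⬝ᵥ mag U)
    + 2 * ch * betaPerp U * psi U * mag U (nrm d)

/-- The direction `b = B/|B|` of the magnetic field. -/
def bdir (U : State) : Fin 3 → ℝ := fun i => mag U i / √(mag U ⬝ᵥ mag U)

/-- The coordinate row vector `dU_j`. -/
def coord (j : Fin 10) : State := Pi.single j 1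

/-- The differentials of the velocity components with respect to `U`. -/
def dVel (U : State) : Fin 3 → State :=
  ![(rho U)⁻¹ • (coord 1 - vel U 0 • coord 0), (rho U)⁻¹ • (coord 2 - vel U 1 • coord 0),
    (rho U)⁻¹ • (coord 3 - vel U 2 • coord 0)]

/-- The differentials of the magnetic field components with respect to `U`. -/
def dMag : Fin 3 → State := ![coord 6, coord 7, coord 8]

/-- The differentials of the components of `b` with respect to `U`:
`db_i = (dB_i - b_i (b·dB))/|B|`. -/
def dBdir (U : State) (i : Fin 3) : State :=
  (√(mag U ⬝ᵥ mag U))⁻¹ • (dMag i - bdir U i • ∑ l, bdir U l • dMag l)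

/-- The differential of `p∥ - p⊥` with respect to `U`. -/
def dDeltaP (U : State) : State :=
  pack (-(vel U ⬝ᵥ vel U) / 2) (vel U) (3 / 2) (-1) (mag U) (psi U)

/-- The differential of `b_d b_i` with respect to `U`. -/
def dBB (d : Fin 2) (U : State) (i : Fin 3) : State :=
  bdir U i • dBdir U (nrm d) + bdir U (nrm d) • dBdir U i

/-- The momentum rows of `C_d(U)`: the differentials of `(p∥ - p⊥) b_d b_i`. -/
def ncMomentumRow (d : Fin 2) (U : State) (i : Fin 3) : State :=
  (bdir U (nrm d) * bdir U i) • dDeltaP U + (ppar U - pperp U) • dBB d U i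

/-- The matrix `C_d(U)` of the non-conservative terms. Its nonzero rows, applied to `∂_d U`, are
`∂_d((p∥ - p⊥) b_d b_i)` for the momentum, `2 p∥ b_d (b·∂_d v)` for `p∥`, and
`∂_d((p∥ - p⊥) b_d (b·v))` for the energy. -/
def ncMatrix (d : Fin 2) (U : State) : Matrix (Fin 10) (Fin 10) ℝ :=
  Matrix.of ![0, ncMomentumRow d U 0, ncMomentumRow d U 1, ncMomentumRow d U 2,
    (2 * ppar U * bdir U (nrm d)) • ∑ i, bdir U i • dVel U i,
    (∑ i, vel U i • ncMomentumRow d U i)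
      + ((ppar U - pperp U) * bdir U (nrm d)) • ∑ i, bdir U i • dVel U i,
    0, 0, 0, 0]

/-- The part in direction `d` of the spatial operator of the reformulated GLM-CGL system, along a
curve of states `u`:
`∂_d f_d + Φ'(V) ∂_d B_d + Υ_d ∂_d Ψ + C_d(U) ∂_d U`. -/
def pdePart (d : Fin 2) (ch : ℝ) (u : ℝ → State) (s : ℝ) : State :=
  deriv (fun r => flux d ch (u r)) s
    + deriv (fun r => mag (u r) (nrm d)) s • godunov (u s)
    + deriv (fun r => psi (u r)) s • upsilon d (u s)
    + ncMatrix d (u s) *ᵥ deriv u s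

/-- The spatial operator of the reformulated GLM-CGL system, which reads `∂_t U + pdeOp U = 0`. -/
def pdeOp (ch : ℝ) (u : ℝ × ℝ → State) (z : ℝ × ℝ) : State :=
  pdePart 0 ch (fun s => u (s, z.2)) z.1 + pdePart 1 ch (fun s => u (z.1, s)) z.2

/-! ## Entropy conservative fluxes -/

/-- Arithmetic mean of the values of `g` at two states. -/
def mean (g : State → ℝ) (a b : State) : ℝ := (g a + g b) / 2

/-- Logarithmic mean, `a^ln = ⟦a⟧/⟦ln a⟧`, extended by `a` on the diagonal. -/
def logMean (a b : ℝ) : ℝ := if a = b then a else (b - a) / (Real.log b - Real.log a)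

/-- First component of the two-point entropy conservative flux. -/
def ecMass (d : Fin 2) (a b : State) : ℝ :=
  logMean (rho a) (rho b) * mean (fun U => vel U (nrm d)) a b

/-- Momentum components of the two-point entropy conservative flux. -/
def ecMomentum (d : Fin 2) (a b : State) (i : Fin 3) : ℝ :=
  mean (fun U => vel U i) a b * ecMass d a b
    - mean (fun U => mag U (nrm d)) a b * mean (fun U => mag U i) a b
    + if i = nrm d then mean rho a b / mean betaPerp a b + mean (fun U => mag U ⬝ᵥ mag U) a b / 2
      else 0

/-- `p∥`-component of the two-point entropy conservative flux. -/
def ecPar (d : Fin 2) (a b : State) : ℝ := ecMass d a b / logMean (betaPar a) (betaPar b)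

/-- Magnetic components of the two-point entropy conservative flux. -/
def ecMag (d : Fin 2) (ch : ℝ) (a b : State) (i : Fin 3) : ℝ :=
  (mean (fun U => betaPerp U * vel U (nrm d)) a b * mean (fun U => mag U i) a b
      - mean (fun U => betaPerp U * vel U i) a b * mean (fun U => mag U (nrm d)) a b)
      / mean betaPerp a b
    + if i = nrm d then ch * mean (fun U => psi U * betaPerp U) a b / mean betaPerp a b else 0

/-- Energy component of the two-point entropy conservative flux. -/
def ecEnergy (d : Fin 2) (ch : ℝ) (a b : State) : ℝ :=
  (2 / logMean (betaPerp a) (betaPerp b) - mean (fun U => vel U ⬝ᵥ vel U) a b) / 2 * ecMass d a b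
    + (∑ i, mean (fun U => vel U i) a b * ecMomentum d a b i)
    + ecPar d a b / 2
    + (∑ i, mean (fun U => mag U i) a b * ecMag d ch a b i)
    - mean (fun U => vel U (nrm d)) a b * mean (fun U => mag U ⬝ᵥ mag U) a b / 2
    + (∑ i, mean (fun U => vel U i) a b * mean (fun U => mag U i) a b)
      * mean (fun U => mag U (nrm d)) a b

/-- The GLM-extended two-point entropy conservative flux in direction `d`. -/
def ecFlux (d : Fin 2) (ch : ℝ) (a b : State) : State :=
  pack (ecMass d a b) (ecMomentum d a b) (ecPar d a b) (ecEnergy d ch a b) (ecMag d ch a b)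
    (ch * mean (fun U => mag U (nrm d)) a b)

/-- The numerical entropy flux of the two-point entropy conservative flux:
`V̄·f̃ + Φ̄ B̄_d - 𝓕̄_d`. -/
def ecEntropyFlux (d : Fin 2) (ch : ℝ) (a b : State) : ℝ :=
  ((1 / 2 : ℝ) • (entropyVar a + entropyVar b)) ⬝ᵥ ecFlux d ch a b
    + mean Phi a b * mean (fun U => mag U (nrm d)) a b
    - mean (potential d ch) a b

/-- The combination of two-point functions `g` along a line of states that gives the value at the
interface `i + 1/2` of order `2p`, where `p = 1` for `k = 2` and `p = 2` otherwise. -/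
def highOrder {E : Type*} [AddCommGroup E] [Module ℝ E] (k : ℕ) (g : State → State → E)
    (u : ℤ → State) (i : ℤ) : E :=
  if k = 2 then g (u i) (u (i + 1))
  else (4 / 3 : ℝ) • g (u i) (u (i + 1))
    - (1 / 6 : ℝ) • (g (u (i - 1)) (u (i + 1)) + g (u i) (u (i + 2)))

/-! ## Entropy-scaled eigenvectors and Rusanov diffusion -/

/-- `a² = 2p⊥/ρ`. -/
def aSq (U : State) : ℝ := 2 * pperp U / rho U

/-- `v_a² = |B|²/ρ`. -/
def vaSq (U : State) : ℝ := (mag U ⬝ᵥ mag U) / rho U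

/-- `v_{ad} = |B_d|/√ρ`. -/
def alfven (d : Fin 2) (U : State) : ℝ := |mag U (nrm d)| / √(rho U)

/-- `√((v_a² + a²)² - 4 v_{ad}² a²)`. -/
def discRoot (d : Fin 2) (U : State) : ℝ :=
  √((vaSq U + aSq U) ^ 2 - 4 * alfven d U ^ 2 * aSq U)

/-- `c_f²`. -/
def cfSq (d : Fin 2) (U : State) : ℝ := (vaSq U + aSq U + discRoot d U) / 2

/-- `c_s²`. -/
def csSq (d : Fin 2) (U : State) : ℝ := (vaSq U + aSq U - discRoot d U) / 2

/-- `α_f`; the value `1/√2` is taken where `c_f = c_s`. -/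
def alphaF (d : Fin 2) (U : State) : ℝ :=
  if cfSq d U = csSq d U then 1 / √2 else √((aSq U - csSq d U) / (cfSq d U - csSq d U))

/-- `α_s`; the value `1/√2` is taken where `c_f = c_s`. -/
def alphaS (d : Fin 2) (U : State) : ℝ :=
  if cfSq d U = csSq d U then 1 / √2 else √((cfSq d U - aSq U) / (cfSq d U - csSq d U))

/-- The normalized tangential magnetic field; `(1/√2, 1/√2)` is taken where it vanishes. -/
def betaTan (d : Fin 2) (U : State) : Fin 2 → ℝ :=
  if mag U (tng d) = 0 ∧ mag U 2 = 0 then ![1 / √2, 1 / √2]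
  else ![mag U (tng d) / √(mag U (tng d) ^ 2 + mag U 2 ^ 2),
    mag U 2 / √(mag U (tng d) ^ 2 + mag U 2 ^ 2)]

/-- The sign of the normal magnetic field, with the convention `sgn 0 = 1`. -/
def sgnB (d : Fin 2) (U : State) : ℝ := if mag U (nrm d) < 0 then -1 else 1

/-- The 3-vector with normal component `x` and tangential components `y`, `z`. -/
def frame (d : Fin 2) (x y z : ℝ) : Fin 3 → ℝ :=
  fun i => if i = nrm d then x else if i = tng d then y else z

/-- Right eigenvectors for `v_d ± c_f` (`σ = ±1`) in primitive variables
`(ρ, v, p∥, p⊥, B, Ψ)`. -/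
def eigFast (d : Fin 2) (U : State) (σ : ℝ) : State :=
  pack (alphaF d U * rho U)
    (frame d (σ * alphaF d U * √(cfSq d U))
      (-σ * alphaS d U * √(csSq d U) * betaTan d U 0 * sgnB d U)
      (-σ * alphaS d U * √(csSq d U) * betaTan d U 1 * sgnB d U))
    (alphaF d U * ppar U) (alphaF d U * rho U * aSq U)
    (frame d 0 (alphaS d U * √(aSq U) * betaTan d U 0 * √(rho U))
      (alphaS d U * √(aSq U) * betaTan d U 1 * √(rho U)))
    0

/-- Right eigenvectors for `v_d ± c_s` in primitive variables. -/
def eigSlow (d : Fin 2) (U : State) (σ : ℝ) : State :=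
  pack (alphaS d U * rho U)
    (frame d (σ * alphaS d U * √(csSq d U))
      (σ * alphaF d U * √(cfSq d U) * betaTan d U 0 * sgnB d U)
      (σ * alphaF d U * √(cfSq d U) * betaTan d U 1 * sgnB d U))
    (alphaS d U * ppar U) (alphaS d U * rho U * aSq U)
    (frame d 0 (-alphaF d U * √(aSq U) * betaTan d U 0 * √(rho U))
      (-alphaF d U * √(aSq U) * betaTan d U 1 * √(rho U)))
    0

/-- Right eigenvectors for `v_d ± v_{ad}` in primitive variables. -/
def eigAlfven (d : Fin 2) (U : State) (σ : ℝ) : State :=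
  pack 0 (frame d 0 (σ * betaTan d U 1) (-σ * betaTan d U 0)) 0 0
    (frame d 0 (-betaTan d U 1 * sgnB d U * √(rho U)) (betaTan d U 0 * sgnB d U * √(rho U))) 0

/-- Right eigenvectors for `v_d ± c_h` in primitive variables. -/
def eigGLM (d : Fin 2) (σ : ℝ) : State := pack 0 0 0 0 (frame d σ 0 0) 1

/-- The matrix of right eigenvectors in primitive variables, with columns in the order
`v_d - c_f, v_d - c_s, v_d - c_h, v_d - v_{ad}, v_d, v_d, v_d + v_{ad}, v_d + c_h, v_d + c_s,
v_d + c_f`. -/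
def eigPrim (d : Fin 2) (U : State) : Matrix (Fin 10) (Fin 10) ℝ :=
  (Matrix.of ![eigFast d U (-1), eigSlow d U (-1), eigGLM d (-1), eigAlfven d U (-1),
    coord 0, coord 4, eigAlfven d U 1, eigGLM d 1, eigSlow d U 1, eigFast d U 1])ᵀ

/-- The Jacobian `∂U/∂w` for the primitive variables `w = (ρ, v, p∥, p⊥, B, Ψ)`. -/
def jacPrim (U : State) : Matrix (Fin 10) (Fin 10) ℝ :=
  Matrix.of ![coord 0,
    vel U 0 • coord 0 + rho U • coord 1,
    vel U 1 • coord 0 + rho U • coord 2,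
    vel U 2 • coord 0 + rho U • coord 3,
    coord 4,
    pack ((vel U ⬝ᵥ vel U) / 2) (rho U • vel U) (1 / 2) 1 (mag U) (psi U),
    coord 6, coord 7, coord 8, coord 9]

/-- `√(5p∥² + 4p∥ρ + ρ²)`. -/
def scaleRoot (U : State) : ℝ := √(5 * ppar U ^ 2 + 4 * ppar U * rho U + rho U ^ 2)

/-- The scaling matrix `T` of the eigenvectors. -/
def scaling (U : State) : Matrix (Fin 10) (Fin 10) ℝ :=
  Matrix.diagonal ![1 / (2 * √(2 * rho U)), 1 / (2 * √(2 * rho U)),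
      √(pperp U) / (2 * √(rho U)), √(pperp U) / (2 * rho U),
      √(rho U) * (2 * ppar U + rho U) / (2 * scaleRoot U),
      ppar U * (5 * ppar U + 2 * rho U) / (2 * √(rho U) * scaleRoot U),
      √(pperp U) / (2 * rho U), √(pperp U) / (2 * √(rho U)),
      1 / (2 * √(2 * rho U)), 1 / (2 * √(2 * rho U))]
    + (ppar U * √(rho U) / (2 * scaleRoot U)) • (Matrix.single 4 5 1 + Matrix.single 5 4 1)

/-- The matrix `R̃_d` of entropy-scaled right eigenvectors in conservative variables. -/
def scaledEig (d : Fin 2) (U : State) : Matrix (Fin 10) (Fin 10) ℝ :=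
  jacPrim U * eigPrim d U * scaling U

/-- The eigenvalues in direction `d`. -/
def eigenvalue (d : Fin 2) (ch : ℝ) (U : State) : Fin 10 → ℝ :=
  ![vel U (nrm d), vel U (nrm d),
    vel U (nrm d) + alfven d U, vel U (nrm d) - alfven d U,
    vel U (nrm d) + ch, vel U (nrm d) - ch,
    vel U (nrm d) + √(cfSq d U), vel U (nrm d) - √(cfSq d U),
    vel U (nrm d) + √(csSq d U), vel U (nrm d) - √(csSq d U)]

/-- The Rusanov speed `max_k |λ_d^k|`. -/
def rusanov (d : Fin 2) (ch : ℝ) (U : State) : ℝ :=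
  Finset.univ.sup' Finset.univ_nonempty fun l => |eigenvalue d ch U l|

/-- The diffusion matrix `D_d = R̃_d Λ_d R̃_dᵀ`, with `Λ_d` the Rusanov speed times the
identity. -/
def diffusion (d : Fin 2) (ch : ℝ) (U : State) : Matrix (Fin 10) (Fin 10) ℝ :=
  scaledEig d U * (rusanov d ch U • (1 : Matrix (Fin 10) (Fin 10) ℝ)) * (scaledEig d U)ᵀ

/-- Rules for the state at which the eigenvectors and the speed are evaluated at an interface
between two states: consistent, positivity preserving and smooth (for example an arithmetic mean). -/
def IsInterfaceState (m : State → State → State) : Prop :=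
  (∀ a, Positive a → m a a = a) ∧
  (∀ a b, Positive a → Positive b → Positive (m a b)) ∧
  ContDiffOn ℝ ∞ (fun w : State × State => m w.1 w.2) {w | Positive w.1 ∧ Positive w.2}

/-! ## Sign-preserving reconstruction

Sequences of grid values are indexed by `ℤ`, and positions on the grid line are measured in units
of the mesh size: `x_i` is `i`, and the cell number `i` is the interval `[i - 1/2, i + 1/2]`. -/

/-- The minmod limiter. -/
def minmod (a b : ℝ) : ℝ := if 0 < a * b then (if |a| < |b| then a else b) else 0

/-- The ENO stencil selection: the leftmost index of the stencil of cell `i` after `n`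
extensions. The stencil `r, …, r + n` is extended to the side with the smaller undivided difference
of order `n + 1`. -/
def enoLeft (w : ℤ → ℝ) (i : ℤ) : ℕ → ℤ
  | 0 => i
  | n + 1 =>
    if |(fwdDiff (1 : ℤ))^[n + 1] w (enoLeft w i n - 1)| < |(fwdDiff (1 : ℤ))^[n + 1] w (enoLeft w i n)|
    then enoLeft w i n - 1 else enoLeft w i n

/-- The two customary forms of the ENO polynomial: the grid values are matched as cell averages
(ENO reconstruction) or as point values (ENO interpolation). -/
inductive ENOKind
  | cellAverage
  | pointValue

/-- The polynomial of degree less than `k` that matches `w` on the cells `r, …, r + k - 1`. For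
cell averages it is the derivative of the interpolant of the primitive function at the cell
boundaries. -/
def enoPoly (κ : ENOKind) (k : ℕ) (w : ℤ → ℝ) (r : ℤ) : Polynomial ℝ :=
  match κ with
  | ENOKind.cellAverage =>
    Polynomial.derivative (Lagrange.interpolate (Finset.Icc r (r + k))
      (fun j : ℤ => (j : ℝ) - 1 / 2) (fun j : ℤ => ∑ l ∈ Finset.Ico r j, w l))
  | ENOKind.pointValue =>
    Lagrange.interpolate (Finset.Ico r (r + k)) (fun j : ℤ => (j : ℝ)) w

/-- The value at the position `x` of the reconstruction in cell `i` of order `k`: MinMod for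
`k = 2`, ENO of order `k` otherwise. -/
def reconstruct (κ : ENOKind) (k : ℕ) (w : ℤ → ℝ) (i : ℤ) (x : ℝ) : ℝ :=
  if k = 2 then w i + minmod (w i - w (i - 1)) (w (i + 1) - w i) * (x - i)
  else (enoPoly κ k w (enoLeft w i (k - 1))).eval x

/-- The reconstructed entropy variables in cell `i` at `x`: the scaled entropy variables `Rᵀ V` are
reconstructed componentwise, and transformed back. -/
def reconstructV (κ : ENOKind) (k : ℕ) (R : Matrix (Fin 10) (Fin 10) ℝ) (u : ℤ → State) (i : ℤ)
    (x : ℝ) : State :=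
  (Rᵀ)⁻¹ *ᵥ fun m => reconstruct κ k (fun j => (Rᵀ *ᵥ entropyVar (u j)) m) i x

/-- The jump at `i + 1/2` of the reconstructed entropy variables. -/
def jumpV (κ : ENOKind) (k : ℕ) (R : Matrix (Fin 10) (Fin 10) ℝ) (u : ℤ → State) (i : ℤ) : State :=
  reconstructV κ k R u (i + 1) (i + 1 / 2) - reconstructV κ k R u i (i + 1 / 2)

/-! ## The semi-discrete scheme

In direction `d`, with a rule `m` for the interface states, along a grid line `u : ℤ → State`. -/

/-- The diffusive vector `D ⟦V̂⟧` at `i + 1/2`. -/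
def diffusive (κ : ENOKind) (k : ℕ) (d : Fin 2) (ch : ℝ) (m : State → State → State)
    (u : ℤ → State) (i : ℤ) : State :=
  diffusion d ch (m (u i) (u (i + 1))) *ᵥ jumpV κ k (scaledEig d (m (u i) (u (i + 1)))) u i

/-- The entropy stable numerical flux at `i + 1/2`. -/
def esFlux (κ : ENOKind) (k : ℕ) (d : Fin 2) (ch : ℝ) (m : State → State → State)
    (u : ℤ → State) (i : ℤ) : State :=
  highOrder k (ecFlux d ch) u i - (1 / 2 : ℝ) • diffusive κ k d ch m u i

/-- The numerical entropy flux at `i + 1/2`. -/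
def esEntropyFlux (κ : ENOKind) (k : ℕ) (d : Fin 2) (ch : ℝ) (m : State → State → State)
    (u : ℤ → State) (i : ℤ) : ℝ :=
  highOrder k (ecEntropyFlux d ch) u i
    - (1 / 2) * (((1 / 2 : ℝ) • (entropyVar (u i) + entropyVar (u (i + 1))))
        ⬝ᵥ diffusive κ k d ch m u i)

/-- Central difference with mesh size `h`, of second order for `k = 2` and of fourth order
otherwise. -/
def central {E : Type*} [AddCommGroup E] [Module ℝ E] (k : ℕ) (h : ℝ) (a : ℤ → E) (i : ℤ) : E :=
  if k = 2 then (2 * h)⁻¹ • (a (i + 1) - a (i - 1))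
  else (12 * h)⁻¹ •
    (-a (i + 2) + (8 : ℝ) • a (i + 1) - (8 : ℝ) • a (i - 1) + a (i - 2))

/-- The part in direction `d` of the spatial operator of the scheme. -/
def schemePart (κ : ENOKind) (k : ℕ) (d : Fin 2) (ch : ℝ) (m : State → State → State) (h : ℝ)
    (u : ℤ → State) (i : ℤ) : State :=
  h⁻¹ • (esFlux κ k d ch m u i - esFlux κ k d ch m u (i - 1))
    + central k h (fun j => mag (u j) (nrm d)) i • godunov (u i)
    + central k h (fun j => psi (u j)) i • upsilon d (u i)
    + ncMatrix d (u i) *ᵥ central k h u i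

/-- The spatial operator of the scheme; the scheme reads `dU_{i,j}/dt + schemeOp U i j = 0`. The
mesh sizes are `hx`, `hy`, and `m d` is the rule for the interface states in direction `d`. -/
def schemeOp (κ : ENOKind) (k : ℕ) (ch : ℝ) (m : Fin 2 → State → State → State) (hx hy : ℝ)
    (U : ℤ → ℤ → State) (i j : ℤ) : State :=
  schemePart κ k 0 ch (m 0) hx (fun l => U l j) i + schemePart κ k 1 ch (m 1) hy (fun l => U i l) j

/-- `U` is an admissible solution of the semi-discrete scheme at the times in `I`. -/
def IsSolution (κ : ENOKind) (k : ℕ) (ch : ℝ) (m : Fin 2 → State → State → State) (hx hy : ℝ)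
    (U : ℝ → ℤ → ℤ → State) (I : Set ℝ) : Prop :=
  ∀ t ∈ I, ∀ i j, Admissible (U t i j) ∧
    HasDerivAt (fun s => U s i j) (-schemeOp κ k ch m hx hy (U t) i j) t

/-- The spatial truncation error at `z` for the field `u`: the scheme, applied to the values of `u`
on the grid through `z`, minus the operator of the differential equation. -/
def truncationError (κ : ENOKind) (k : ℕ) (ch : ℝ) (m : Fin 2 → State → State → State) (hx hy : ℝ)
    (u : ℝ × ℝ → State) (z : ℝ × ℝ) : State :=
  schemeOp κ k ch m hx hy (fun i j => u (z.1 + i * hx, z.2 + j * hy)) 0 0 - pdeOp ch u z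

/-- The reconstruction in direction `d` is regular at `s` along the curve of states `u`: the
eigenvectors depend smoothly on the state there, and no scaled entropy variable (scaled with the
eigenvectors at `s`) has a vanishing derivative of order `1, …, k - 1`. -/
def RegularAt (k : ℕ) (d : Fin 2) (u : ℝ → State) (s : ℝ) : Prop :=
  mag (u s) (nrm d) ≠ 0 ∧ (mag (u s) (tng d) ≠ 0 ∨ mag (u s) 2 ≠ 0) ∧
  ∀ l : ℕ, 1 ≤ l → l < k → ∀ c : Fin 10,
    ((scaledEig d (u s))ᵀ *ᵥ iteratedDeriv l (fun r => entropyVar (u r)) s) c ≠ 0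

end GLMCGL

end

noncomputable section

namespace GLMCGL

/-! ## Forward differences and polynomial interpolation on the integers -/

/-! Entropy stability and accuracy are separate arguments; both rest on an explicit formula for the
jump of the reconstruction at an interface.

Entropy. Since V is the gradient of the entropy (`hasDerivAt_entropy`), pair the scheme with V_i.
The two-point flux satisfies ⟦V⟧·f̃ = ⟦𝓕⟧ - ⟦Φ⟧ B̄_d (`jump_dotProduct_ecFlux`). Hence, without
diffusion, the pairing is exactly a difference of q̃: the Godunov term absorbs the Φ contributions,
while Υ_d and every vector C_d(U)x are orthogonal to V (`entropyVar_dotProduct_highOrder`). The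
diffusion leaves an excess ⟦V⟧·D⟦V̂⟧/(4h) at each of the two interfaces. As Λ is a scalar matrix,
this is a nonnegative multiple of a sum of products ⟦w⟧⟦ŵ⟧ over the scaled variables, and each
product is nonnegative by the sign property `reconJump_mul_nonneg`. For ENO, the jump ⟦ŵ⟧ is a sum
of multiples of the k-th differences of w, over the indices between the left ends of the stencils of
the two cells. The coefficients alternate in sign (`enoCoeff_sign`), and stencil selection makes the
differences alternate in the same pattern, up to the sign of ⟦w⟧ (`enoLeft_sign`).

Accuracy. By symmetry and consistency of f̃, the flux differences are twice the central difference
of f̃(u_0, ·) (`highOrder_sub_eq_central`), so all terms except the diffusion are central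
differences and Taylor expansion gives order k. The same jump formula bounds ⟦ŵ⟧ by k-th
differences; R̃ is locally bounded even where it is discontinuous, so the diffusive flux is O(h^k)
(`diffusive_isBigO`). This is claim (a).

For (b) the difference of two neighbouring diffusive fluxes must be O(h^(k+1)). At a regular point
R̃ is smooth and invertible, and the differences of orders below k of the scaled variables have
fixed signs for small h. Then only the last stencil choice depends on the data, and the jump is a
fixed Lipschitz function of two k-th differences (`reconJump_of_sign`). These vary by O(h^(k+1))
between neighbouring interfaces. All estimates hold locally uniformly in the base point, and
compactness of K makes the constants uniform. -/

theorem fwdDiff_iter_succ_apply {E : Type*} [AddCommGroup E] (w : ℤ → E) (n : ℕ) (s : ℤ) :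
    (fwdDiff (1 : ℤ))^[n + 1] w s
      = (fwdDiff (1 : ℤ))^[n] w (s + 1) - (fwdDiff (1 : ℤ))^[n] w s := by
  rw [Function.iterate_succ_apply', fwdDiff]

/-- Transfers facts about differences of polynomials of a real variable to sequences indexed by ℤ.
-/
theorem fwdDiff_iter_intCast (F : ℝ → ℝ) (n : ℕ) (y : ℤ) :
    (fwdDiff (1 : ℤ))^[n] (fun j : ℤ => F j) y = (fwdDiff (1 : ℝ))^[n] F y := by
  simp [fwdDiff_iter_eq_sum_shift]

theorem fwdDiff_iter_eval_eq_zero (P : Polynomial ℝ) (a : ℝ) {n : ℕ} (hP : P.degree < n) (y : ℤ) :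
    (fwdDiff (1 : ℤ))^[n] (fun j : ℤ => P.eval ((j : ℝ) - a)) y = 0 := by
  rw [fwdDiff_iter_intCast (fun x => P.eval (x - a)) n y]
  simp only [sub_eq_add_neg]
  rw [fwdDiff_iter_comp_add (1 : ℝ) (fun x => P.eval x) (-a) n y]
  rcases eq_or_ne P 0 with rfl | h0
  · simp [fwdDiff_iter_eq_sum_shift]
  · have h := Polynomial.fwdDiff_iter_eq_zero_of_degree_lt
      ((Polynomial.natDegree_lt_iff_degree_lt h0).2 hP)
    exact congrFun h _

/-- Only the last term of the binomial sum survives. Applied to an interpolation error, it evaluates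
that error at the first node outside the stencil. -/
theorem fwdDiff_iter_eq_of_vanish (g : ℤ → ℝ) (n : ℕ) (s : ℤ)
    (hg : ∀ j ∈ Finset.Ico s (s + n), g j = 0) :
    (fwdDiff (1 : ℤ))^[n] g s = g (s + n) := by
  rw [fwdDiff_iter_eq_sum_shift, Finset.sum_range_succ, Finset.sum_eq_zero]
  · simp
  · intro l hl
    have hl' := Finset.mem_range.1 hl
    rw [hg _ (by simp; omega), smul_zero]

/-- Two interpolants on neighbouring stencils differ by a multiple of the nodal polynomial of the
common nodes. -/
theorem interpolate_shift_sub (f : ℤ → ℝ) (a : ℝ) (n : ℕ) (s : ℤ) :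
    Lagrange.interpolate (Finset.Ico (s + 1) (s + 1 + (n + 1 : ℕ))) (fun j : ℤ => (j : ℝ) - a) f
      - Lagrange.interpolate (Finset.Ico s (s + (n + 1 : ℕ))) (fun j : ℤ => (j : ℝ) - a) f
    = Polynomial.C ((fwdDiff (1 : ℤ))^[n + 1] f s / n.factorial)
      * ∏ j ∈ Finset.range n, (Polynomial.X - Polynomial.C ((s : ℝ) + 1 + j - a)) := by
  have inj : ∀ S : Set ℤ, Set.InjOn (fun j : ℤ => (j : ℝ) - a) S := fun S x _ y _ h => by
    simpa using h
  have dS := Lagrange.degree_interpolate_lt f (inj (Finset.Ico s (s + (n + 1 : ℕ)) : Finset ℤ))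
  have dT := Lagrange.degree_interpolate_lt f
    (inj (Finset.Ico (s + 1) (s + 1 + (n + 1 : ℕ)) : Finset ℤ))
  have c1 : (Finset.Ico s (s + (n + 1 : ℕ))).card = n + 1 := by simp
  have c2 : (Finset.Ico (s + 1) (s + 1 + (n + 1 : ℕ))).card = n + 1 := by simp
  rw [c1] at dS
  rw [c2] at dT
  -- Both sides have degree at most n, so agreement at the n + 1 nodes of the right-hand stencil
  -- suffices.
  refine Polynomial.eq_of_degrees_lt_of_eval_index_eq (Finset.Ico (s + 1) (s + 1 + (n + 1 : ℕ)))
    (inj _) ?_ ?_ ?_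
  · rw [c2]
    exact (Polynomial.degree_sub_le _ _).trans_lt (max_lt dT dS)
  · rw [c2]
    refine (Polynomial.degree_mul_le _ _).trans_lt ?_
    have h1 : (∏ j ∈ Finset.range n,
        (Polynomial.X - Polynomial.C ((s : ℝ) + 1 + j - a))).degree = (n : WithBot ℕ) := by
      rw [Polynomial.degree_prod]
      simp only [Polynomial.degree_X_sub_C]
      simp
    rw [h1]
    have h2 := Polynomial.degree_C_le (a := (fwdDiff (1 : ℤ))^[n + 1] f s / n.factorial)
    calc _ ≤ (0 : WithBot ℕ) + n := by gcongr
      _ < _ := by rw [zero_add]; exact_mod_cast Nat.lt_succ_self n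
  · intro i hi
    have hi' := Finset.mem_Ico.1 hi
    rw [Polynomial.eval_sub, Lagrange.eval_interpolate_at_node f (inj _) hi, Polynomial.eval_mul,
      Polynomial.eval_C, Polynomial.eval_prod]
    simp only [Polynomial.eval_sub, Polynomial.eval_X, Polynomial.eval_C]
    -- At the new node the left side is the error of the old interpolant. As that interpolant has
    -- degree at most n, the error there is the difference of f of order n + 1, and the nodal
    -- product is n!. At the common nodes both sides vanish.
    by_cases hlast : i = s + (n + 1 : ℕ)
    · have key := fwdDiff_iter_eq_of_vanish
        (fun j => f j - (Lagrange.interpolate (Finset.Ico s (s + (n + 1 : ℕ)))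
          (fun j : ℤ => (j : ℝ) - a) f).eval ((j : ℝ) - a)) (n + 1) s (by
          intro j hj
          rw [Lagrange.eval_interpolate_at_node f (inj _) hj, sub_self])
      have hadd := congrFun (fwdDiff_iter_add (1 : ℤ) f
        (fun j => -(Lagrange.interpolate (Finset.Ico s (s + (n + 1 : ℕ)))
          (fun j : ℤ => (j : ℝ) - a) f).eval ((j : ℝ) - a)) (n + 1)) s
      have hz : (fwdDiff (1 : ℤ))^[n + 1]
          (fun j : ℤ => -(Lagrange.interpolate (Finset.Ico s (s + (n + 1 : ℕ)))
          (fun j : ℤ => (j : ℝ) - a) f).eval ((j : ℝ) - a)) s = 0 := by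
        simpa only [Polynomial.eval_neg] using fwdDiff_iter_eval_eq_zero (-(Lagrange.interpolate (Finset.Ico s
          (s + (n + 1 : ℕ))) (fun j : ℤ => (j : ℝ) - a) f)) a (by rw [Polynomial.degree_neg]; exact dS) s
      rw [Pi.add_apply, hz, add_zero] at hadd
      have hprod : ∏ x ∈ Finset.range n, ((i : ℝ) - a - ((s : ℝ) + 1 + x - a)) = n.factorial := by
        rw [← Finset.prod_range_add_one_eq_factorial, ← Finset.prod_range_reflect]
        push_cast
        refine Finset.prod_congr rfl fun x hx => ?_
        have hx' := Finset.mem_range.1 hx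
        rw [hlast, Nat.sub_sub, Nat.cast_sub (by omega)]
        push_cast
        ring
      rw [hprod, div_mul_cancel₀ _ (by positivity), hlast]
      rw [← hadd]
      exact key.symm
    · have hi2 : i ∈ Finset.Ico s (s + (n + 1 : ℕ)) := by
        rw [Finset.mem_Ico]; push_cast at *; omega
      rw [Lagrange.eval_interpolate_at_node f (inj _) hi2, sub_self]
      symm
      apply mul_eq_zero_of_right
      refine Finset.prod_eq_zero (i := (i - s - 1).toNat) ?_ ?_
      · rw [Finset.mem_range]; push_cast at *; omega
      · have h3 : (((i - s - 1).toNat : ℤ) : ℝ) = ((i - s - 1 : ℤ) : ℝ) := by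
          rw [Int.toNat_of_nonneg (by omega)]
        rw [Int.cast_natCast] at h3
        rw [h3]
        push_cast
        ring

/-! ## Jumps of the reconstruction -/

/-- The coefficient of `Δ^k w (i + t)` in the difference at `i + 1/2` of the reconstruction
polynomials with stencils starting at `i + t + 1` and `i + t`. -/
def enoCoeff (κ : ENOKind) (k : ℕ) (t : ℤ) : ℝ :=
  match κ with
  | ENOKind.cellAverage => (Polynomial.derivative (∏ j ∈ Finset.range k,
      (Polynomial.X - Polynomial.C ((t : ℝ) + 1 + j)))).eval 1 / k.factorial
  | ENOKind.pointValue => (∏ j ∈ Finset.range (k - 1), (1 / 2 - ((t : ℝ) + 1 + j)))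
      / (k - 1).factorial

/-- Point values follow from `interpolate_shift_sub` at the interface. For cell averages that lemma
is applied to the primitive function and differentiated; a difference of order k + 1 of the
primitive is one of order k of w. -/
theorem enoPoly_shift_sub (κ : ENOKind) {k : ℕ} (hk : 0 < k) (w : ℤ → ℝ) (i s : ℤ) :
    (enoPoly κ k w (s + 1)).eval ((i : ℝ) + 1 / 2) - (enoPoly κ k w s).eval ((i : ℝ) + 1 / 2)
      = enoCoeff κ k (s - i) * (fwdDiff (1 : ℤ))^[k] w s := by
  obtain ⟨n, rfl⟩ : ∃ n, k = n + 1 := ⟨k - 1, by omega⟩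
  cases κ with
  | pointValue =>
    have h := interpolate_shift_sub w 0 n s
    simp only [sub_zero] at h
    simp only [enoPoly, enoCoeff]
    rw [← Polynomial.eval_sub, h]
    simp only [Polynomial.eval_mul, Polynomial.eval_C, Polynomial.eval_prod, Polynomial.eval_sub,
      Polynomial.eval_X, Nat.add_sub_cancel]
    have : ∀ j : ℕ, (i : ℝ) + 1 / 2 - ((s : ℝ) + 1 + j) = 1 / 2 - (((s - i : ℤ) : ℝ) + 1 + j) := by
      intro j; push_cast; ring
    simp only [this]
    ring
  | cellAverage =>
    simp only [enoPoly, enoCoeff]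
    have hI : ∀ r : ℤ, Finset.Icc r (r + (n + 1 : ℕ)) = Finset.Ico r (r + (n + 1 + 1 : ℕ)) := by
      intro r; ext x; simp only [Finset.mem_Icc, Finset.mem_Ico]; push_cast; omega
    rw [hI, hI]
    set W : ℤ → ℝ := fun j => ∑ l ∈ Finset.Ico s j, w l with hW
    have inj : ∀ S : Set ℤ, Set.InjOn (fun j : ℤ => (j : ℝ) - 1 / 2) S := fun S x _ y _ h => by
      simpa using h
    have h := interpolate_shift_sub W (1 / 2) (n + 1) s
    -- The primitives anchored at s and at s + 1 differ by the constant w s, which disappears on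
    -- differentiation.
    have hshift : Lagrange.interpolate (Finset.Ico (s + 1) (s + 1 + (n + 1 + 1 : ℕ)))
        (fun j : ℤ => (j : ℝ) - 1 / 2) (fun j : ℤ => ∑ l ∈ Finset.Ico (s + 1) j, w l)
        = Lagrange.interpolate (Finset.Ico (s + 1) (s + 1 + (n + 1 + 1 : ℕ)))
          (fun j : ℤ => (j : ℝ) - 1 / 2) W - Polynomial.C (w s) := by
      symm
      apply Lagrange.eq_interpolate_of_eval_eq _ (inj _)
      · refine (Polynomial.degree_sub_le _ _).trans_lt (max_lt
          (Lagrange.degree_interpolate_lt _ (inj _)) (Polynomial.degree_C_le.trans_lt ?_))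
        rw [Int.card_Ico]
        exact_mod_cast (by omega : 0 < (s + 1 + (n + 1 + 1 : ℕ) - (s + 1)).toNat)
      · intro j hj
        rw [Polynomial.eval_sub, Lagrange.eval_interpolate_at_node _ (inj _) hj, Polynomial.eval_C,
          hW]
        have hj' := Finset.mem_Ico.1 hj
        simp only
        have : Finset.Ico s j = insert s (Finset.Ico (s + 1) j) := by
          ext x; simp only [Finset.mem_Ico, Finset.mem_insert]; omega
        rw [this, Finset.sum_insert (by simp)]
        ring
    have hd : (fwdDiff (1 : ℤ))^[n + 1 + 1] W s = (fwdDiff (1 : ℤ))^[n + 1] w s := by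
      rw [Function.iterate_succ_apply, fwdDiff_iter_eq_sum_shift, fwdDiff_iter_eq_sum_shift]
      refine Finset.sum_congr rfl fun l _ => ?_
      congr 1
      rw [fwdDiff, hW]
      simp only
      have : Finset.Ico s (s + l • (1 : ℤ) + 1)
          = insert (s + l • (1 : ℤ)) (Finset.Ico s (s + l • (1 : ℤ))) := by
        ext x; simp only [Finset.mem_Ico, Finset.mem_insert, nsmul_eq_mul]; omega
      rw [this, Finset.sum_insert (by simp)]
      ring
    rw [hshift, Polynomial.derivative_sub, Polynomial.derivative_C, sub_zero, ← Polynomial.eval_sub,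
      ← Polynomial.derivative_sub, h, hd, Polynomial.derivative_C_mul, Polynomial.eval_C_mul]
    -- Translating by i - 1/2 moves the cell boundaries to integers and the interface i + 1/2 to the
    -- point 1.
    have hcomp : ∏ j ∈ Finset.range (n + 1),
          (Polynomial.X - Polynomial.C ((s : ℝ) + 1 + j - 1 / 2))
        = (∏ j ∈ Finset.range (n + 1),
          (Polynomial.X - Polynomial.C (((s - i : ℤ) : ℝ) + 1 + j))).comp
            (Polynomial.X - Polynomial.C ((i : ℝ) - 1 / 2)) := by
      rw [Polynomial.prod_comp]
      refine Finset.prod_congr rfl fun j _ => ?_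
      rw [Polynomial.sub_comp, Polynomial.X_comp, Polynomial.C_comp, sub_sub, ← Polynomial.C_add]
      congr 2
      push_cast
      ring
    rw [hcomp, Polynomial.derivative_comp]
    simp only [Polynomial.derivative_sub, Polynomial.derivative_X, Polynomial.derivative_C,
      sub_zero, one_mul, Polynomial.eval_comp, Polynomial.eval_sub, Polynomial.eval_X,
      Polynomial.eval_C]
    rw [show (i : ℝ) + 1 / 2 - (i - 1 / 2) = 1 by ring]
    ring

theorem enoPoly_sub (κ : ENOKind) {k : ℕ} (hk : 0 < k) (w : ℤ → ℝ) (i r : ℤ) (n : ℕ) :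
    (enoPoly κ k w (r + n)).eval ((i : ℝ) + 1 / 2) - (enoPoly κ k w r).eval ((i : ℝ) + 1 / 2)
      = ∑ l ∈ Finset.range n,
        enoCoeff κ k (r + l - i) * (fwdDiff (1 : ℤ))^[k] w (r + l) := by
  induction n with
  | zero => simp
  | succ n ih =>
    rw [Finset.sum_range_succ, ← ih, ← enoPoly_shift_sub κ hk]
    push_cast
    rw [add_assoc r]
    ring

/-- For point values the interface lies between nodes. For cell averages it is itself a node, and
the derivative there is the product over the other nodes. Either way the negative factors come from
the t + k - 1 nodes to its right. -/
theorem enoCoeff_sign (κ : ENOKind) {k : ℕ} (hk : k = 3 ∨ k = 4) {t : ℤ} (h1 : -(k : ℤ) < t)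
    (h2 : t ≤ 0) : 0 < (-1 : ℝ) ^ (t + k - 1).toNat * enoCoeff κ k t := by
  rcases hk with rfl | rfl <;> cases κ <;> push_cast at h1 <;> interval_cases t <;>
    simp [enoCoeff, Finset.prod_range_succ, Nat.factorial, Polynomial.derivative_mul] <;> norm_num

theorem enoLeft_succ (w : ℤ → ℝ) (i : ℤ) (n : ℕ) :
    enoLeft w i (n + 1) = if |(fwdDiff (1 : ℤ))^[n + 1] w (enoLeft w i n - 1)|
      < |(fwdDiff (1 : ℤ))^[n + 1] w (enoLeft w i n)|
    then enoLeft w i n - 1 else enoLeft w i n := rfl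

theorem enoLeft_mem (w : ℤ → ℝ) (i : ℤ) (n : ℕ) :
    i - n ≤ enoLeft w i n ∧ enoLeft w i n ≤ i := by
  induction n with
  | zero => simp [enoLeft]
  | succ n ih => rw [enoLeft_succ]; split_ifs <;> push_cast <;> omega

/-- Subtracting something of no larger modulus cannot reverse a sign. This is how both minmod and
the ENO selection preserve signs. -/
theorem mul_sub_nonneg_of_abs_le {c a b : ℝ} (h : 0 ≤ c * a) (hab : |b| ≤ |a|) :
    0 ≤ c * (a - b) := by
  have h1 : c * b ≤ |c| * |b| := by rw [← abs_mul]; exact le_abs_self _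
  have h2 : c * a = |c| * |a| := by rw [← abs_mul, abs_of_nonneg h]
  have h3 : |c| * |b| ≤ |c| * |a| := by gcongr
  linarith

/-- The stencils of neighbouring cells are ordered, and the differences of the next order between
their left ends alternate in sign. -/
theorem enoLeft_sign (w : ℤ → ℝ) (i : ℤ) (n : ℕ) :
    enoLeft w i n ≤ enoLeft w (i + 1) n ∧
    ∀ s, enoLeft w i n ≤ s → s < enoLeft w (i + 1) n →
      0 ≤ ((-1) ^ (s - i + n).toNat * (w (i + 1) - w i)) * (fwdDiff (1 : ℤ))^[n + 1] w s := by
  induction n with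
  | zero =>
    refine ⟨by simp [enoLeft], fun s h1 h2 => ?_⟩
    obtain rfl : s = i := by simp only [enoLeft] at h1 h2; omega
    simp [fwdDiff, mul_self_nonneg]
  | succ n ih =>
    obtain ⟨hle, hs⟩ := ih
    have hm := enoLeft_mem w i n
    rw [enoLeft_succ, enoLeft_succ]
    set r := enoLeft w i n
    set r' := enoLeft w (i + 1) n
    -- Cells sharing a stencil compare the same two differences, so they extend it to the same side
    -- and the new range of s is empty.
    have hsame : r = r' → (|(fwdDiff (1 : ℤ))^[n + 1] w (r - 1)| < |(fwdDiff (1 : ℤ))^[n + 1] w r| ↔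
      |(fwdDiff (1 : ℤ))^[n + 1] w (r' - 1)| < |(fwdDiff (1 : ℤ))^[n + 1] w r'|) := by
      intro h; rw [h]
    constructor
    · split_ifs with h1 h2 h2 <;> grind
    · intro s h1 h2
      rw [fwdDiff_iter_succ_apply]
      have hsl : r - 1 ≤ s := by split_ifs at h1 <;> omega
      have hsr : s ≤ r' - 1 := by split_ifs at h2 <;> omega
      have hrr : r < r' := by
        rcases hle.lt_or_eq with h | h
        · exact h
        · exfalso
          have := hsame h
          split_ifs at h1 h2 <;> first | omega | tauto
      have e1 : (s - i + (n + 1 : ℕ)).toNat = (s + 1 - i + n).toNat := by push_cast; congr 1; ring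
      have e2 : r ≤ s → (-1 : ℝ) ^ (s + 1 - i + n).toNat = -(-1) ^ (s - i + n).toNat := by
        intro h
        rw [show (s + 1 - i + n).toNat = (s - i + n).toNat + 1 by omega, pow_succ]
        ring
      rw [e1]
      -- In the interior, two consecutive differences of opposite sign are subtracted. The index r'
      -- - 1 remains only if the right cell did not move left, and r - 1 occurs only if the left
      -- cell did; in both cases the selection test says that the term of uncontrolled sign has no
      -- larger modulus.
      by_cases hl : r ≤ s
      · have p1 := hs s hl (by omega)
        by_cases hr : s + 1 < r'
        · have p2 := hs (s + 1) (by omega) hr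
          rw [e2 hl] at p2 ⊢
          linarith
        · have h3 : ¬ |(fwdDiff (1 : ℤ))^[n + 1] w (r' - 1)| < |(fwdDiff (1 : ℤ))^[n + 1] w r'| := by
            intro h; rw [if_pos h] at h2; omega
          have h4 : s = r' - 1 := by omega
          rw [not_lt, ← h4, show r' = s + 1 by omega] at h3
          have := mul_sub_nonneg_of_abs_le p1 h3
          rw [e2 hl]
          linarith
      · have h3 : |(fwdDiff (1 : ℤ))^[n + 1] w (r - 1)| < |(fwdDiff (1 : ℤ))^[n + 1] w r| := by
          by_contra h; rw [if_neg h] at h1; omega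
        rw [show r - 1 = s by omega, show r = s + 1 by omega] at h3
        exact mul_sub_nonneg_of_abs_le (hs (s + 1) (by omega) (by omega)) h3.le

/-- The jump at `i + 1/2` of the reconstruction. -/
def reconJump (κ : ENOKind) (k : ℕ) (w : ℤ → ℝ) (i : ℤ) : ℝ :=
  reconstruct κ k w (i + 1) ((i : ℝ) + 1 / 2) - reconstruct κ k w i ((i : ℝ) + 1 / 2)

theorem reconJump_two (κ : ENOKind) (w : ℤ → ℝ) (i : ℤ) :
    reconJump κ 2 w i = (w (i + 1) - w i) - minmod (w (i + 1) - w i) (w (i + 2) - w (i + 1)) / 2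
      - minmod (w i - w (i - 1)) (w (i + 1) - w i) / 2 := by
  simp only [reconJump, reconstruct, if_true]
  rw [show i + 1 - 1 = i by ring, show i + 1 + 1 = i + 2 by ring]
  push_cast
  ring

/-- The jump of the ENO reconstruction in terms of differences of order `k`. -/
theorem reconJump_eq_sum (κ : ENOKind) {k : ℕ} (hk : k = 3 ∨ k = 4) (w : ℤ → ℝ) (i : ℤ) :
    reconJump κ k w i = ∑ s ∈ Finset.Ico (enoLeft w i (k - 1)) (enoLeft w (i + 1) (k - 1)),
      enoCoeff κ k (s - i) * (fwdDiff (1 : ℤ))^[k] w s := by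
  have hk2 : k ≠ 2 := by omega
  simp only [reconJump, reconstruct, if_neg hk2]
  have hle := (enoLeft_sign w i (k - 1)).1
  obtain ⟨n, hn⟩ := Int.eq_ofNat_of_zero_le (sub_nonneg.2 hle)
  rw [show enoLeft w (i + 1) (k - 1) = enoLeft w i (k - 1) + n by omega]
  rw [enoPoly_sub κ (by omega)]
  set r := enoLeft w i (k - 1)
  refine Finset.sum_bij (fun l _ => r + (l : ℤ)) ?_ ?_ ?_ ?_
  · intro l hl; have := Finset.mem_range.1 hl; simp only [Finset.mem_Ico]; omega
  · intro a _ b _ h; simpa using h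
  · intro b hb
    have := Finset.mem_Ico.1 hb
    exact ⟨(b - r).toNat, by rw [Finset.mem_range]; omega, by omega⟩
  · intro l _; rfl

theorem minmod_spec (a b : ℝ) : 0 ≤ minmod a b * a ∧ 0 ≤ minmod a b * b ∧
    |minmod a b| ≤ |a| ∧ |minmod a b| ≤ |b| := by
  unfold minmod
  split_ifs with h1 h2
  · exact ⟨mul_self_nonneg a, h1.le, le_rfl, h2.le⟩
  · exact ⟨by linarith, mul_self_nonneg b, not_lt.1 h2, le_rfl⟩
  · simp

/-- The jump of the reconstruction has the sign of the jump of the grid values. -/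
theorem reconJump_mul_nonneg (κ : ENOKind) {k : ℕ} (hk : k = 2 ∨ k = 3 ∨ k = 4) (w : ℤ → ℝ)
    (i : ℤ) : 0 ≤ (w (i + 1) - w i) * reconJump κ k w i := by
  rcases hk with rfl | hk
  · rw [reconJump_two]
    set d := w (i + 1) - w i
    have h1 := (minmod_spec d (w (i + 2) - w (i + 1))).2.2.1
    have h2 := (minmod_spec (w i - w (i - 1)) d).2.2.2
    have h0 : 0 ≤ d * d := mul_self_nonneg d
    -- The jump is the mean of d minus one limited slope and d minus the other, and neither slope
    -- exceeds d in modulus.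
    have p1 := mul_sub_nonneg_of_abs_le h0 h1
    have p2 := mul_sub_nonneg_of_abs_le h0 h2
    linarith
  · rw [reconJump_eq_sum κ hk, Finset.mul_sum]
    refine Finset.sum_nonneg fun s hs => ?_
    obtain ⟨h1, h2⟩ := Finset.mem_Ico.1 hs
    have m1 := enoLeft_mem w i (k - 1)
    have m2 := enoLeft_mem w (i + 1) (k - 1)
    have p := (enoLeft_sign w i (k - 1)).2 s h1 h2
    have hs0 : s ≤ i := by omega
    have q := enoCoeff_sign κ hk (t := s - i) (by omega) (by omega)
    have e : (s - i + (k - 1 : ℕ)).toNat = (s - i + k - 1).toNat := by omega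
    rw [Nat.sub_add_cancel (by omega), e] at p
    -- Coefficient and difference carry the same alternating factor, which squares to one.
    have hsq : ((-1 : ℝ) ^ (s - i + k - 1).toNat) * (-1) ^ (s - i + k - 1).toNat = 1 := by
      rw [← mul_pow]; norm_num
    calc (0 : ℝ) ≤ ((-1) ^ (s - i + k - 1).toNat * enoCoeff κ k (s - i))
          * ((-1) ^ (s - i + k - 1).toNat * (w (i + 1) - w i) * (fwdDiff (1 : ℤ))^[k] w s) :=
          mul_nonneg q.le p
      _ = ((-1) ^ (s - i + k - 1).toNat * (-1) ^ (s - i + k - 1).toNat) * ((w (i + 1) - w i)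
          * (enoCoeff κ k (s - i) * (fwdDiff (1 : ℤ))^[k] w s)) := by ring
      _ = _ := by rw [hsq, one_mul]

/-- The jump of the reconstruction is bounded by the differences of order `k`. -/
theorem reconJump_abs_le (κ : ENOKind) {k : ℕ} (hk : k = 2 ∨ k = 3 ∨ k = 4) :
    ∃ C : ℝ, 0 ≤ C ∧ ∀ (w : ℤ → ℝ) (i : ℤ) (M : ℝ), (∀ s ∈ Finset.Icc (i - 4) (i + 4),
      |(fwdDiff (1 : ℤ))^[k] w s| ≤ M) → |reconJump κ k w i| ≤ C * M := by
  rcases hk with rfl | hk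
  · refine ⟨1, zero_le_one, fun w i M hM => ?_⟩
    have q1 := hM (i - 1) (by rw [Finset.mem_Icc]; omega)
    have q2 := hM i (by rw [Finset.mem_Icc]; omega)
    simp only [Function.iterate_succ, Function.iterate_zero, Function.comp, id, fwdDiff] at q1 q2
    rw [show i - 1 + 1 = i by ring] at q1
    rw [show i + 1 + 1 = i + 2 by ring] at q2
    rw [reconJump_two]
    -- Minmod returns one of its arguments, or zero when their product is not positive; in that last
    -- case neither modulus exceeds |b - a|. With consecutive slopes, b - a is a second difference.
    have key : ∀ a b : ℝ, |a - minmod a b| ≤ |b - a| ∧ |b - minmod a b| ≤ |b - a| := by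
      intro a b
      unfold minmod
      split_ifs with h1 h2
      · simp
      · simp [abs_sub_comm]
      · rw [sub_zero, sub_zero]
        constructor <;> rw [← sq_le_sq] <;> nlinarith
    have k1 := (key (w (i + 1) - w i) (w (i + 2) - w (i + 1))).1
    have k2 := (key (w i - w (i - 1)) (w (i + 1) - w i)).2
    have e : ∀ a b c : ℝ, a - b / 2 - c / 2 = (a - b) / 2 + (a - c) / 2 := by intros; ring
    rw [e]
    refine (abs_add_le _ _).trans ?_
    rw [abs_div, abs_div, abs_two]
    linarith
  -- The two stencils start between i - 3 and i + 1, so the offsets s - i in the jump formula lie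
  -- between -3 and 0.
  · refine ⟨∑ t ∈ Finset.Icc (-4 : ℤ) 0, |enoCoeff κ k t|, Finset.sum_nonneg fun _ _ => abs_nonneg _,
      fun w i M hM => ?_⟩
    have m1 := enoLeft_mem w i (k - 1)
    have m2 := enoLeft_mem w (i + 1) (k - 1)
    have hM0 : 0 ≤ M := (abs_nonneg _).trans (hM i (by simp))
    rw [reconJump_eq_sum κ hk]
    refine (Finset.abs_sum_le_sum_abs _ _).trans ?_
    rw [Finset.sum_mul]
    have himg : ∑ t ∈ Finset.Icc (-4 : ℤ) 0, |enoCoeff κ k t| * M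
        = ∑ s ∈ Finset.Icc (i - 4) i, |enoCoeff κ k (s - i)| * M := by
      refine Finset.sum_bij (fun t _ => t + i) ?_ ?_ ?_ ?_
      · intro t ht; rw [Finset.mem_Icc] at *; omega
      · intro a _ b _ h; simpa using h
      · intro b hb; rw [Finset.mem_Icc] at hb
        exact ⟨b - i, by rw [Finset.mem_Icc]; omega, by omega⟩
      · intro t _; simp
    rw [himg]
    refine (Finset.sum_le_sum (g := fun s => |enoCoeff κ k (s - i)| * M) fun s hs => ?_).trans
      (Finset.sum_le_sum_of_subset_of_nonneg (fun s hs => ?_) fun _ _ _ => by positivity)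
    · rw [abs_mul]
      have := Finset.mem_Ico.1 hs
      gcongr
      exact hM s (by rw [Finset.mem_Icc]; omega)
    · have := Finset.mem_Ico.1 hs
      rw [Finset.mem_Icc]; omega

/-! ## Translation -/

theorem enoLeft_shift (w : ℤ → ℝ) (a i : ℤ) (n : ℕ) :
    enoLeft (fun j => w (j + a)) i n = enoLeft w (i + a) n - a := by
  induction n with
  | zero => simp [enoLeft]
  | succ n ih =>
    rw [enoLeft_succ, enoLeft_succ, ih, fwdDiff_iter_comp_add, fwdDiff_iter_comp_add]
    rw [show enoLeft w (i + a) n - a - 1 + a = enoLeft w (i + a) n - 1 by ring,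
      show enoLeft w (i + a) n - a + a = enoLeft w (i + a) n by ring]
    split_ifs <;> ring

/-- Needed so that the numerical flux at an interface does not depend on which grid point serves as
the origin. -/
theorem reconJump_shift (κ : ENOKind) {k : ℕ} (hk : k = 2 ∨ k = 3 ∨ k = 4) (w : ℤ → ℝ) (a i : ℤ) :
    reconJump κ k (fun j => w (j + a)) i = reconJump κ k w (i + a) := by
  rcases hk with rfl | hk
  · simp only [reconJump_two]
    rw [show i + 1 + a = i + a + 1 by ring, show i + 2 + a = i + a + 2 by ring,
      show i - 1 + a = i + a - 1 by ring]
  · rw [reconJump_eq_sum κ hk, reconJump_eq_sum κ hk, enoLeft_shift, enoLeft_shift]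
    refine Finset.sum_bij (fun s _ => s + a) ?_ ?_ ?_ ?_
    · intro s hs; rw [Finset.mem_Ico] at *; rw [show i + a + 1 = i + 1 + a by ring]; omega
    · intro x _ y _ h; simpa using h
    · intro b hb
      rw [Finset.mem_Ico, show i + a + 1 = i + 1 + a by ring] at hb
      exact ⟨b - a, by rw [Finset.mem_Ico]; omega, by omega⟩
    · intro s _
      rw [fwdDiff_iter_comp_add, show s + a - (i + a) = s - i by ring]

/-! ## Reconstruction of sequences with differences of constant sign -/

theorem abs_lt_abs_iff_of_sign {σ a b : ℝ} (hσ : σ = 1 ∨ σ = -1) (ha : 0 < σ * a)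
    (hb : 0 < σ * b) : |a| < |b| ↔ 0 < σ * (b - a) := by
  have h : ∀ x, |x| = |σ * x| := by
    intro x; rcases hσ with rfl | rfl <;> simp
  rw [h a, h b, abs_of_pos ha, abs_of_pos hb, mul_sub, sub_pos]

/-- When the two competing differences have the same sign, comparing their moduli amounts to reading
the sign of their difference, which is a difference of the next order. -/
theorem enoLeft_step {w : ℤ → ℝ} {i : ℤ} {n : ℕ} {σ : ℝ} (hσ : σ = 1 ∨ σ = -1)
    (h1 : 0 < σ * (fwdDiff (1 : ℤ))^[n + 1] w (enoLeft w i n - 1))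
    (h2 : 0 < σ * (fwdDiff (1 : ℤ))^[n + 1] w (enoLeft w i n)) :
    enoLeft w i (n + 1) = if 0 < σ * (fwdDiff (1 : ℤ))^[n + 2] w (enoLeft w i n - 1)
      then enoLeft w i n - 1 else enoLeft w i n := by
  rw [enoLeft_succ, fwdDiff_iter_succ_apply _ (n + 1), sub_add_cancel]
  simp only [abs_lt_abs_iff_of_sign hσ h1 h2]

/-- The first k - 2 extensions are decided by signs of differences of orders below k, so fixed signs
give one offset r for all data and all cells. Only the last extension, which reads the sign of a
k-th difference, stays open. -/
theorem enoLeft_of_sign {k : ℕ} (hk : k ≤ 4) (σ : ℕ → ℝ) (hσ : ∀ l, σ l = 1 ∨ σ l = -1) (n : ℕ)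
    (hn : n + 2 ≤ k) : ∃ r : ℤ, -(n : ℤ) ≤ r ∧ r ≤ 0 ∧ ∀ (w : ℤ → ℝ) (i : ℤ),
      (∀ l, 1 ≤ l → l < k → ∀ s ∈ Finset.Icc (i - 4) (i + 4),
        0 < σ l * (fwdDiff (1 : ℤ))^[l] w s) → enoLeft w i n = i + r := by
  induction n with
  | zero => exact ⟨0, by simp, le_rfl, fun w i _ => by simp [enoLeft]⟩
  | succ n ih =>
    obtain ⟨r, hr1, hr2, hr⟩ := ih (by omega)
    have hsq : ∀ l, σ l * σ l = 1 := fun l => by rcases hσ l with h | h <;> rw [h] <;> norm_num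
    refine ⟨if 0 < σ (n + 1) * σ (n + 2) then r - 1 else r, ?_, ?_, fun w i hw => ?_⟩
    · push_cast; split_ifs <;> omega
    · split_ifs <;> omega
    · have e := hr w i hw
      have q1 := hw (n + 1) (by omega) (by omega) (enoLeft w i n - 1)
        (by rw [e, Finset.mem_Icc]; omega)
      have q2 := hw (n + 1) (by omega) (by omega) (enoLeft w i n)
        (by rw [e, Finset.mem_Icc]; omega)
      have q3 := hw (n + 2) (by omega) (by omega) (enoLeft w i n - 1)
        (by rw [e, Finset.mem_Icc]; omega)
      rw [enoLeft_step (hσ (n + 1)) q1 q2]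
      have hiff : 0 < σ (n + 1) * (fwdDiff (1 : ℤ))^[n + 2] w (enoLeft w i n - 1)
          ↔ 0 < σ (n + 1) * σ (n + 2) := by
        have hx : ∀ x, σ (n + 1) * x = σ (n + 1) * σ (n + 2) * (σ (n + 2) * x) := fun x => by
          rw [show σ (n + 1) * σ (n + 2) * (σ (n + 2) * x)
            = σ (n + 1) * x * (σ (n + 2) * σ (n + 2)) by ring, hsq, mul_one]
        rw [hx, mul_pos_iff_of_pos_right q3]
      simp only [hiff]
      rw [e]
      split_ifs <;> ring

/-- If the differences of orders less than `k` have constant signs, then the jump of the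
reconstruction is a Lipschitz continuous function of the differences of order `k`. -/
theorem reconJump_of_sign (κ : ENOKind) {k : ℕ} (hk : k = 2 ∨ k = 3 ∨ k = 4) (σ : ℕ → ℝ)
    (hσ : ∀ l, σ l = 1 ∨ σ l = -1) : ∃ (c₁ c₂ : ℝ) (r : ℤ), -3 ≤ r ∧ r ≤ 0 ∧
      ∀ (w : ℤ → ℝ) (i : ℤ), (∀ l, 1 ≤ l → l < k → ∀ s ∈ Finset.Icc (i - 5) (i + 5),
        0 < σ l * (fwdDiff (1 : ℤ))^[l] w s) →
      reconJump κ k w i = c₁ * max (σ (k - 1) * (fwdDiff (1 : ℤ))^[k] w (i + r - 1)) 0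
        + c₂ * max (-(σ (k - 1) * (fwdDiff (1 : ℤ))^[k] w (i + r))) 0 := by
  have hsq : ∀ l, σ l * σ l = 1 := fun l => by rcases hσ l with h | h <;> rw [h] <;> norm_num
  rcases hk with rfl | hk
  · refine ⟨σ 1 / 2, σ 1 / 2, 0, by norm_num, le_rfl, fun w i hw => ?_⟩
    have q1 := hw 1 le_rfl (by norm_num) (i - 1) (by rw [Finset.mem_Icc]; omega)
    have q2 := hw 1 le_rfl (by norm_num) i (by rw [Finset.mem_Icc]; omega)
    have q3 := hw 1 le_rfl (by norm_num) (i + 1) (by rw [Finset.mem_Icc]; omega)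
    clear hw
    rw [reconJump_two, add_zero]
    simp only [Function.iterate_succ, Function.iterate_zero, Function.comp, id, fwdDiff,
      sub_add_cancel, show i + 1 + 1 = i + 2 by ring, show 2 - 1 = 1 from rfl] at *
    have hs := hσ 1
    generalize σ 1 = τ at *
    generalize w (i + 1) - w i = b at *
    generalize w i - w (i - 1) = a at *
    generalize w (i + 2) - w (i + 1) = c at *
    -- For slopes of one sign, minmod chooses the first exactly when the modulus increases, so the
    -- sign of the second difference makes the choice.
    have key : ∀ x y : ℝ, 0 < τ * x → 0 < τ * y →
        minmod x y = if 0 < τ * (y - x) then x else y := by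
      intro x y hx hy
      have hxy : 0 < x * y := by
        have := mul_pos hx hy
        rw [show τ * x * (τ * y) = (τ * τ) * (x * y) by ring] at this
        rcases hs with rfl | rfl <;> linarith
      simp only [minmod, if_pos hxy, abs_lt_abs_iff_of_sign hs hx hy]
    rw [key b c q2 q3, key a b q1 q2]
    split_ifs with h1 h2 h2
    · rw [max_eq_left h2.le, max_eq_right (by linarith)]
      rcases hs with rfl | rfl <;> ring
    · rw [max_eq_right (by linarith), max_eq_right (by linarith)]
      rcases hs with rfl | rfl <;> ring
    · rw [max_eq_left h2.le, max_eq_left (by linarith)]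
      rcases hs with rfl | rfl <;> ring
    · rw [max_eq_right (by linarith), max_eq_left (by linarith)]
      rcases hs with rfl | rfl <;> ring
  · obtain ⟨n, rfl⟩ : ∃ n, k = n + 2 := ⟨k - 2, by omega⟩
    obtain ⟨r, hr1, hr2, hr⟩ := enoLeft_of_sign (k := n + 2) (by omega) σ hσ n le_rfl
    refine ⟨σ (n + 1) * enoCoeff κ (n + 2) (r - 1), -(σ (n + 1) * enoCoeff κ (n + 2) r), r,
      by omega, hr2, fun w i hw => ?_⟩
    have e1 := hr w i fun l h1 h2 s hs => hw l h1 h2 s (by rw [Finset.mem_Icc] at *; omega)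
    have e2 := hr w (i + 1) fun l h1 h2 s hs => hw l h1 h2 s (by rw [Finset.mem_Icc] at *; omega)
    have hw' := hw (n + 1) (by omega) (by omega)
    have s1 := enoLeft_step (w := w) (i := i) (n := n) (hσ (n + 1))
      (hw' _ (by rw [e1, Finset.mem_Icc]; omega)) (hw' _ (by rw [e1, Finset.mem_Icc]; omega))
    have s2 := enoLeft_step (w := w) (i := i + 1) (n := n) (hσ (n + 1))
      (hw' _ (by rw [e2, Finset.mem_Icc]; omega)) (hw' _ (by rw [e2, Finset.mem_Icc]; omega))
    rw [reconJump_eq_sum κ hk]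
    simp only [show n + 2 - 1 = n + 1 by omega]
    rw [s1, s2, e1, e2, show i + 1 + r - 1 = i + r by ring]
    have hs := hσ (n + 1)
    generalize σ (n + 1) = τ at *
    have ico1 : ∀ a : ℤ, Finset.Ico a (a + 1) = {a} := fun a => by ext; simp; omega
    -- The four outcomes of the last extension in cells i and i + 1. The index i + r - 1 enters the
    -- jump when cell i moves left, and i + r when cell i + 1 does not; the two positive parts
    -- encode these switches continuously.
    split_ifs with h1 h2 h2
    · have : Finset.Ico (i + r - 1) (i + r) = {i + r - 1} := by
        ext x; simp only [Finset.mem_Ico, Finset.mem_singleton]; omega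
      rw [max_eq_left h1.le, max_eq_right (by linarith), this, Finset.sum_singleton,
        show i + r - 1 - i = r - 1 by ring]
      rcases hs with rfl | rfl <;> ring
    · have : Finset.Ico (i + r - 1) (i + 1 + r) = {i + r - 1, i + r} := by
        ext x; simp only [Finset.mem_Ico, Finset.mem_insert, Finset.mem_singleton]; omega
      rw [max_eq_left h1.le, max_eq_left (by linarith), this, Finset.sum_pair (by omega),
        show i + r - 1 - i = r - 1 by ring, show i + r - i = r by ring]
      rcases hs with rfl | rfl <;> ring
    · rw [max_eq_right (by linarith), max_eq_right (by linarith), Finset.Ico_self]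
      simp
    · rw [max_eq_right (by linarith), max_eq_left (by linarith), show i + 1 + r = i + r + 1 by ring,
        ico1, Finset.sum_singleton, show i + r - i = r by ring]
      rcases hs with rfl | rfl <;> ring

/-! ## Algebra of the entropy variables -/

theorem pack_dotProduct (r : ℝ) (m : Fin 3 → ℝ) (p e : ℝ) (b : Fin 3 → ℝ) (s : ℝ)
    (r' : ℝ) (m' : Fin 3 → ℝ) (p' e' : ℝ) (b' : Fin 3 → ℝ) (s' : ℝ) :
    pack r m p e b s ⬝ᵥ pack r' m' p' e' b' s'
      = r * r' + m ⬝ᵥ m' + p * p' + e * e' + b ⬝ᵥ b' + s * s' := by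
  simp [dotProduct, Fin.sum_univ_succ, pack]
  ring

theorem pack_sub (r : ℝ) (m : Fin 3 → ℝ) (p e : ℝ) (b : Fin 3 → ℝ) (s : ℝ)
    (r' : ℝ) (m' : Fin 3 → ℝ) (p' e' : ℝ) (b' : Fin 3 → ℝ) (s' : ℝ) :
    pack r m p e b s - pack r' m' p' e' b' s'
      = pack (r - r') (m - m') (p - p') (e - e') (b - b') (s - s') := by
  ext i; fin_cases i <;> rfl

theorem Positive.betaPerp_pos {U : State} (h : Positive U) : 0 < betaPerp U := div_pos h.1 h.2.2

theorem Positive.betaPar_pos {U : State} (h : Positive U) : 0 < betaPar U := div_pos h.1 h.2.1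

/-- In terms of ρ, β∥ and β⊥ the entropy is a sum of logarithms, so its jumps can be treated with
the logarithmic means of exactly these quantities. -/
theorem specificEntropy_eq {U : State} (h : Positive U) : specificEntropy U
    = -2 * Real.log (rho U) - Real.log (betaPar U) - 2 * Real.log (betaPerp U) := by
  obtain ⟨h1, h2, h3⟩ := h
  unfold specificEntropy betaPar betaPerp
  rw [Real.log_div (by positivity) (by positivity), Real.log_mul (by positivity) (by positivity),
    Real.log_pow, Real.log_pow, Real.log_div h1.ne' h2.ne', Real.log_div h1.ne' h3.ne']
  push_cast
  ring

theorem entropyVar_dotProduct_godunov (U : State) : entropyVar U ⬝ᵥ godunov U = Phi U := by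
  rw [entropyVar, godunov, pack_dotProduct]
  simp only [dotProduct, Fin.sum_univ_three, Phi]
  ring

/-- The contributions -2β⊥Ψv_d of the energy and 2β⊥Ψv_d of the last component cancel. -/
theorem entropyVar_dotProduct_upsilon (d : Fin 2) (U : State) :
    entropyVar U ⬝ᵥ upsilon d U = 0 := by
  rw [entropyVar, upsilon, pack_dotProduct]
  simp only [dotProduct, Fin.sum_univ_three, Pi.zero_apply]
  ring

/-- The energy row contains v times the momentum rows, which cancels the weights 2β⊥v. What remains
is a multiple of b_d (b·dv) with coefficient 2p∥(β⊥ - β∥) - 2β⊥(p∥ - p⊥) = 0. As x is arbitrary,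
central differences are covered too. -/
theorem entropyVar_dotProduct_ncMatrix (d : Fin 2) {U : State} (h : Positive U) (x : State) :
    entropyVar U ⬝ᵥ (ncMatrix d U *ᵥ x) = 0 := by
  obtain ⟨h1, h2, h3⟩ := h
  have hrow : ncMatrix d U *ᵥ x = pack 0 (fun i => ncMomentumRow d U i ⬝ᵥ x)
      ((2 * ppar U * bdir U (nrm d)) * ((∑ i, bdir U i • dVel U i) ⬝ᵥ x))
      ((∑ i, vel U i * (ncMomentumRow d U i ⬝ᵥ x))
        + ((ppar U - pperp U) * bdir U (nrm d)) * ((∑ i, bdir U i • dVel U i) ⬝ᵥ x)) 0 0 := by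
    ext i
    fin_cases i
    · exact zero_dotProduct x
    · rfl
    · rfl
    · rfl
    · exact smul_dotProduct (2 * ppar U * bdir U (nrm d)) (∑ i, bdir U i • dVel U i) x
    · refine (add_dotProduct (∑ i, vel U i • ncMomentumRow d U i) (((ppar U - pperp U) *
        bdir U (nrm d)) • ∑ i, bdir U i • dVel U i) x).trans ?_
      rw [sum_dotProduct, smul_dotProduct]
      simp only [smul_dotProduct]
      rfl
    all_goals exact zero_dotProduct x
  rw [hrow, entropyVar, pack_dotProduct]
  generalize (∑ i, bdir U i • dVel U i) ⬝ᵥ x = y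
  simp only [dotProduct, Fin.sum_univ_three, Pi.zero_apply, betaPerp, betaPar]
  generalize ∑ j, ncMomentumRow d U 0 j * x j = y0
  generalize ∑ j, ncMomentumRow d U 1 j * x j = y1
  generalize ∑ j, ncMomentumRow d U 2 j * x j = y2
  field_simp
  ring

/-! ### Logarithmic means and the discrete entropy balance -/

theorem logMean_mul_log {a b : ℝ} (ha : 0 < a) (hb : 0 < b) :
    logMean a b * (Real.log b - Real.log a) = b - a := by
  unfold logMean
  split_ifs with h
  · rw [h]; ring
  · refine div_mul_cancel₀ _ (sub_ne_zero.2 fun e => h ?_)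
    exact (Real.log_injOn_pos hb ha e).symm

theorem logMean_pos {a b : ℝ} (ha : 0 < a) (hb : 0 < b) : 0 < logMean a b := by
  unfold logMean
  split_ifs with h
  · exact ha
  · rcases lt_or_gt_of_ne h with h | h
    · exact div_pos (sub_pos.2 h) (sub_pos.2 (Real.log_lt_log ha h))
    · exact div_pos_of_neg_of_neg (sub_neg.2 h) (sub_neg.2 (Real.log_lt_log hb h))

/-- The entropy conservation condition for the two-point flux. -/
theorem jump_dotProduct_ecFlux (d : Fin 2) (ch : ℝ) {a b : State} (ha : Positive a)
    (hb : Positive b) : (entropyVar b - entropyVar a) ⬝ᵥ ecFlux d ch a b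
      = potential d ch b - potential d ch a
        - (Phi b - Phi a) * mean (fun U => mag U (nrm d)) a b := by
  have hβ : 0 < mean betaPerp a b := by
    have := ha.betaPerp_pos; have := hb.betaPerp_pos; unfold mean; positivity
  have h1 := logMean_mul_log ha.1 hb.1
  have h2 := logMean_mul_log ha.betaPar_pos hb.betaPar_pos
  have h3 := logMean_mul_log ha.betaPerp_pos hb.betaPerp_pos
  have p2 := logMean_pos ha.betaPar_pos hb.betaPar_pos
  have p3 := logMean_pos ha.betaPerp_pos hb.betaPerp_pos
  have h2' : Real.log (betaPar b) - Real.log (betaPar a)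
      = (betaPar b - betaPar a) * (logMean (betaPar a) (betaPar b))⁻¹ := by
    rw [← h2]; field_simp
  have h3' : Real.log (betaPerp b) - Real.log (betaPerp a)
      = (betaPerp b - betaPerp a) * (logMean (betaPerp a) (betaPerp b))⁻¹ := by
    rw [← h3]; field_simp
  have hP : mean rho a b / mean betaPerp a b * mean betaPerp a b = mean rho a b :=
    div_mul_cancel₀ _ hβ.ne'
  have hB : ∀ i, ecMag d ch a b i * mean betaPerp a b =
      (mean (fun U => betaPerp U * vel U (nrm d)) a b * mean (fun U => mag U i) a b
      - mean (fun U => betaPerp U * vel U i) a b * mean (fun U => mag U (nrm d)) a b)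
    + if i = nrm d then ch * mean (fun U => psi U * betaPerp U) a b else 0 := by
    intro i
    rw [ecMag, add_mul, div_mul_cancel₀ _ hβ.ne']
    split_ifs
    · rw [div_mul_cancel₀ _ hβ.ne']
    · rw [zero_mul]
  have hB0 := hB 0
  have hB1 := hB 1
  have hB2 := hB 2
  rw [entropyVar, entropyVar, pack_sub, ecFlux, pack_dotProduct, specificEntropy_eq ha,
    specificEntropy_eq hb, ecEnergy]
  simp only [ecMomentum, ecPar, ecMass, potential, Phi, dotProduct, Fin.sum_univ_three,
    Pi.sub_apply]
  -- With all quotients abstracted, the identity is polynomial modulo a few relations: `hP` and `hB`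
  -- clear the mean of β⊥, and `h1`, `h2'`, `h3'` exchange jumps of logarithms for jumps of their
  -- arguments. The multipliers below are the factors with which these quantities occur in ⟦V⟧·f̃.
  generalize mean rho a b / mean betaPerp a b = P at *
  simp only [div_eq_mul_inv _ (logMean _ _)]
  generalize (logMean (betaPerp a) (betaPerp b))⁻¹ = X3 at *
  generalize (logMean (betaPar a) (betaPar b))⁻¹ = X2 at *
  generalize logMean (rho a) (rho b) = L1 at *
  generalize ecMag d ch a b 0 = z0 at *
  generalize ecMag d ch a b 1 = z1 at *
  generalize ecMag d ch a b 2 = z2 at *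
  fin_cases d
  · simp [nrm, mean] at *
    linear_combination (vel a 0 + vel b 0) * h1 + ((vel a 0 + vel b 0) / 2 * L1) * h2'
      + 2 * ((vel a 0 + vel b 0) / 2 * L1) * h3'
      + 2 * (vel b 0 - vel a 0) * hP + 2 * (mag b 0 - mag a 0) * hB0
      + 2 * (mag b 1 - mag a 1) * hB1 + 2 * (mag b 2 - mag a 2) * hB2
  · simp [nrm, mean] at *
    linear_combination (vel a 1 + vel b 1) * h1 + ((vel a 1 + vel b 1) / 2 * L1) * h2'
      + 2 * ((vel a 1 + vel b 1) / 2 * L1) * h3'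
      + 2 * (vel b 1 - vel a 1) * hP + 2 * (mag b 0 - mag a 0) * hB0
      + 2 * (mag b 1 - mag a 1) * hB1 + 2 * (mag b 2 - mag a 2) * hB2

/-- V at one end is the mean of V minus or plus half its jump, so half of the jump condition makes
the symmetric identity one-sided. The potential then appears at the cell's own state and cancels
between interfaces. -/
theorem entropyVar_dotProduct_ecFlux_left (d : Fin 2) (ch : ℝ) {a b : State} (ha : Positive a)
    (hb : Positive b) : entropyVar a ⬝ᵥ ecFlux d ch a b
      = ecEntropyFlux d ch a b + potential d ch a
        - Phi a * ((mag a (nrm d) + mag b (nrm d)) / 2) := by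
  have h := jump_dotProduct_ecFlux d ch ha hb
  rw [sub_dotProduct] at h
  rw [ecEntropyFlux, smul_dotProduct, add_dotProduct]
  simp only [mean, smul_eq_mul] at *
  linear_combination -(1 / 2) * h

theorem entropyVar_dotProduct_ecFlux_right (d : Fin 2) (ch : ℝ) {a b : State} (ha : Positive a)
    (hb : Positive b) : entropyVar b ⬝ᵥ ecFlux d ch a b
      = ecEntropyFlux d ch a b + potential d ch b
        - Phi b * ((mag a (nrm d) + mag b (nrm d)) / 2) := by
  have h := jump_dotProduct_ecFlux d ch ha hb
  rw [sub_dotProduct] at h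
  rw [ecEntropyFlux, smul_dotProduct, add_dotProduct]
  simp only [mean, smul_eq_mul] at *
  linear_combination (1 / 2) * h

/-- The high order entropy conservative scheme conserves entropy. -/
theorem entropyVar_dotProduct_highOrder (k : ℕ) (d : Fin 2) (ch h : ℝ)
    (u : ℤ → State) (hu : ∀ i, Positive (u i)) (i : ℤ) :
    entropyVar (u i) ⬝ᵥ (h⁻¹ • (highOrder k (ecFlux d ch) u i - highOrder k (ecFlux d ch) u (i - 1))
      + central k h (fun j => mag (u j) (nrm d)) i • godunov (u i)
      + central k h (fun j => psi (u j)) i • upsilon d (u i)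
      + ncMatrix d (u i) *ᵥ central k h u i)
    = h⁻¹ * (highOrder k (ecEntropyFlux d ch) u i - highOrder k (ecEntropyFlux d ch) u (i - 1)) := by
  have hl := fun j => entropyVar_dotProduct_ecFlux_left d ch (hu i) (hu j)
  have hr := fun j => entropyVar_dotProduct_ecFlux_right d ch (hu j) (hu i)
  rw [dotProduct_add, dotProduct_add, dotProduct_add, dotProduct_smul, dotProduct_smul,
    dotProduct_smul, entropyVar_dotProduct_godunov, entropyVar_dotProduct_upsilon,
    entropyVar_dotProduct_ncMatrix d (hu i), smul_zero, add_zero, add_zero, dotProduct_sub]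
  -- The potentials cancel, since the weights of the pairs containing cell i have equal sums at both
  -- interfaces. The averages of B_d combine into exactly the stencil of `central`: 4/3 · 1/2 = 8/12
  -- and 1/6 · 1/2 = 1/12.
  simp only [highOrder, central]
  rw [show i - 1 + 1 = i by ring, show i - 1 - 1 = i - 2 by ring, show i - 1 + 2 = i + 1 by ring]
  split_ifs
  · rw [hl, hr]
    simp only [smul_eq_mul, mul_inv]
    ring
  · simp only [dotProduct_sub, dotProduct_smul, dotProduct_add, hl, hr, smul_eq_mul, mul_inv]
    ring

/-- The diffusive vector in terms of the jumps of the reconstructed scaled variables. -/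
theorem diffusive_eq (κ : ENOKind) (k : ℕ) (d : Fin 2) (ch : ℝ) (m : State → State → State)
    (u : ℤ → State) (i : ℤ) : diffusive κ k d ch m u i =
      if (scaledEig d (m (u i) (u (i + 1)))).det = 0 then 0 else
        rusanov d ch (m (u i) (u (i + 1))) • (scaledEig d (m (u i) (u (i + 1))) *ᵥ fun c =>
          reconJump κ k (fun j =>
            ((scaledEig d (m (u i) (u (i + 1))))ᵀ *ᵥ entropyVar (u j)) c) i) := by
  unfold diffusive jumpV reconstructV diffusion
  generalize scaledEig d (m (u i) (u (i + 1))) = R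
  rw [← Matrix.mulVec_sub, Matrix.mulVec_mulVec, Matrix.mul_assoc]
  -- A singular matrix has inverse zero by convention, so the diffusive vector is zero there;
  -- otherwise R̃ᵀ cancels the back transformation.
  split_ifs with h
  · rw [Matrix.nonsing_inv_apply_not_isUnit _ (by simp [Matrix.det_transpose, h]),
      Matrix.mul_zero, Matrix.mul_zero, Matrix.zero_mulVec]
  · rw [Matrix.mul_nonsing_inv _ (by rwa [Matrix.det_transpose, isUnit_iff_ne_zero]),
      Matrix.mul_one, Matrix.mul_smul, Matrix.mul_one, Matrix.smul_mulVec]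
    rfl

/-! ### Entropy dissipation by the diffusive terms -/

theorem rusanov_nonneg (d : Fin 2) (ch : ℝ) (U : State) : 0 ≤ rusanov d ch U :=
  (abs_nonneg _).trans
    (Finset.le_sup' (fun l => |eigenvalue d ch U l|) (Finset.mem_univ (0 : Fin 10)))

/-- Moving R̃ to the other factor turns the pairing into the Rusanov speed times a sum of products
of jumps and reconstructed jumps of the scaled variables, to which the sign property applies
termwise. -/
theorem jump_dotProduct_diffusive_nonneg (κ : ENOKind) {k : ℕ} (hk : k = 2 ∨ k = 3 ∨ k = 4)
    (d : Fin 2) (ch : ℝ) (m : State → State → State) (u : ℤ → State) (i : ℤ) :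
    0 ≤ (entropyVar (u (i + 1)) - entropyVar (u i)) ⬝ᵥ diffusive κ k d ch m u i := by
  rw [diffusive_eq]
  split_ifs
  · simp
  · rw [dotProduct_smul, Matrix.dotProduct_mulVec, ← Matrix.mulVec_transpose]
    refine mul_nonneg (rusanov_nonneg _ _ _) (Finset.sum_nonneg fun c _ => ?_)
    rw [Matrix.mulVec_sub]
    exact reconJump_mul_nonneg κ hk (fun j =>
      ((scaledEig d (m (u i) (u (i + 1))))ᵀ *ᵥ entropyVar (u j)) c) i

/-- The entropy flux uses the mean of V at the interface, which differs from V_i by half a jump. The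
excess is a quarter of h⁻¹ times the sum of the two dissipation terms. -/
theorem le_entropyVar_dotProduct_schemePart (κ : ENOKind) {k : ℕ} (hk : k = 2 ∨ k = 3 ∨ k = 4)
    (d : Fin 2) (ch : ℝ) (m : State → State → State) {h : ℝ} (hh : 0 < h) (u : ℤ → State)
    (hu : ∀ i, Positive (u i)) (i : ℤ) :
    (1 / h) * (esEntropyFlux κ k d ch m u i - esEntropyFlux κ k d ch m u (i - 1))
      ≤ entropyVar (u i) ⬝ᵥ schemePart κ k d ch m h u i := by
  have e := entropyVar_dotProduct_highOrder k d ch h u hu i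
  have j1 := jump_dotProduct_diffusive_nonneg κ hk d ch m u i
  have j2 := jump_dotProduct_diffusive_nonneg κ hk d ch m u (i - 1)
  rw [show i - 1 + 1 = i by ring] at j2
  simp only [schemePart, esFlux, esEntropyFlux]
  rw [show i - 1 + 1 = i by ring]
  simp only [dotProduct_add, dotProduct_sub, sub_dotProduct, add_dotProduct, dotProduct_smul,
    smul_dotProduct, smul_eq_mul] at *
  have hi : 0 < h⁻¹ := inv_pos.2 hh
  have p1 := mul_nonneg hi.le j1
  have p2 := mul_nonneg hi.le j2
  rw [one_div]
  linarith

/-- The chain rule, with `hpp` supplying the differential of p⊥ from the equation of state. It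
confirms that `entropyVar` is the gradient of `entropy`. -/
theorem hasDerivAt_entropy {U : ℝ → State} {U' : State} {t : ℝ} (hU : HasDerivAt U U' t)
    (h : Positive (U t)) : HasDerivAt (fun s => entropy (U s)) (entropyVar (U t) ⬝ᵥ U') t := by
  have hc := hasDerivAt_pi.1 hU
  obtain ⟨h1, h2, h3⟩ := h
  have hv : ∀ j, HasDerivAt (fun s => U s j / U s 0)
      ((U' j * U t 0 - U t j * U' 0) / (U t 0) ^ 2) t := fun j => (hc j).div (hc 0) h1.ne'
  have hpp : HasDerivAt (fun s => pperp (U s))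
      (U' 5 - vel (U t) ⬝ᵥ ![U' 1, U' 2, U' 3] + (vel (U t) ⬝ᵥ vel (U t)) / 2 * U' 0
        - mag (U t) ⬝ᵥ ![U' 6, U' 7, U' 8] - U' 4 / 2 - psi (U t) * U' 9) t := by
    have hp := (hc 5).sub ((((((hc 0).mul ((((hv 1).mul (hv 1)).add ((hv 2).mul (hv 2))).add
      ((hv 3).mul (hv 3)))).add ((((hc 6).mul (hc 6)).add ((hc 7).mul (hc 7))).add
      ((hc 8).mul (hc 8)))).add (hc 4)).add ((hc 9).pow 2)).div_const 2)
    refine (hp.congr_deriv ?_).congr_of_eventuallyEq (Filter.Eventually.of_forall fun s => ?_)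
    · simp [dotProduct, Fin.sum_univ_three, vel, mag, psi]
      have : U t 0 ≠ 0 := h1.ne'
      field_simp
      ring
    · simp [pperp, dotProduct, Fin.sum_univ_three, vel, mag, psi, rho, ppar]
  have hlog := ((((hc 4).mul (hpp.pow 2)).div ((hc 0).pow 5) (pow_pos h1 5).ne').log
    (div_pos (mul_pos h2 (pow_pos h3 2)) (pow_pos h1 5)).ne')
  refine (((hc 0).neg.mul hlog).congr_deriv ?_)
  simp only [Pi.mul_apply, Pi.div_apply, Pi.pow_apply]
  rw [entropyVar, specificEntropy, betaPerp, betaPar]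
  change 0 < U t 0 at h1
  change 0 < U t 4 at h2
  simp only [dotProduct, Fin.sum_univ_succ, pack, rho, ppar]
  generalize Real.log _ = L
  simp
  field_simp
  ring

/-! ## Taylor expansion with parameters -/

section Taylor

open Filter Topology Asymptotics

variable {E G : Type*} [NormedAddCommGroup E] [NormedSpace ℝ E] [NormedAddCommGroup G]
  [NormedSpace ℝ G]

/-- The partial derivative is the full derivative applied to (0, 1). It feeds the inductions on the
order of differentiation. -/
theorem contDiffAt_deriv_snd {F : E × ℝ → G} {q : E × ℝ} {n : ℕ}
    (hF : ContDiffAt ℝ (n + 1 : ℕ) F q) :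
    ContDiffAt ℝ n (fun p : E × ℝ => deriv (fun s => F (p.1, s)) p.2) q := by
  have h1 : ContDiffAt ℝ n (fun p => fderiv ℝ F p (0, 1)) q :=
    (hF.fderiv_right (m := n) (by norm_cast)).clm_apply contDiffAt_const
  refine h1.congr_of_eventuallyEq ?_
  filter_upwards [hF.eventually (by simp)] with p hp
  have hd : HasFDerivAt F (fderiv ℝ F p) (p.1, p.2) :=
    (hp.differentiableAt (by simp)).hasFDerivAt
  have hl : HasDerivAt (fun s : ℝ => (p.1, s)) ((0 : E), (1 : ℝ)) p.2 :=
    (hasDerivAt_const _ _).prodMk (hasDerivAt_id _)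
  exact (hd.comp_hasDerivAt p.2 hl).deriv

/-- Taylor's theorem in the last variable, locally uniformly in the other ones. -/
theorem taylor_isBigO {z₀ : E} (n : ℕ) : ∀ {F : E × ℝ → G}, ContDiffAt ℝ n F (z₀, 0) →
    (fun p : E × ℝ => F p - ∑ l ∈ Finset.range n,
      (p.2 ^ l / l.factorial) • iteratedDeriv l (fun s => F (p.1, s)) 0)
      =O[𝓝 (z₀, 0)] fun p => p.2 ^ n := by
  induction n with
  | zero =>
    intro F hF
    simpa using hF.continuousAt.norm.isBoundedUnder_le.isBigO_one ℝ
  | succ n ih =>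
    intro F hF
    -- The t-derivative of the remainder is the remainder of lower order of the partial derivative.
    -- The mean value inequality on the segment from 0, where the remainder vanishes, gains the
    -- missing power.
    have hb := ih (contDiffAt_deriv_snd hF)
    obtain ⟨C, hC⟩ := hb.bound
    have hdiff : ∀ᶠ p : E × ℝ in 𝓝 (z₀, 0), DifferentiableAt ℝ F p := by
      filter_upwards [hF.eventually (by simp)] with p hp
      exact hp.differentiableAt (by simp)
    obtain ⟨ε, hε, hball⟩ := Metric.eventually_nhds_iff_ball.1 (hC.and hdiff)
    refine IsBigO.of_bound C ?_
    filter_upwards [Metric.ball_mem_nhds (z₀, (0 : ℝ)) hε] with p hp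
    have hmem : ∀ t ∈ Set.uIcc 0 p.2, (p.1, t) ∈ Metric.ball (z₀, (0 : ℝ)) ε := by
      intro t ht
      rw [Metric.mem_ball, Prod.dist_eq, max_lt_iff] at hp ⊢
      refine ⟨hp.1, lt_of_le_of_lt ?_ hp.2⟩
      simp only [Real.dist_eq, sub_zero]
      have := Set.abs_sub_left_of_mem_uIcc ht
      simpa using this
    set D : ℕ → G := fun l => iteratedDeriv l (fun s => F (p.1, s)) 0 with hD
    have hder : ∀ t ∈ Set.uIcc 0 p.2, HasDerivWithinAt
        (fun t => F (p.1, t) - ∑ l ∈ Finset.range (n + 1), (t ^ l / l.factorial) • D l)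
        (deriv (fun s => F (p.1, s)) t
          - ∑ l ∈ Finset.range n, (t ^ l / l.factorial) • D (l + 1)) (Set.uIcc 0 p.2) t := by
      intro t ht
      have h1 : HasDerivAt (fun s => F (p.1, s)) (deriv (fun s => F (p.1, s)) t) t := by
        have hd := (hball _ (hmem t ht)).2
        have hl : DifferentiableAt ℝ (fun s : ℝ => (p.1, s)) t := by fun_prop
        exact (DifferentiableAt.comp t hd hl).hasDerivAt
      have h2 : HasDerivAt (fun t : ℝ => ∑ l ∈ Finset.range (n + 1), (t ^ l / l.factorial) • D l)
          (∑ l ∈ Finset.range n, (t ^ l / l.factorial) • D (l + 1)) t := by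
        have h3 : ∀ l ∈ Finset.range (n + 1), HasDerivAt (fun t : ℝ => (t ^ l / l.factorial) • D l)
            (((l : ℝ) * t ^ (l - 1) / l.factorial) • D l) t := fun l _ =>
          ((hasDerivAt_pow l t).div_const _).smul_const _
        convert! HasDerivAt.fun_sum h3 using 1
        rw [Finset.sum_range_succ']
        simp only [Nat.cast_zero, zero_mul, zero_div, zero_smul, add_zero]
        refine Finset.sum_congr rfl fun l _ => ?_
        congr 1
        rw [Nat.factorial_succ, Nat.add_sub_cancel]
        push_cast
        field_simp
      exact (h1.sub h2).hasDerivWithinAt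
    have hbound : ∀ t ∈ Set.uIcc 0 p.2, ‖deriv (fun s => F (p.1, s)) t
          - ∑ l ∈ Finset.range n, (t ^ l / l.factorial) • D (l + 1)‖ ≤ C * |p.2| ^ n := by
      intro t ht
      have h1 := (hball _ (hmem t ht)).1
      have h2 : |t| ≤ |p.2| := by
        have := Set.abs_sub_left_of_mem_uIcc ht
        simpa using this
      simp only [hD, iteratedDeriv_succ']
      refine h1.trans ?_
      rw [norm_pow, Real.norm_eq_abs]
      rcases eq_or_ne n 0 with rfl | hn
      · simp
      -- The constant extracted from the estimate is not known to be nonnegative; it is forced to be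
      -- wherever the bound is not trivial.
      · have hC0 : 0 ≤ C ∨ |t| ^ n = 0 := by
          by_cases ht0 : t = 0
          · right; simp [ht0, hn]
          · left
            by_contra hneg
            have := (norm_nonneg _).trans h1
            rw [norm_pow, Real.norm_eq_abs] at this
            have hp : 0 < |t| ^ n := by positivity
            nlinarith
        rcases hC0 with h0 | h0
        · gcongr
        · rw [h0, mul_zero]
          by_contra hneg
          rw [not_le] at hneg
          have hp0 : p.2 ≠ 0 := by
            rintro h; rw [h] at hneg; simp [hn] at hneg
          have := (norm_nonneg _).trans (hball _ (hmem p.2 Set.right_mem_uIcc)).1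
          rw [norm_pow, Real.norm_eq_abs] at this
          linarith
    have hmv := (convex_uIcc (0 : ℝ) p.2).norm_image_sub_le_of_norm_hasDerivWithin_le hder hbound
      Set.left_mem_uIcc Set.right_mem_uIcc
    have hzero : F (p.1, 0) - ∑ l ∈ Finset.range (n + 1), ((0 : ℝ) ^ l / l.factorial) • D l = 0 := by
      rw [Finset.sum_range_succ']
      simp [hD]
    rw [hzero, sub_zero] at hmv
    refine hmv.trans_eq ?_
    rw [norm_pow, sub_zero, Real.norm_eq_abs, pow_succ, mul_assoc]

theorem taylor_isBigO_scaled {z₀ : E} {n : ℕ} {F : E × ℝ → G} (hF : ContDiffAt ℝ n F (z₀, 0))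
    (c : ℝ) : (fun p : E × ℝ => F (p.1, c * p.2) - ∑ l ∈ Finset.range n,
      ((c * p.2) ^ l / l.factorial) • iteratedDeriv l (fun s => F (p.1, s)) 0)
      =O[𝓝 (z₀, 0)] fun p => p.2 ^ n := by
  have ht : Tendsto (fun p : E × ℝ => (p.1, c * p.2)) (𝓝 (z₀, 0)) (𝓝 (z₀, 0)) := by
    have : Continuous (fun p : E × ℝ => (p.1, c * p.2)) := by fun_prop
    simpa using this.tendsto (z₀, (0 : ℝ))
  refine ((taylor_isBigO n hF).comp_tendsto ht).trans ?_
  refine IsBigO.of_bound (|c| ^ n) (Eventually.of_forall fun p => ?_)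
  simp [mul_pow]

/-- The n-th difference annihilates powers below n and maps the n-th power to n!, so only one Taylor
term survives. -/
theorem fwdDiff_taylor_isBigO {z₀ : E} {n : ℕ} {F : E × ℝ → G}
    (hF : ContDiffAt ℝ (n + 1 : ℕ) F (z₀, 0)) (s : ℤ) :
    (fun p : E × ℝ => (fwdDiff (1 : ℤ))^[n] (fun j : ℤ => F (p.1, (j : ℝ) * p.2)) s
      - p.2 ^ n • iteratedDeriv n (fun s => F (p.1, s)) 0)
      =O[𝓝 (z₀, 0)] fun p => p.2 ^ (n + 1) := by
  have hsum : (fun p : E × ℝ => ∑ k ∈ Finset.range (n + 1),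
      ((-1 : ℤ) ^ (n - k) * n.choose k) • (F (p.1, ((s + k • 1 : ℤ) : ℝ) * p.2)
        - ∑ l ∈ Finset.range (n + 1), ((((s + k • 1 : ℤ) : ℝ) * p.2) ^ l / l.factorial)
          • iteratedDeriv l (fun s => F (p.1, s)) 0)) =O[𝓝 (z₀, 0)] fun p => p.2 ^ (n + 1) := by
    refine IsBigO.fun_sum fun k _ => ?_
    simp only [← Int.cast_smul_eq_zsmul ℝ]
    exact (taylor_isBigO_scaled hF _).const_smul_left _
  refine hsum.congr_left fun p => ?_
  simp only [smul_sub, Finset.sum_sub_distrib]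
  rw [← fwdDiff_iter_eq_sum_shift (1 : ℤ) (fun j : ℤ => F (p.1, (j : ℝ) * p.2)) n s]
  congr 1
  simp only [Finset.smul_sum]
  rw [Finset.sum_comm]
  have hl : ∀ l, ∑ k ∈ Finset.range (n + 1), ((-1 : ℤ) ^ (n - k) * n.choose k) •
      ((((s + k • 1 : ℤ) : ℝ) * p.2) ^ l / l.factorial)
          • iteratedDeriv l (fun s => F (p.1, s)) 0
      = ((p.2 ^ l / l.factorial) * (fwdDiff (1 : ℝ))^[n] (fun x => x ^ l) (s : ℝ))
        • iteratedDeriv l (fun s => F (p.1, s)) 0 := by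
    intro l
    rw [← fwdDiff_iter_intCast (fun x => x ^ l), fwdDiff_iter_eq_sum_shift, Finset.mul_sum,
      Finset.sum_smul]
    refine Finset.sum_congr rfl fun k _ => ?_
    rw [← Int.cast_smul_eq_zsmul ℝ, ← Int.cast_smul_eq_zsmul ℝ, smul_smul]
    congr 1
    rw [smul_eq_mul, mul_pow]
    ring
  simp only [hl]
  rw [Finset.sum_range_succ, Finset.sum_eq_zero, zero_add, fwdDiff_iter_eq_factorial]
  · congr 1
    simp only [Pi.natCast_apply]
    field_simp
  · intro l hl
    rw [fwdDiff_iter_pow_eq_zero_of_lt (Finset.mem_range.1 hl)]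
    simp

/-- Same cancellation with an expansion one term shorter: all Taylor terms vanish and only the
remainder is left. -/
theorem fwdDiff_isBigO {z₀ : E} {n : ℕ} {F : E × ℝ → G} (hF : ContDiffAt ℝ n F (z₀, 0)) (s : ℤ) :
    (fun p : E × ℝ => (fwdDiff (1 : ℤ))^[n] (fun j : ℤ => F (p.1, (j : ℝ) * p.2)) s)
      =O[𝓝 (z₀, 0)] fun p => p.2 ^ n := by
  have hsum : (fun p : E × ℝ => ∑ k ∈ Finset.range (n + 1),
      ((-1 : ℤ) ^ (n - k) * n.choose k) • (F (p.1, ((s + k • 1 : ℤ) : ℝ) * p.2)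
        - ∑ l ∈ Finset.range n, ((((s + k • 1 : ℤ) : ℝ) * p.2) ^ l / l.factorial)
          • iteratedDeriv l (fun s => F (p.1, s)) 0)) =O[𝓝 (z₀, 0)] fun p => p.2 ^ n := by
    refine IsBigO.fun_sum fun k _ => ?_
    simp only [← Int.cast_smul_eq_zsmul ℝ]
    exact (taylor_isBigO_scaled hF _).const_smul_left _
  refine hsum.congr_left fun p => ?_
  simp only [smul_sub, Finset.sum_sub_distrib]
  rw [← fwdDiff_iter_eq_sum_shift (1 : ℤ) (fun j : ℤ => F (p.1, (j : ℝ) * p.2)) n s, sub_eq_self]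
  simp only [Finset.smul_sum]
  rw [Finset.sum_comm]
  refine Finset.sum_eq_zero fun l hl => ?_
  have h0 := congrFun (fwdDiff_iter_pow_eq_zero_of_lt (R := ℝ) (Finset.mem_range.1 hl)) (s : ℝ)
  rw [← fwdDiff_iter_intCast (fun x => x ^ l), fwdDiff_iter_eq_sum_shift] at h0
  have : ∑ k ∈ Finset.range (n + 1), ((-1 : ℤ) ^ (n - k) * n.choose k) •
      ((((s + k • 1 : ℤ) : ℝ) * p.2) ^ l / l.factorial)
          • iteratedDeriv l (fun s => F (p.1, s)) 0
      = ((p.2 ^ l / l.factorial) * ∑ k ∈ Finset.range (n + 1),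
        ((-1 : ℤ) ^ (n - k) * n.choose k) • (((s + k • 1 : ℤ) : ℝ)) ^ l)
        • iteratedDeriv l (fun s => F (p.1, s)) 0 := by
    rw [Finset.mul_sum, Finset.sum_smul]
    refine Finset.sum_congr rfl fun k _ => ?_
    rw [← Int.cast_smul_eq_zsmul ℝ, ← Int.cast_smul_eq_zsmul ℝ, smul_smul]
    congr 1
    rw [smul_eq_mul, mul_pow]
    ring
  rw [this, h0]
  simp

end Taylor

section MeshFilter

open Filter Topology Asymptotics

variable {E : Type*} [NormedAddCommGroup E]

/-- The filter of small positive mesh sizes at points near `z₀`. -/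
def meshFilter (z₀ : E) : Filter (E × ℝ) := 𝓝 z₀ ×ˢ 𝓝[>] (0 : ℝ)

theorem meshFilter_le (z₀ : E) : meshFilter z₀ ≤ 𝓝 (z₀, (0 : ℝ)) := by
  rw [meshFilter, nhds_prod_eq]
  exact Filter.prod_mono le_rfl nhdsWithin_le_nhds

theorem meshFilter_pos (z₀ : E) : ∀ᶠ p : E × ℝ in meshFilter z₀, 0 < p.2 :=
  tendsto_snd.eventually (self_mem_nhdsWithin : Set.Ioi (0 : ℝ) ∈ 𝓝[>] (0 : ℝ))

theorem meshFilter_lt_one (z₀ : E) : ∀ᶠ p : E × ℝ in meshFilter z₀, p.2 < 1 :=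
  tendsto_snd.eventually (nhdsWithin_le_nhds (Iio_mem_nhds one_pos))

theorem isBigO_pow_of_le (z₀ : E) {m n : ℕ} (h : m ≤ n) :
    (fun p : E × ℝ => p.2 ^ n) =O[meshFilter z₀] fun p => p.2 ^ m := by
  refine IsBigO.of_bound 1 ?_
  filter_upwards [meshFilter_pos z₀, meshFilter_lt_one z₀] with p h0 h1
  rw [one_mul, norm_pow, norm_pow, Real.norm_of_nonneg h0.le]
  exact pow_le_pow_of_le_one h0.le h1.le h

variable {G : Type*} [NormedAddCommGroup G] [NormedSpace ℝ G]

theorem IsBigO.inv_smul {z₀ : E} {n : ℕ} {f : E × ℝ → G}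
    (hf : f =O[meshFilter z₀] fun p => p.2 ^ (n + 1)) :
    (fun p => p.2⁻¹ • f p) =O[meshFilter z₀] fun p => p.2 ^ n := by
  refine ((isBigO_refl (fun p : E × ℝ => p.2⁻¹) (meshFilter z₀)).smul hf).congr' .rfl ?_
  filter_upwards [meshFilter_pos z₀] with p hp
  rw [smul_eq_mul, pow_succ]
  field_simp

/-- Accuracy of the central differences. -/
theorem central_isBigO [NormedSpace ℝ E] {z₀ : E} {k : ℕ} (hk : k = 2 ∨ k = 3 ∨ k = 4) {F : E × ℝ → G}
    (hF : ContDiffAt ℝ ∞ F (z₀, 0)) :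
    (fun p : E × ℝ => central k p.2 (fun j : ℤ => F (p.1, (j : ℝ) * p.2)) 0
      - deriv (fun s => F (p.1, s)) 0) =O[meshFilter z₀] fun p => p.2 ^ k := by
  have hT := fun (n : ℕ) (c : ℝ) => (taylor_isBigO_scaled (n := n)
    (hF.of_le (by exact_mod_cast le_top)) c).mono (meshFilter_le z₀)
  by_cases h2 : k = 2
  · subst h2
    have h := IsBigO.inv_smul (((hT 3 1).sub (hT 3 (-1))).const_smul_left (1 / 2 : ℝ))
    refine h.congr' ?_ .rfl
    filter_upwards [meshFilter_pos z₀] with p hp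
    simp only [central, if_true, Finset.sum_range_succ, Finset.sum_range_zero, iteratedDeriv_zero,
      iteratedDeriv_one, Nat.factorial]
    push_cast
    simp only [Pi.smul_apply, zero_add, one_mul]
    match_scalars <;> field_simp <;> ring
  -- The same fourth-order stencil serves k = 3 and k = 4.
  · have hk4 : k ≤ 4 := by omega
    have h := IsBigO.inv_smul ((((((hT 5 2).const_smul_left (-1 : ℝ)).add
      ((hT 5 1).const_smul_left (8 : ℝ))).sub ((hT 5 (-1)).const_smul_left (8 : ℝ))).add
      (hT 5 (-2))).const_smul_left (1 / 12 : ℝ))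
    refine (h.congr' ?_ .rfl).trans (isBigO_pow_of_le z₀ hk4)
    filter_upwards [meshFilter_pos z₀] with p hp
    simp only [central, if_neg h2, Finset.sum_range_succ, Finset.sum_range_zero,
      iteratedDeriv_zero, iteratedDeriv_one, Nat.factorial]
    push_cast
    simp only [Pi.smul_apply, zero_add, one_mul]
    match_scalars <;> field_simp <;> ring

end MeshFilter

/-! ## Smoothness of the two-point flux -/

section Smooth

open Filter Topology Asymptotics

/-- The slope of the logarithm at 1, extended continuously, absorbs the case distinction at equal
arguments. -/
theorem logMean_eq_dslope {a b : ℝ} (ha : 0 < a) (hb : 0 < b) :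
    logMean a b = a / dslope Real.log 1 (b / a) := by
  unfold logMean
  split_ifs with h
  · rw [← h, div_self ha.ne', dslope_same, Real.deriv_log]
    simp
  · have h1 : b / a ≠ 1 := fun e => h ((div_eq_one_iff_eq ha.ne').1 e).symm
    rw [dslope_of_ne _ h1, slope_def_field, Real.log_div hb.ne' ha.ne', Real.log_one, sub_zero]
    have h2 : Real.log b - Real.log a ≠ 0 :=
      sub_ne_zero.2 fun e => h (Real.log_injOn_pos hb ha e).symm
    have h3 : b / a - 1 = (b - a) / a := by field_simp
    rw [h3, div_div_eq_mul_div]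
    field_simp

/-- Dividing the zero at 1 out of the logarithm leaves an analytic function with value 1 there, so
the quotient is smooth across the diagonal. -/
theorem contDiffAt_logMean {a : ℝ} (ha : 0 < a) :
    ContDiffAt ℝ ∞ (fun w : ℝ × ℝ => logMean w.1 w.2) (a, a) := by
  have hlog : AnalyticAt ℝ Real.log 1 := analyticAt_log one_pos
  obtain ⟨p, hp⟩ := hlog
  have hd : ContDiffAt ℝ ∞ (dslope Real.log 1) 1 :=
    (HasFPowerSeriesAt.has_fpower_series_dslope_fslope hp).analyticAt.contDiffAt
  have hq : ContDiffAt ℝ ∞ (fun w : ℝ × ℝ => w.2 / w.1) (a, a) :=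
    contDiffAt_snd.div contDiffAt_fst ha.ne'
  have hd' : ContDiffAt ℝ ∞ (fun w : ℝ × ℝ => dslope Real.log 1 (w.2 / w.1)) (a, a) := by
    refine ContDiffAt.comp (a, a) (g := dslope Real.log 1) (f := fun w : ℝ × ℝ => w.2 / w.1) ?_ hq
    simpa [div_self ha.ne'] using hd
  refine (contDiffAt_fst.div hd' ?_).congr_of_eventuallyEq ?_
  · simp [div_self ha.ne', dslope_same, Real.deriv_log]
  · filter_upwards [continuousAt_fst.eventually (lt_mem_nhds ha),
      continuousAt_snd.eventually (lt_mem_nhds ha)] with w h1 h2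
    exact logMean_eq_dslope h1 h2

theorem contDiff_coord (j : Fin 10) : ContDiff ℝ ∞ (fun U : State => U j) := contDiff_apply ℝ ℝ j

theorem contDiff_rho : ContDiff ℝ ∞ rho := contDiff_coord 0

theorem contDiff_ppar : ContDiff ℝ ∞ ppar := contDiff_coord 4

theorem contDiff_psi : ContDiff ℝ ∞ psi := contDiff_coord 9

theorem contDiff_mag (i : Fin 3) : ContDiff ℝ ∞ (fun U => mag U i) := by
  fin_cases i
  · exact contDiff_coord 6
  · exact contDiff_coord 7
  · exact contDiff_coord 8

theorem contDiffAt_vel {U : State} (h : rho U ≠ 0) (i : Fin 3) :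
    ContDiffAt ℝ ∞ (fun U => vel U i) U := by
  fin_cases i
  · exact (contDiff_coord 1).contDiffAt.div contDiff_rho.contDiffAt h
  · exact (contDiff_coord 2).contDiffAt.div contDiff_rho.contDiffAt h
  · exact (contDiff_coord 3).contDiffAt.div contDiff_rho.contDiffAt h

theorem contDiffAt_dotProduct {E : Type*} [NormedAddCommGroup E] [NormedSpace ℝ E] {n : ℕ}
    {f g : E → Fin n → ℝ} {q : E} (hf : ∀ i, ContDiffAt ℝ ∞ (fun w => f w i) q)
    (hg : ∀ i, ContDiffAt ℝ ∞ (fun w => g w i) q) : ContDiffAt ℝ ∞ (fun w => f w ⬝ᵥ g w) q :=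
  ContDiffAt.sum fun i _ => (hf i).mul (hg i)

theorem contDiffAt_pack {E : Type*} [NormedAddCommGroup E] [NormedSpace ℝ E] {q : E}
    {r p e s : E → ℝ} {m b : E → Fin 3 → ℝ} (hr : ContDiffAt ℝ ∞ r q)
    (hm : ∀ i, ContDiffAt ℝ ∞ (fun w => m w i) q) (hp : ContDiffAt ℝ ∞ p q)
    (he : ContDiffAt ℝ ∞ e q) (hb : ∀ i, ContDiffAt ℝ ∞ (fun w => b w i) q)
    (hs : ContDiffAt ℝ ∞ s q) :
    ContDiffAt ℝ ∞ (fun w => pack (r w) (m w) (p w) (e w) (b w) (s w)) q := by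
  rw [contDiffAt_pi]
  intro j
  fin_cases j
  · exact hr
  · exact hm 0
  · exact hm 1
  · exact hm 2
  · exact hp
  · exact he
  · exact hb 0
  · exact hb 1
  · exact hb 2
  · exact hs

theorem contDiffAt_magSq (U : State) : ContDiffAt ℝ ∞ (fun U => mag U ⬝ᵥ mag U) U :=
  contDiffAt_dotProduct (fun i => (contDiff_mag i).contDiffAt) fun i => (contDiff_mag i).contDiffAt

theorem contDiffAt_velSq {U : State} (h : rho U ≠ 0) :
    ContDiffAt ℝ ∞ (fun U => vel U ⬝ᵥ vel U) U :=
  contDiffAt_dotProduct (contDiffAt_vel h) (contDiffAt_vel h)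

theorem contDiffAt_pperp {U : State} (h : rho U ≠ 0) : ContDiffAt ℝ ∞ pperp U :=
  (contDiff_coord 5).contDiffAt.sub (((((contDiff_rho.contDiffAt.mul (contDiffAt_velSq h)).add
    (contDiffAt_magSq U)).add contDiff_ppar.contDiffAt).add
    (contDiff_psi.contDiffAt.pow 2)).div_const 2)

theorem contDiffAt_betaPerp {U : State} (h : Positive U) : ContDiffAt ℝ ∞ betaPerp U :=
  contDiff_rho.contDiffAt.div (contDiffAt_pperp h.1.ne') h.2.2.ne'

theorem contDiffAt_betaPar {U : State} (h : Positive U) : ContDiffAt ℝ ∞ betaPar U :=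
  contDiff_rho.contDiffAt.div contDiff_ppar.contDiffAt h.2.1.ne'

theorem eventually_positive {U : State} (h : Positive U) : ∀ᶠ W in 𝓝 U, Positive W := by
  filter_upwards [contDiff_rho.continuous.continuousAt.eventually (lt_mem_nhds h.1),
    contDiff_ppar.continuous.continuousAt.eventually (lt_mem_nhds h.2.1),
    (contDiffAt_pperp h.1.ne').continuousAt.eventually (lt_mem_nhds h.2.2)] with W h1 h2 h3
  exact ⟨h1, h2, h3⟩

theorem contDiffAt_specificEntropy {U : State} (h : Positive U) :
    ContDiffAt ℝ ∞ specificEntropy U := by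
  exact ((contDiff_ppar.contDiffAt.mul ((contDiffAt_pperp h.1.ne').pow 2)).div
    (contDiff_rho.contDiffAt.pow 5) (pow_pos h.1 5).ne').log
    (div_pos (mul_pos h.2.1 (pow_pos h.2.2 2)) (pow_pos h.1 5)).ne'

theorem contDiffAt_entropyVar {U : State} (h : Positive U) : ContDiffAt ℝ ∞ entropyVar U :=
  contDiffAt_pack
    ((contDiffAt_const.sub (contDiffAt_specificEntropy h)).sub
      ((contDiffAt_betaPerp h).mul (contDiffAt_velSq h.1.ne')))
    (fun i => (contDiffAt_const.mul (contDiffAt_betaPerp h)).mul (contDiffAt_vel h.1.ne' i))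
    ((contDiffAt_betaPerp h).sub (contDiffAt_betaPar h))
    (contDiffAt_const.mul (contDiffAt_betaPerp h))
    (fun i => (contDiffAt_const.mul (contDiffAt_betaPerp h)).mul (contDiff_mag i).contDiffAt)
    ((contDiffAt_const.mul (contDiffAt_betaPerp h)).mul contDiff_psi.contDiffAt)

theorem contDiffAt_mean {g : State → ℝ} {a b : State} (ha : ContDiffAt ℝ ∞ g a)
    (hb : ContDiffAt ℝ ∞ g b) : ContDiffAt ℝ ∞ (fun w : State × State => mean g w.1 w.2) (a, b) :=
  ((ContDiffAt.comp (a, b) (f := Prod.fst) ha contDiffAt_fst).add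
    (ContDiffAt.comp (a, b) (f := Prod.snd) hb contDiffAt_snd)).div_const 2

theorem contDiffAt_logMean_comp {g : State → ℝ} {a : State} (h : 0 < g a)
    (ha : ContDiffAt ℝ ∞ g a) :
    ContDiffAt ℝ ∞ (fun w : State × State => logMean (g w.1) (g w.2)) (a, a) :=
  ContDiffAt.comp (a, a) (g := fun w : ℝ × ℝ => logMean w.1 w.2)
    (f := fun w : State × State => (g w.1, g w.2)) (contDiffAt_logMean h)
    ((ContDiffAt.comp (a, a) (f := Prod.fst) ha contDiffAt_fst).prodMk
      (ContDiffAt.comp (a, a) (f := Prod.snd) ha contDiffAt_snd))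

/-- The two-point flux is smooth at the diagonal. -/
theorem contDiffAt_ecFlux (d : Fin 2) (ch : ℝ) {a : State} (h : Positive a) :
    ContDiffAt ℝ ∞ (fun w : State × State => ecFlux d ch w.1 w.2) (a, a) := by
  have h0 := h.1.ne'
  have mv := fun i => contDiffAt_mean (contDiffAt_vel h0 i) (contDiffAt_vel h0 i)
  have mB := fun i => contDiffAt_mean (a := a) (b := a) (contDiff_mag i).contDiffAt
    (contDiff_mag i).contDiffAt
  have mBB := contDiffAt_mean (contDiffAt_magSq a) (contDiffAt_magSq a)
  have mvv := contDiffAt_mean (contDiffAt_velSq h0) (contDiffAt_velSq h0)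
  have mρ := contDiffAt_mean (a := a) (b := a) contDiff_rho.contDiffAt contDiff_rho.contDiffAt
  have mβ := contDiffAt_mean (contDiffAt_betaPerp h) (contDiffAt_betaPerp h)
  have mβv := fun i => contDiffAt_mean ((contDiffAt_betaPerp h).mul (contDiffAt_vel h0 i))
    ((contDiffAt_betaPerp h).mul (contDiffAt_vel h0 i))
  have mΨ := contDiffAt_mean (contDiff_psi.contDiffAt.mul (contDiffAt_betaPerp h))
    (contDiff_psi.contDiffAt.mul (contDiffAt_betaPerp h))
  have hβ : mean betaPerp a a ≠ 0 := by
    have := h.betaPerp_pos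
    unfold mean; positivity
  have lβ := contDiffAt_logMean_comp h.betaPerp_pos (contDiffAt_betaPerp h)
  have lp := contDiffAt_logMean_comp h.betaPar_pos (contDiffAt_betaPar h)
  have hm : ContDiffAt ℝ ∞ (fun w : State × State => ecMass d w.1 w.2) (a, a) :=
    (contDiffAt_logMean_comp h.1 contDiff_rho.contDiffAt).mul (mv _)
  have hmom : ∀ i, ContDiffAt ℝ ∞ (fun w : State × State => ecMomentum d w.1 w.2 i) (a, a) := by
    intro i
    refine (((mv i).mul hm).sub ((mB _).mul (mB i))).add ?_
    split_ifs
    · exact (mρ.div mβ hβ).add (mBB.div_const 2)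
    · exact contDiffAt_const
  have hpar : ContDiffAt ℝ ∞ (fun w : State × State => ecPar d w.1 w.2) (a, a) :=
    hm.div lp (logMean_pos h.betaPar_pos h.betaPar_pos).ne'
  have hmag : ∀ i, ContDiffAt ℝ ∞ (fun w : State × State => ecMag d ch w.1 w.2 i) (a, a) := by
    intro i
    refine ((((mβv _).mul (mB i)).sub ((mβv i).mul (mB _))).div mβ hβ).add ?_
    split_ifs
    · exact (contDiffAt_const.mul mΨ).div mβ hβ
    · exact contDiffAt_const
  have hen : ContDiffAt ℝ ∞ (fun w : State × State => ecEnergy d ch w.1 w.2) (a, a) :=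
    (((((((contDiffAt_const.div lβ (logMean_pos h.betaPerp_pos h.betaPerp_pos).ne').sub
      mvv).div_const 2).mul hm).add (ContDiffAt.sum fun i _ => (mv i).mul (hmom i))).add
      (hpar.div_const 2)).add (ContDiffAt.sum fun i _ => (mB i).mul (hmag i))).sub
      (((mv _).mul mBB).div_const 2) |>.add
      ((ContDiffAt.sum fun i _ => (mv i).mul (mB i)).mul (mB _))
  exact contDiffAt_pack hm hmom hpar hen hmag (contDiffAt_const.mul (mB _))

theorem mean_comm (g : State → ℝ) (a b : State) : mean g a b = mean g b a := by
  unfold mean; ring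

theorem logMean_comm (a b : ℝ) : logMean a b = logMean b a := by
  unfold logMean
  by_cases h : a = b
  · simp [h]
  · rw [if_neg h, if_neg (Ne.symm h), ← neg_sub, ← neg_sub (Real.log a), neg_div_neg_eq]

theorem ecFlux_comm (d : Fin 2) (ch : ℝ) (a b : State) : ecFlux d ch a b = ecFlux d ch b a := by
  have h1 : ecMass d a b = ecMass d b a := by
    simp only [ecMass, logMean_comm (rho a), mean_comm _ a]
  have h2 : ecMomentum d a b = ecMomentum d b a := by
    funext i; simp only [ecMomentum, h1, mean_comm _ a]
  have h3 : ecPar d a b = ecPar d b a := by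
    simp only [ecPar, h1, logMean_comm (betaPar a)]
  have h4 : ecMag d ch a b = ecMag d ch b a := by
    funext i; simp only [ecMag, mean_comm _ a]
  have h5 : ecEnergy d ch a b = ecEnergy d ch b a := by
    simp only [ecEnergy, h1, h2, h3, h4, mean_comm _ a, logMean_comm (betaPerp a)]
  simp only [ecFlux, h1, h2, h3, h4, h5, mean_comm _ a]

theorem ecFlux_self (d : Fin 2) (ch : ℝ) {U : State} (h : Positive U) :
    ecFlux d ch U U = flux d ch U := by
  obtain ⟨h1, h2, h3⟩ := h
  have hm : ∀ g : State → ℝ, mean g U U = g U := fun g => by unfold mean; ring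
  have hl : ∀ a : ℝ, logMean a a = a := fun a => by simp [logMean]
  have hE : U 5 = pperp U
      + (rho U * (vel U ⬝ᵥ vel U) + mag U ⬝ᵥ mag U + ppar U + psi U ^ 2) / 2 := by
    unfold pperp; ring
  have e1 : ecMass d U U = rho U * vel U (nrm d) := by simp only [ecMass, hm, hl]
  have e2 : ecMomentum d U U = fun i => rho U * vel U (nrm d) * vel U i
      - mag U (nrm d) * mag U i + if i = nrm d then pperp U + (mag U ⬝ᵥ mag U) / 2 else 0 := by
    funext i
    simp only [ecMomentum, hm, e1, betaPerp]
    split_ifs <;> field_simp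
  have e3 : ecPar d U U = ppar U * vel U (nrm d) := by
    simp only [ecPar, e1, hl, betaPar]; field_simp
  have e4 : ecMag d ch U U = fun i => vel U (nrm d) * mag U i - vel U i * mag U (nrm d)
      + if i = nrm d then ch * psi U else 0 := by
    funext i
    simp only [ecMag, hm, betaPerp]
    split_ifs <;> field_simp
  have e5 : ecEnergy d ch U U = vel U (nrm d) * ((U 5 - psi U ^ 2 / 2) + pperp U
      + (mag U ⬝ᵥ mag U) / 2) - mag U (nrm d) * (mag U ⬝ᵥ vel U) + ch * psi U * mag U (nrm d) := by
    simp only [ecEnergy, hm, hl, e1, e2, e3, e4, hE, betaPerp]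
    simp only [dotProduct, Fin.sum_univ_three]
    fin_cases d <;> simp [nrm] <;> field_simp <;> ring
  rw [ecFlux, flux, e1, e2, e3, e4, e5, hm]

end Smooth

/-! ## Accuracy of the entropy conservative part -/

section Consistency

open Filter Topology Asymptotics

theorem mulVec_isBigO {α : Type*} {l : Filter α} {n m : ℕ} {A : α → Matrix (Fin n) (Fin m) ℝ}
    {f : α → Fin m → ℝ} {g : α → ℝ} (hA : ∀ i j, (fun a => A a i j) =O[l] fun _ => (1 : ℝ))
    (hf : f =O[l] g) : (fun a => A a *ᵥ f a) =O[l] g := by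
  rw [isBigO_pi] at hf ⊢
  intro i
  change (fun a => ∑ j, A a i j * f a j) =O[l] g
  refine IsBigO.fun_sum fun j _ => ?_
  simpa using (hA i j).mul (hf j)

theorem magSq_pos {U : State} (h : mag U ≠ 0) : 0 < mag U ⬝ᵥ mag U :=
  lt_of_le_of_ne (Finset.sum_nonneg fun _ _ => mul_self_nonneg _)
    (Ne.symm (dotProduct_self_eq_zero.not.2 h))

theorem contDiffAt_bdir {U : State} (h : mag U ≠ 0) (i : Fin 3) :
    ContDiffAt ℝ ∞ (fun U => bdir U i) U := by
  have h0 := magSq_pos h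
  exact (contDiff_mag i).contDiffAt.div ((contDiffAt_magSq U).sqrt h0.ne') (Real.sqrt_pos.2 h0).ne'

theorem contDiffAt_dVel {U : State} (h : rho U ≠ 0) (i : Fin 3) :
    ContDiffAt ℝ ∞ (fun U => dVel U i) U := by
  have h1 := contDiff_rho.contDiffAt.inv h
  have h2 := fun (i : Fin 3) (j : Fin 10) => h1.smul
    ((contDiffAt_const (c := coord j)).sub ((contDiffAt_vel h i).smul
      (contDiffAt_const (c := coord 0))))
  fin_cases i
  · exact h2 0 1
  · exact h2 1 2
  · exact h2 2 3

theorem contDiffAt_ncMomentumRow (d : Fin 2) {U : State} (h : Admissible U) (i : Fin 3) :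
    ContDiffAt ℝ ∞ (fun U => ncMomentumRow d U i) U := by
  have h0 := magSq_pos h.2
  have hv := contDiffAt_vel h.1.1.ne'
  have hb := contDiffAt_bdir h.2
  have h1 : ContDiffAt ℝ ∞ dDeltaP U :=
    contDiffAt_pack ((contDiffAt_velSq h.1.1.ne').neg.div_const 2) hv contDiffAt_const
      contDiffAt_const (fun i => (contDiff_mag i).contDiffAt) contDiff_psi.contDiffAt
  have h2 : ∀ i, ContDiffAt ℝ ∞ (fun U => dBdir U i) U := fun i =>
    (((contDiffAt_magSq U).sqrt h0.ne').inv (Real.sqrt_pos.2 h0).ne').smul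
      (contDiffAt_const.sub ((hb i).smul
        (ContDiffAt.sum fun l _ => (hb l).smul contDiffAt_const)))
  have h3 : ContDiffAt ℝ ∞ (fun U => dBB d U i) U :=
    ((hb i).smul (h2 _)).add ((hb _).smul (h2 i))
  exact (((hb _).mul (hb i)).smul h1).add
    ((contDiff_ppar.contDiffAt.sub (contDiffAt_pperp h.1.1.ne')).smul h3)

/-- Only local boundedness of C_d is needed. The nonvanishing field of an admissible state enters
the estimate of the conservative error here, through b = B/|B|. -/
theorem continuousAt_ncMatrix (d : Fin 2) {U : State} (h : Admissible U) (i j : Fin 10) :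
    ContinuousAt (fun U => ncMatrix d U i j) U := by
  have hr := contDiffAt_ncMomentumRow d h
  have hb := contDiffAt_bdir h.2
  have hv := contDiffAt_vel h.1.1.ne'
  have hs : ContDiffAt ℝ ∞ (fun U => ∑ i, bdir U i • dVel U i) U :=
    ContDiffAt.sum fun i _ => (hb i).smul (contDiffAt_dVel h.1.1.ne' i)
  have hp := contDiff_ppar.contDiffAt (x := U)
  refine continuousAt_pi.1 (?_ : ContinuousAt (fun U => ncMatrix d U i) U) j
  fin_cases i
  · exact continuousAt_const
  · exact (hr 0).continuousAt
  · exact (hr 1).continuousAt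
  · exact (hr 2).continuousAt
  · exact (((contDiffAt_const.mul hp).mul (hb _)).smul hs).continuousAt
  · exact ((ContDiffAt.sum fun i _ => (hv i).smul (hr i)).add
      (((hp.sub (contDiffAt_pperp h.1.1.ne')).mul (hb _)).smul hs)).continuousAt
  all_goals exact continuousAt_const

theorem contDiffAt_godunov {U : State} (h : Positive U) : ContDiffAt ℝ ∞ godunov U :=
  contDiffAt_pack contDiffAt_const (fun i => (contDiff_mag i).contDiffAt) contDiffAt_const
    (contDiffAt_dotProduct (contDiffAt_vel h.1.ne') fun i => (contDiff_mag i).contDiffAt)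
    (contDiffAt_vel h.1.ne') contDiffAt_const

theorem contDiffAt_upsilon (d : Fin 2) {U : State} (h : Positive U) :
    ContDiffAt ℝ ∞ (upsilon d) U :=
  contDiffAt_pack contDiffAt_const (fun _ => contDiffAt_const) contDiffAt_const
    (contDiff_psi.contDiffAt.mul (contDiffAt_vel h.1.ne' _)) (fun _ => contDiffAt_const)
    (contDiffAt_vel h.1.ne' _)

/-- For symmetric consistent two-point fluxes the high order flux differences are central
differences. -/
theorem highOrder_sub_eq_central {E : Type*} [AddCommGroup E] [Module ℝ E] (k : ℕ)
    {g : State → State → E} (hg : ∀ a b, g a b = g b a) (h : ℝ) (u : ℤ → State) :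
    h⁻¹ • (highOrder k g u 0 - highOrder k g u (-1))
      = (2 : ℝ) • central k h (fun j => g (u 0) (u j)) 0 := by
  -- The pair u(-1), u 1 occurs in both interface values and cancels; every other pair contains u 0.
  simp only [highOrder, central]
  rw [show (-1 : ℤ) + 1 = 0 by norm_num, show (-1 : ℤ) - 1 = -2 by norm_num,
    show (-1 : ℤ) + 2 = 1 by norm_num, show (0 : ℤ) + 1 = 1 by norm_num,
    show (0 : ℤ) - 1 = -1 by norm_num, show (0 : ℤ) + 2 = 2 by norm_num,
    show (0 : ℤ) - 2 = -2 by norm_num, hg (u (-1)) (u 0), hg (u (-2)) (u 0)]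
  by_cases hh : h = 0
  · subst hh; simp
  · split_ifs
    · match_scalars <;> field_simp
    · match_scalars <;> field_simp <;> norm_num

/-- Differentiate f̃(v, v) = f(v): by symmetry both slots contribute equally. The factor 2 matches
the one in `highOrder_sub_eq_central`. -/
theorem deriv_ecFlux_right (d : Fin 2) (ch : ℝ) {v : ℝ → State} (hv : DifferentiableAt ℝ v 0)
    (hp : Positive (v 0)) :
    deriv (fun r => flux d ch (v r)) 0 = (2 : ℝ) • deriv (fun r => ecFlux d ch (v 0) (v r)) 0 := by
  have hG := ((contDiffAt_ecFlux d ch hp).differentiableAt (by simp)).hasFDerivAt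
  set L := fderiv ℝ (fun w : State × State => ecFlux d ch w.1 w.2) (v 0, v 0)
  have hd := hv.hasDerivAt
  have h1 : HasDerivAt (fun r => ecFlux d ch (v r) (v r)) (L (deriv v 0, deriv v 0)) 0 :=
    HasFDerivAt.comp_hasDerivAt (f := fun r => (v r, v r)) (0 : ℝ) hG (hd.prodMk hd)
  have h2 : HasDerivAt (fun r => ecFlux d ch (v 0) (v r)) (L (0, deriv v 0)) 0 :=
    HasFDerivAt.comp_hasDerivAt (f := fun r => (v 0, v r)) (0 : ℝ) hG ((hasDerivAt_const (0 : ℝ) (v 0)).prodMk hd)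
  have h3 : HasDerivAt (fun r => ecFlux d ch (v r) (v 0)) (L (deriv v 0, 0)) 0 :=
    HasFDerivAt.comp_hasDerivAt (f := fun r => (v r, v 0)) (0 : ℝ) hG (hd.prodMk (hasDerivAt_const (0 : ℝ) (v 0)))
  have h4 : L (deriv v 0, 0) = L (0, deriv v 0) := by
    refine h3.unique (h2.congr_of_eventuallyEq (Eventually.of_forall fun r => ?_))
    exact ecFlux_comm d ch _ _
  have h5 : (fun r => flux d ch (v r)) =ᶠ[𝓝 0] fun r => ecFlux d ch (v r) (v r) := by
    filter_upwards [hv.continuousAt.eventually (eventually_positive hp)] with r hr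
    exact (ecFlux_self d ch hr).symm
  rw [h5.deriv_eq, h1.deriv, h2.deriv, two_smul]
  nth_rewrite 1 [← h4]
  rw [← map_add]
  simp

/-- The grid line through `z` in the direction `e` with mesh size `h`. -/
def gridLine (u : ℝ × ℝ → State) (e : ℝ × ℝ) (p : (ℝ × ℝ) × ℝ) (j : ℤ) : State :=
  u (p.1 + ((j : ℝ) * p.2) • e)

theorem gridLine_zero (u : ℝ × ℝ → State) (e : ℝ × ℝ) (p : (ℝ × ℝ) × ℝ) :
    gridLine u e p 0 = u p.1 := by simp [gridLine]

theorem contDiffAt_line {u : ℝ × ℝ → State} {z₀ : ℝ × ℝ} (hu : ContDiffAt ℝ ∞ u z₀) (e : ℝ × ℝ) :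
    ContDiffAt ℝ ∞ (fun p : (ℝ × ℝ) × ℝ => u (p.1 + p.2 • e)) (z₀, 0) := by
  refine ContDiffAt.comp (z₀, (0 : ℝ)) (g := u) (f := fun p : (ℝ × ℝ) × ℝ => p.1 + p.2 • e) ?_ ?_
  · simpa using hu
  · exact contDiffAt_fst.add (contDiffAt_snd.smul contDiffAt_const)

theorem tendsto_fst_meshFilter (z₀ : ℝ × ℝ) : Tendsto Prod.fst (meshFilter z₀) (𝓝 z₀) :=
  tendsto_fst

/-- Apart from the diffusion, the scheme approximates the differential operator of order `k`. -/
theorem schemePart_sub_pdePart_isBigO (κ : ENOKind) {k : ℕ} (hk : k = 2 ∨ k = 3 ∨ k = 4)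
    (d : Fin 2) (ch : ℝ) (m : State → State → State) {u : ℝ × ℝ → State} {z₀ : ℝ × ℝ}
    (hu : ContDiffAt ℝ ∞ u z₀) (ha : Admissible (u z₀)) (e : ℝ × ℝ) :
    (fun p : (ℝ × ℝ) × ℝ => schemePart κ k d ch m p.2 (gridLine u e p) 0
      + (1 / 2 : ℝ) • (p.2⁻¹ • (diffusive κ k d ch m (gridLine u e p) 0
        - diffusive κ k d ch m (gridLine u e p) (-1)))
      - pdePart d ch (fun s => u (p.1 + s • e)) 0) =O[meshFilter z₀] fun p => p.2 ^ k := by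
  have hl := contDiffAt_line hu e
  have hl0 : u (z₀ + (0 : ℝ) • e) = u z₀ := by simp
  have hz := tendsto_fst_meshFilter z₀
  have huz : Tendsto (fun p : (ℝ × ℝ) × ℝ => u p.1) (meshFilter z₀) (𝓝 (u z₀)) :=
    hu.continuousAt.tendsto.comp hz
  have c1 : ContDiffAt ℝ ∞ (fun p : (ℝ × ℝ) × ℝ => ecFlux d ch (u p.1) (u (p.1 + p.2 • e)))
      (z₀, 0) := by
    refine ContDiffAt.comp (z₀, (0 : ℝ)) (g := fun w : State × State => ecFlux d ch w.1 w.2)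
      (f := fun p : (ℝ × ℝ) × ℝ => (u p.1, u (p.1 + p.2 • e))) ?_ ?_
    · simp only [hl0]
      exact contDiffAt_ecFlux d ch ha.1
    · exact (ContDiffAt.comp (z₀, (0 : ℝ)) (g := u) (f := Prod.fst) hu contDiffAt_fst).prodMk hl
  have c2 : ContDiffAt ℝ ∞ (fun p : (ℝ × ℝ) × ℝ => mag (u (p.1 + p.2 • e)) (nrm d)) (z₀, 0) :=
    (contDiff_mag (nrm d)).contDiffAt.comp (z₀, (0 : ℝ)) hl
  have c3 : ContDiffAt ℝ ∞ (fun p : (ℝ × ℝ) × ℝ => psi (u (p.1 + p.2 • e))) (z₀, 0) :=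
    contDiff_psi.contDiffAt.comp (z₀, (0 : ℝ)) hl
  -- The error is four central-difference errors, of f̃(u_0, ·), B_d, Ψ and U. The coefficients are
  -- evaluated at the centre in both operators, so they need only be bounded.
  have b1 := (central_isBigO hk c1).const_smul_left (2 : ℝ)
  have b2 := (central_isBigO hk c2).smul
    (((contDiffAt_godunov ha.1).continuousAt.tendsto.comp huz).isBigO_one ℝ)
  have b3 := (central_isBigO hk c3).smul
    (((contDiffAt_upsilon d ha.1).continuousAt.tendsto.comp huz).isBigO_one ℝ)
  have b4 := mulVec_isBigO (A := fun p : (ℝ × ℝ) × ℝ => ncMatrix d (u p.1)) (fun i j =>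
    ((continuousAt_ncMatrix d ha i j).tendsto.comp huz).isBigO_one ℝ) (central_isBigO hk hl)
  simp only [smul_eq_mul, mul_one] at b2 b3
  refine (((b1.add b2).add b3).add b4).congr' ?_ .rfl
  have hdiff : ∀ᶠ z in 𝓝 z₀, DifferentiableAt ℝ u z := by
    filter_upwards [(hu.of_le (m := 1) (by exact_mod_cast le_top)).eventually (by simp)] with z hz
    exact hz.differentiableAt (by simp)
  filter_upwards [hz.eventually hdiff, huz.eventually (eventually_positive ha.1)] with p hp1 hp2
  have hv : DifferentiableAt ℝ (fun s : ℝ => u (p.1 + s • e)) 0 := by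
    refine DifferentiableAt.comp (0 : ℝ) (g := u) (f := fun s : ℝ => p.1 + s • e) ?_ ?_
    · simpa using hp1
    · fun_prop
  have hf := deriv_ecFlux_right d ch hv (by simpa using hp2)
  simp only [zero_smul, add_zero] at hf
  have hh := highOrder_sub_eq_central k (ecFlux_comm d ch) p.2 (gridLine u e p)
  rw [gridLine_zero] at hh
  simp only [schemePart, pdePart, esFlux, hf, zero_smul, add_zero, gridLine_zero, Function.comp,
    zero_sub, Pi.smul_apply, smul_sub]
  simp only [smul_sub] at hh
  simp only [Matrix.mulVec_sub, sub_smul]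
  have hg : gridLine u e p = fun j : ℤ => u (p.1 + ((j : ℝ) * p.2) • e) := rfl
  simp only [hg] at hh ⊢
  have hh' := sub_eq_iff_eq_add.1 hh
  rw [hh']
  module

end Consistency

/-! ## The scaled eigenvectors -/

section Eigenvectors

open Filter Topology Asymptotics

/-- The property is arbitrary so that one entrywise argument yields both local boundedness and
smoothness of the eigenvectors. -/
theorem pack_forall {α : Type*} {P : (α → ℝ) → Prop} {r p e s : α → ℝ} {m b : α → Fin 3 → ℝ}
    (hr : P r) (hm : ∀ i, P fun w => m w i) (hp : P p) (he : P e) (hb : ∀ i, P fun w => b w i)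
    (hs : P s) (j : Fin 10) : P fun w => pack (r w) (m w) (p w) (e w) (b w) (s w) j := by
  fin_cases j
  · exact hr
  · exact hm 0
  · exact hm 1
  · exact hm 2
  · exact hp
  · exact he
  · exact hb 0
  · exact hb 1
  · exact hb 2
  · exact hs

theorem frame_forall {α : Type*} {P : (α → ℝ) → Prop} (d : Fin 2) {x y z : α → ℝ} (hx : P x)
    (hy : P y) (hz : P z) (i : Fin 3) : P fun w => frame d (x w) (y w) (z w) i := by
  unfold frame
  split_ifs
  · exact hx
  · exact hy
  · exact hz

/-- An algebra of functions contains the entries of the scaled eigenvectors if it contains the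
quantities from which they are built. -/
theorem scaledEig_forall {P : (State → ℝ) → Prop} (d : Fin 2)
    (hadd : ∀ f g, P f → P g → P fun U => f U + g U)
    (hmul : ∀ f g, P f → P g → P fun U => f U * g U) (hconst : ∀ c : ℝ, P fun _ => c)
    (hαf : P (alphaF d)) (hαs : P (alphaS d)) (hcf : P fun U => √(cfSq d U))
    (hcs : P fun U => √(csSq d U)) (hβ : ∀ i, P fun U => betaTan d U i) (hσ : P (sgnB d))
    (hρ : P rho) (hp : P ppar) (ha : P aSq) (hsa : P fun U => √(aSq U))
    (hsρ : P fun U => √(rho U)) (hjac : ∀ i j, P fun U => jacPrim U i j)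
    (hscal : ∀ i j, P fun U => scaling U i j) (i j : Fin 10) :
    P fun U => scaledEig d U i j := by
  have hneg : ∀ f, P f → P fun U => -f U := fun f hf => by
    simpa using hmul _ _ (hconst (-1)) hf
  have hfast : ∀ σ j, P fun U => eigFast d U σ j := fun σ j =>
    pack_forall (hmul _ _ hαf hρ) (frame_forall d (hmul _ _ (hmul _ _ (hconst _) hαf) hcf)
      (hmul _ _ (hmul _ _ (hmul _ _ (hmul _ _ (hconst _) hαs) hcs) (hβ 0)) hσ)
      (hmul _ _ (hmul _ _ (hmul _ _ (hmul _ _ (hconst _) hαs) hcs) (hβ 1)) hσ))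
      (hmul _ _ hαf hp) (hmul _ _ (hmul _ _ hαf hρ) ha)
      (frame_forall d (hconst 0) (hmul _ _ (hmul _ _ (hmul _ _ hαs hsa) (hβ 0)) hsρ)
        (hmul _ _ (hmul _ _ (hmul _ _ hαs hsa) (hβ 1)) hsρ)) (hconst 0) j
  have hslow : ∀ σ j, P fun U => eigSlow d U σ j := fun σ j =>
    pack_forall (hmul _ _ hαs hρ) (frame_forall d (hmul _ _ (hmul _ _ (hconst _) hαs) hcs)
      (hmul _ _ (hmul _ _ (hmul _ _ (hmul _ _ (hconst _) hαf) hcf) (hβ 0)) hσ)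
      (hmul _ _ (hmul _ _ (hmul _ _ (hmul _ _ (hconst _) hαf) hcf) (hβ 1)) hσ))
      (hmul _ _ hαs hp) (hmul _ _ (hmul _ _ hαs hρ) ha)
      (frame_forall d (hconst 0) (hmul _ _ (hmul _ _ (hmul _ _ (hneg _ hαf) hsa) (hβ 0)) hsρ)
        (hmul _ _ (hmul _ _ (hmul _ _ (hneg _ hαf) hsa) (hβ 1)) hsρ)) (hconst 0) j
  have halfven : ∀ σ j, P fun U => eigAlfven d U σ j := fun σ j =>
    pack_forall (hconst 0) (frame_forall d (hconst 0) (hmul _ _ (hconst _) (hβ 1))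
      (hmul _ _ (hconst _) (hβ 0))) (hconst 0) (hconst 0)
      (frame_forall d (hconst 0) (hmul _ _ (hmul _ _ (hneg _ (hβ 1)) hσ) hsρ)
        (hmul _ _ (hmul _ _ (hβ 0) hσ) hsρ)) (hconst 0) j
  have heig : ∀ i j, P fun U => eigPrim d U i j := by
    intro i j
    fin_cases j
    · exact hfast (-1) i
    · exact hslow (-1) i
    · exact hconst _
    · exact halfven (-1) i
    · exact hconst _
    · exact hconst _
    · exact halfven 1 i
    · exact hconst _
    · exact hslow 1 i
    · exact hfast 1 i
  have hsum : ∀ (s : Finset (Fin 10)) (f : Fin 10 → State → ℝ), (∀ l, P (f l)) →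
      P fun U => ∑ l ∈ s, f l U := by
    intro s f hf
    induction s using Finset.induction_on with
    | empty => simpa using hconst 0
    | insert a s ha ih =>
      simp only [Finset.sum_insert ha]
      exact hadd _ _ (hf a) ih
  simp only [scaledEig, Matrix.mul_apply]
  exact hsum _ _ fun l => hmul _ _ (hsum _ _ fun l' => hmul _ _ (hjac i l') (heig l' l)) (hscal l j)

theorem contDiffAt_jacPrim {U : State} (h : Positive U) (i j : Fin 10) :
    ContDiffAt ℝ ∞ (fun U => jacPrim U i j) U := by
  have hv := contDiffAt_vel h.1.ne'
  have hρ := contDiff_rho.contDiffAt (x := U)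
  have hc : ∀ i : Fin 10, ContDiffAt ℝ ∞ (fun _ : State => coord i) U := fun i => contDiffAt_const
  refine contDiffAt_pi.1 (?_ : ContDiffAt ℝ ∞ (fun U => jacPrim U i) U) j
  fin_cases i
  · exact hc 0
  · exact ((hv 0).smul (hc 0)).add (hρ.smul (hc 1))
  · exact ((hv 1).smul (hc 0)).add (hρ.smul (hc 2))
  · exact ((hv 2).smul (hc 0)).add (hρ.smul (hc 3))
  · exact hc 4
  · exact contDiffAt_pack ((contDiffAt_velSq h.1.ne').div_const 2) (fun i => hρ.mul (hv i))
      contDiffAt_const contDiffAt_const (fun i => (contDiff_mag i).contDiffAt)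
      contDiff_psi.contDiffAt
  · exact hc 6
  · exact hc 7
  · exact hc 8
  · exact hc 9

theorem scaleRoot_pos {U : State} (h : Positive U) : 0 < scaleRoot U := by
  obtain ⟨h1, h2, -⟩ := h
  exact Real.sqrt_pos.2 (by positivity)

theorem contDiffAt_scaling {U : State} (h : Positive U) (i j : Fin 10) :
    ContDiffAt ℝ ∞ (fun U => scaling U i j) U := by
  have hk := scaleRoot_pos h
  obtain ⟨h1, h2, h3⟩ := h
  have hρ := contDiff_rho.contDiffAt (x := U)
  have hp := contDiff_ppar.contDiffAt (x := U)
  have hsρ := hρ.sqrt h1.ne'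
  have hst := (contDiffAt_pperp h1.ne').sqrt h3.ne'
  have hsρ0 := Real.sqrt_pos.2 h1
  have hκ : ContDiffAt ℝ ∞ scaleRoot U :=
    (((contDiffAt_const.mul (hp.pow 2)).add ((contDiffAt_const.mul hp).mul hρ)).add
      (hρ.pow 2)).sqrt (by positivity)
  have c : ∀ x : ℝ, ContDiffAt ℝ ∞ (fun _ : State => x) U := fun x => contDiffAt_const
  have h2ρ : 0 < 2 * rho U := by positivity
  have e1 : ContDiffAt ℝ ∞ (fun U => 1 / (2 * √(2 * rho U))) U :=
    (c 1).div ((c 2).mul (((c 2).mul hρ).sqrt h2ρ.ne')) (by positivity)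
  have e2 : ContDiffAt ℝ ∞ (fun U => √(pperp U) / (2 * √(rho U))) U :=
    hst.div ((c 2).mul hsρ) (by positivity)
  have e3 : ContDiffAt ℝ ∞ (fun U => √(pperp U) / (2 * rho U)) U :=
    hst.div ((c 2).mul hρ) (by positivity)
  have e4 : ContDiffAt ℝ ∞ (fun U => √(rho U) * (2 * ppar U + rho U) / (2 * scaleRoot U)) U :=
    (hsρ.mul (((c 2).mul hp).add hρ)).div ((c 2).mul hκ) (by positivity)
  have e5 : ContDiffAt ℝ ∞
      (fun U => ppar U * (5 * ppar U + 2 * rho U) / (2 * √(rho U) * scaleRoot U)) U :=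
    (hp.mul (((c 5).mul hp).add ((c 2).mul hρ))).div (((c 2).mul hsρ).mul hκ) (by positivity)
  have e6 : ContDiffAt ℝ ∞ (fun U => ppar U * √(rho U) / (2 * scaleRoot U)) U :=
    (hp.mul hsρ).div ((c 2).mul hκ) (by positivity)
  have hdiag : ContDiffAt ℝ ∞ (fun U : State =>
      (![1 / (2 * √(2 * rho U)), 1 / (2 * √(2 * rho U)),
      √(pperp U) / (2 * √(rho U)), √(pperp U) / (2 * rho U),
      √(rho U) * (2 * ppar U + rho U) / (2 * scaleRoot U),
      ppar U * (5 * ppar U + 2 * rho U) / (2 * √(rho U) * scaleRoot U),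
      √(pperp U) / (2 * rho U), √(pperp U) / (2 * √(rho U)),
      1 / (2 * √(2 * rho U)), 1 / (2 * √(2 * rho U))] : State) i) U := by
    fin_cases i
    · exact e1
    · exact e1
    · exact e2
    · exact e3
    · exact e4
    · exact e5
    · exact e3
    · exact e2
    · exact e1
    · exact e1
  have hs : ∀ U : State, scaling U i j = (if i = j then
      (![1 / (2 * √(2 * rho U)), 1 / (2 * √(2 * rho U)),
      √(pperp U) / (2 * √(rho U)), √(pperp U) / (2 * rho U),
      √(rho U) * (2 * ppar U + rho U) / (2 * scaleRoot U),
      ppar U * (5 * ppar U + 2 * rho U) / (2 * √(rho U) * scaleRoot U),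
      √(pperp U) / (2 * rho U), √(pperp U) / (2 * √(rho U)),
      1 / (2 * √(2 * rho U)), 1 / (2 * √(2 * rho U))] : State) i else 0)
      + (ppar U * √(rho U) / (2 * scaleRoot U)) *
        ((Matrix.single 4 5 1 + Matrix.single 5 4 1 : Matrix (Fin 10) (Fin 10) ℝ) i j) := by
    intro U
    rw [scaling, Matrix.add_apply, Matrix.diagonal_apply, Matrix.smul_apply, smul_eq_mul]
  simp only [hs]
  refine ContDiffAt.add ?_ (e6.mul contDiffAt_const)
  split_ifs
  · exact hdiag
  · exact contDiffAt_const

/-! ### Wave speeds and local bounds for the eigenvectors -/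

theorem contDiffAt_aSq {U : State} (h : Positive U) : ContDiffAt ℝ ∞ aSq U :=
  (contDiffAt_const.mul (contDiffAt_pperp h.1.ne')).div contDiff_rho.contDiffAt h.1.ne'

theorem contDiffAt_vaSq {U : State} (h : Positive U) : ContDiffAt ℝ ∞ vaSq U :=
  (contDiffAt_magSq U).div contDiff_rho.contDiffAt h.1.ne'

theorem aSq_pos {U : State} (h : Positive U) : 0 < aSq U :=
  div_pos (mul_pos two_pos h.2.2) h.1

theorem alfven_sq {U : State} (h : Positive U) (d : Fin 2) :
    alfven d U ^ 2 = mag U (nrm d) ^ 2 / rho U := by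
  rw [alfven, div_pow, sq_abs, Real.sq_sqrt h.1.le]

theorem vaSq_eq {U : State} (h : Positive U) (d : Fin 2) :
    vaSq U = alfven d U ^ 2 + (mag U (tng d) ^ 2 + mag U 2 ^ 2) / rho U := by
  rw [alfven_sq h, vaSq, ← add_div]
  congr 1
  simp only [dotProduct, Fin.sum_univ_three]
  fin_cases d <;> simp [nrm, tng] <;> ring

/-- A sum of nonnegative terms, hence a real square root; the last term is positive when the
tangential field is nonzero. -/
theorem disc_eq {U : State} (h : Positive U) (d : Fin 2) :
    (vaSq U + aSq U) ^ 2 - 4 * alfven d U ^ 2 * aSq U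
      = (vaSq U - aSq U) ^ 2 + 4 * aSq U * ((mag U (tng d) ^ 2 + mag U 2 ^ 2) / rho U) := by
  rw [vaSq_eq h d]
  ring

theorem discRoot_sq {U : State} (h : Positive U) (d : Fin 2) :
    discRoot d U ^ 2 = (vaSq U + aSq U) ^ 2 - 4 * alfven d U ^ 2 * aSq U := by
  rw [discRoot, Real.sq_sqrt]
  rw [disc_eq h]
  have h1 := h.1
  have h2 := aSq_pos h
  positivity

theorem continuousAt_alfven (d : Fin 2) {U : State} (h : Positive U) :
    ContinuousAt (alfven d) U :=
  ((contDiff_mag (nrm d)).continuous.continuousAt.abs).div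
    (contDiff_rho.continuous.continuousAt.sqrt) (Real.sqrt_pos.2 h.1).ne'

theorem continuousAt_discRoot (d : Fin 2) {U : State} (h : Positive U) :
    ContinuousAt (discRoot d) U :=
  (((((contDiffAt_vaSq h).continuousAt.add (contDiffAt_aSq h).continuousAt).pow 2)).sub
    ((continuousAt_const.mul ((continuousAt_alfven d h).pow 2)).mul
      (contDiffAt_aSq h).continuousAt)).sqrt

theorem continuousAt_cfSq (d : Fin 2) {U : State} (h : Positive U) : ContinuousAt (cfSq d) U :=
  (((contDiffAt_vaSq h).continuousAt.add (contDiffAt_aSq h).continuousAt).add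
    (continuousAt_discRoot d h)).div_const 2

theorem continuousAt_csSq (d : Fin 2) {U : State} (h : Positive U) : ContinuousAt (csSq d) U :=
  (((contDiffAt_vaSq h).continuousAt.add (contDiffAt_aSq h).continuousAt).sub
    (continuousAt_discRoot d h)).div_const 2

theorem csSq_le_cfSq (d : Fin 2) (U : State) : csSq d U ≤ cfSq d U := by
  have : 0 ≤ discRoot d U := Real.sqrt_nonneg _
  unfold csSq cfSq
  linarith

/-- Equivalent to c_s² ≤ a² ≤ c_f², which puts the quotients defining the α inside [0, 1]. -/
theorem abs_vaSq_sub_aSq_le {U : State} (h : Positive U) (d : Fin 2) :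
    |vaSq U - aSq U| ≤ discRoot d U := by
  rw [discRoot, ← Real.sqrt_sq_eq_abs, disc_eq h]
  refine Real.sqrt_le_sqrt ?_
  have h1 := h.1
  have h2 := aSq_pos h
  have : 0 ≤ 4 * aSq U * ((mag U (tng d) ^ 2 + mag U 2 ^ 2) / rho U) := by positivity
  linarith

theorem aSq_le_cfSq {U : State} (h : Positive U) (d : Fin 2) : aSq U ≤ cfSq d U := by
  have := (abs_le.1 (abs_vaSq_sub_aSq_le h d)).1
  unfold cfSq
  linarith

theorem csSq_le_aSq {U : State} (h : Positive U) (d : Fin 2) : csSq d U ≤ aSq U := by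
  have := (abs_le.1 (abs_vaSq_sub_aSq_le h d)).2
  unfold csSq
  linarith

theorem abs_alphaF_le {U : State} (h : Positive U) (d : Fin 2) : |alphaF d U| ≤ 1 := by
  unfold alphaF
  split_ifs with he
  · rw [abs_of_nonneg (by positivity)]
    exact div_le_one_of_le₀ (by rw [Real.one_le_sqrt]; norm_num) (by positivity)
  · rw [abs_of_nonneg (Real.sqrt_nonneg _), Real.sqrt_le_one]
    have h1 := lt_of_le_of_ne (csSq_le_cfSq d U) (Ne.symm he)
    have h2 := aSq_le_cfSq h d
    rw [div_le_one (by linarith)]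
    linarith

theorem abs_alphaS_le {U : State} (h : Positive U) (d : Fin 2) : |alphaS d U| ≤ 1 := by
  unfold alphaS
  split_ifs with he
  · rw [abs_of_nonneg (by positivity)]
    exact div_le_one_of_le₀ (by rw [Real.one_le_sqrt]; norm_num) (by positivity)
  · rw [abs_of_nonneg (Real.sqrt_nonneg _), Real.sqrt_le_one]
    have h1 := lt_of_le_of_ne (csSq_le_cfSq d U) (Ne.symm he)
    have h2 := csSq_le_aSq h d
    rw [div_le_one (by linarith)]
    linarith

theorem abs_betaTan_le (d : Fin 2) (U : State) (i : Fin 2) : |betaTan d U i| ≤ 1 := by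
  have h2 : |1 / √(2 : ℝ)| ≤ 1 := by
    rw [abs_of_nonneg (by positivity)]
    exact div_le_one_of_le₀ (by rw [Real.one_le_sqrt]; norm_num) (by positivity)
  have h3 : ∀ x y : ℝ, |x / √(x ^ 2 + y ^ 2)| ≤ 1 := fun x y => by
    rw [abs_div, abs_of_nonneg (Real.sqrt_nonneg _)]
    refine div_le_one_of_le₀ (Real.abs_le_sqrt ?_) (Real.sqrt_nonneg _)
    nlinarith [sq_nonneg y]
  unfold betaTan
  split_ifs
  · fin_cases i <;> exact h2
  · fin_cases i
    · exact h3 _ _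
    · have := h3 (mag U 2) (mag U (tng d))
      rw [add_comm] at this
      exact this

/-- The scaled eigenvectors are locally bounded, also where they are discontinuous. -/
theorem scaledEig_isBigO (d : Fin 2) {U : State} (h : Positive U) (i j : Fin 10) :
    (fun W => scaledEig d W i j) =O[𝓝 U] fun _ => (1 : ℝ) := by
  have hc : ∀ {f : State → ℝ}, ContinuousAt f U → f =O[𝓝 U] fun _ => (1 : ℝ) :=
    fun hf => hf.tendsto.isBigO_one ℝ
  have hb : ∀ {f : State → ℝ}, (∀ W, Positive W → |f W| ≤ 1) → f =O[𝓝 U] fun _ => (1 : ℝ) := by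
    intro f hf
    refine IsBigO.of_bound 1 ?_
    filter_upwards [eventually_positive h] with W hW
    simpa using hf W hW
  refine scaledEig_forall d (P := fun f => f =O[𝓝 U] fun _ => (1 : ℝ)) (fun f g hf hg => hf.add hg)
    (fun f g hf hg => by simpa using hf.mul hg) (fun c => isBigO_const_const c one_ne_zero _)
    (hb fun W hW => abs_alphaF_le hW d) (hb fun W hW => abs_alphaS_le hW d)
    (hc (continuousAt_cfSq d h).sqrt) (hc (continuousAt_csSq d h).sqrt)
    (fun i => hb fun W _ => abs_betaTan_le d W i) (hb fun W _ => ?_)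
    (hc contDiff_rho.continuous.continuousAt) (hc contDiff_ppar.continuous.continuousAt)
    (hc (contDiffAt_aSq h).continuousAt) (hc (contDiffAt_aSq h).continuousAt.sqrt)
    (hc contDiff_rho.continuous.continuousAt.sqrt)
    (fun i j => hc (contDiffAt_jacPrim h i j).continuousAt)
    (fun i j => hc (contDiffAt_scaling h i j).continuousAt) i j
  unfold sgnB
  split_ifs <;> simp

theorem continuousAt_eigenvalue (d : Fin 2) (ch : ℝ) {U : State} (h : Positive U) (l : Fin 10) :
    ContinuousAt (fun W => eigenvalue d ch W l) U := by
  have hv := (contDiffAt_vel h.1.ne' (nrm d)).continuousAt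
  have ha := continuousAt_alfven d h
  have hf := (continuousAt_cfSq d h).sqrt
  have hs := (continuousAt_csSq d h).sqrt
  fin_cases l
  · exact hv
  · exact hv
  · exact hv.add ha
  · exact hv.sub ha
  · exact hv.add continuousAt_const
  · exact hv.sub continuousAt_const
  · exact hv.add hf
  · exact hv.sub hf
  · exact hv.add hs
  · exact hv.sub hs

/-- The Rusanov speed need not be differentiable where the moduli of two eigenvalues coincide;
Lipschitz dependence is enough, and a maximum preserves it. -/
theorem abs_sup'_sub_sup'_le (f g : Fin 10 → ℝ) :
    |(Finset.univ.sup' Finset.univ_nonempty fun l => |f l|)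
      - Finset.univ.sup' Finset.univ_nonempty (fun l => |g l|)| ≤ ∑ l, |f l - g l| := by
  have key : ∀ f g : Fin 10 → ℝ, (Finset.univ.sup' Finset.univ_nonempty fun l => |f l|)
      ≤ (Finset.univ.sup' Finset.univ_nonempty fun l => |g l|) + ∑ l, |f l - g l| := by
    intro f g
    refine Finset.sup'_le _ _ fun l _ => ?_
    have h1 := Finset.le_sup' (fun l => |g l|) (Finset.mem_univ l)
    have h2 := Finset.single_le_sum (f := fun l => |f l - g l|) (fun l _ => abs_nonneg _)
      (Finset.mem_univ l)
    have h3 := abs_sub_abs_le_abs_sub (f l) (g l)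
    linarith
  rw [abs_sub_le_iff]
  have k1 := key f g
  have k2 := key g f
  simp only [abs_sub_comm (g _)] at k2
  constructor <;> linarith

theorem continuousAt_rusanov (d : Fin 2) (ch : ℝ) {U : State} (h : Positive U) :
    ContinuousAt (rusanov d ch) U :=
  ContinuousAt.finset_sup'_apply _ fun l _ => (continuousAt_eigenvalue d ch h l).abs

end Eigenvectors

/-! ## Regular states -/

section Regular

open Filter Topology Asymptotics

/-- The states at which the eigenvectors in direction `d` depend smoothly on the state. -/
def RegularState (d : Fin 2) (U : State) : Prop :=
  Positive U ∧ mag U (nrm d) ≠ 0 ∧ (mag U (tng d) ≠ 0 ∨ mag U 2 ≠ 0)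

variable {d : Fin 2} {U : State}

theorem RegularState.tangential_pos (h : RegularState d U) :
    0 < mag U (tng d) ^ 2 + mag U 2 ^ 2 := by
  rcases h.2.2 with h | h <;> positivity

theorem RegularState.disc_pos (h : RegularState d U) :
    0 < (vaSq U + aSq U) ^ 2 - 4 * alfven d U ^ 2 * aSq U := by
  rw [disc_eq h.1]
  have h1 := h.1.1
  have h2 := aSq_pos h.1
  have h3 := h.tangential_pos
  positivity

theorem RegularState.discRoot_pos (h : RegularState d U) : 0 < discRoot d U :=
  Real.sqrt_pos.2 h.disc_pos

theorem RegularState.alfven_pos (h : RegularState d U) : 0 < alfven d U :=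
  div_pos (abs_pos.2 h.2.1) (Real.sqrt_pos.2 h.1.1)

/-- Vieta's relation; positivity of c_s² then comes from a nonzero normal field. -/
theorem cfSq_mul_csSq (h : Positive U) (d : Fin 2) :
    cfSq d U * csSq d U = alfven d U ^ 2 * aSq U := by
  have := discRoot_sq h d
  unfold cfSq csSq
  linear_combination -(1 / 4) * this

theorem cfSq_pos (h : Positive U) (d : Fin 2) : 0 < cfSq d U :=
  (aSq_pos h).trans_le (aSq_le_cfSq h d)

theorem RegularState.csSq_pos (h : RegularState d U) : 0 < csSq d U := by
  have h1 := cfSq_mul_csSq h.1 d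
  have h2 := cfSq_pos h.1 d
  have h3 := h.alfven_pos
  have h4 := aSq_pos h.1
  have h5 : 0 < cfSq d U * csSq d U := by rw [h1]; positivity
  exact (pos_iff_pos_of_mul_pos h5).1 h2

theorem RegularState.csSq_lt_cfSq (h : RegularState d U) : csSq d U < cfSq d U := by
  have := h.discRoot_pos
  unfold csSq cfSq
  linarith

/-- The product of the two gaps is a²(B_t² + B_z²)/ρ, with B_t and B_z the tangential components, so
a tangential field separates the speeds. This keeps the square roots defining the α away from zero.
-/
theorem RegularState.speeds_separated (h : RegularState d U) :
    csSq d U < aSq U ∧ aSq U < cfSq d U := by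
  have h1 := discRoot_sq h.1 d
  have h2 : 0 < (aSq U - csSq d U) * (cfSq d U - aSq U) := by
    have h3 : (aSq U - csSq d U) * (cfSq d U - aSq U)
        = aSq U * ((mag U (tng d) ^ 2 + mag U 2 ^ 2) / rho U) := by
      have h4 := vaSq_eq h.1 d
      unfold cfSq csSq
      linear_combination (1 / 4) * h1 + aSq U * h4
    rw [h3]
    have := h.1.1
    have := aSq_pos h.1
    have := h.tangential_pos
    positivity
  have h3 := csSq_le_aSq h.1 d
  have h4 := aSq_le_cfSq h.1 d
  constructor
  · refine lt_of_le_of_ne h3 fun e => ?_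
    rw [e, sub_self, zero_mul] at h2
    exact lt_irrefl _ h2
  · refine lt_of_le_of_ne h4 fun e => ?_
    rw [← e, sub_self, mul_zero] at h2
    exact lt_irrefl _ h2

theorem RegularState.contDiffAt_alfven (h : RegularState d U) : ContDiffAt ℝ ∞ (alfven d) U :=
  ((contDiff_mag (nrm d)).contDiffAt.norm ℝ h.2.1).div
    (contDiff_rho.contDiffAt.sqrt h.1.1.ne') (Real.sqrt_pos.2 h.1.1).ne'

theorem RegularState.contDiffAt_discRoot (h : RegularState d U) : ContDiffAt ℝ ∞ (discRoot d) U :=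
  ((((contDiffAt_vaSq h.1).add (contDiffAt_aSq h.1)).pow 2).sub
    ((contDiffAt_const.mul (h.contDiffAt_alfven.pow 2)).mul (contDiffAt_aSq h.1))).sqrt
    h.disc_pos.ne'

theorem RegularState.contDiffAt_cfSq (h : RegularState d U) : ContDiffAt ℝ ∞ (cfSq d) U :=
  (((contDiffAt_vaSq h.1).add (contDiffAt_aSq h.1)).add h.contDiffAt_discRoot).div_const 2

theorem RegularState.contDiffAt_csSq (h : RegularState d U) : ContDiffAt ℝ ∞ (csSq d) U :=
  (((contDiffAt_vaSq h.1).add (contDiffAt_aSq h.1)).sub h.contDiffAt_discRoot).div_const 2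

/-- Near a regular state the convention for coinciding speeds is never invoked, and the α follow
their smooth formulas. -/
theorem RegularState.eventually_ne (h : RegularState d U) :
    ∀ᶠ W in 𝓝 U, cfSq d W ≠ csSq d W :=
  (h.contDiffAt_cfSq.continuousAt.ne_iff_eventually_ne h.contDiffAt_csSq.continuousAt).1
    h.csSq_lt_cfSq.ne'

theorem RegularState.contDiffAt_alphaF (h : RegularState d U) : ContDiffAt ℝ ∞ (alphaF d) U := by
  have h1 := h.csSq_lt_cfSq
  have h2 := h.speeds_separated
  refine ((((contDiffAt_aSq h.1).sub h.contDiffAt_csSq).div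
    (h.contDiffAt_cfSq.sub h.contDiffAt_csSq) (sub_pos.2 h1).ne').sqrt
    (div_pos (sub_pos.2 h2.1) (sub_pos.2 h1)).ne').congr_of_eventuallyEq ?_
  filter_upwards [h.eventually_ne] with W hW
  exact if_neg hW

theorem RegularState.contDiffAt_alphaS (h : RegularState d U) : ContDiffAt ℝ ∞ (alphaS d) U := by
  have h1 := h.csSq_lt_cfSq
  have h2 := h.speeds_separated
  refine (((h.contDiffAt_cfSq.sub (contDiffAt_aSq h.1)).div
    (h.contDiffAt_cfSq.sub h.contDiffAt_csSq) (sub_pos.2 h1).ne').sqrt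
    (div_pos (sub_pos.2 h2.2) (sub_pos.2 h1)).ne').congr_of_eventuallyEq ?_
  filter_upwards [h.eventually_ne] with W hW
  exact if_neg hW

theorem RegularState.contDiffAt_betaTan (h : RegularState d U) (i : Fin 2) :
    ContDiffAt ℝ ∞ (fun W => betaTan d W i) U := by
  have h0 := h.tangential_pos
  have ht := (contDiff_mag (tng d)).contDiffAt (x := U)
  have h2 := (contDiff_mag 2).contDiffAt (x := U)
  have hs := ((ht.pow 2).add (h2.pow 2))
  have hr := hs.sqrt h0.ne'
  have hev : ∀ᶠ W in 𝓝 U, ¬ (mag W (tng d) = 0 ∧ mag W 2 = 0) := by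
    filter_upwards [hs.continuousAt.eventually (lt_mem_nhds h0)] with W hW h
    rw [h.1, h.2] at hW
    norm_num at hW
  fin_cases i
  · refine (ht.div hr (Real.sqrt_pos.2 h0).ne').congr_of_eventuallyEq ?_
    filter_upwards [hev] with W hW
    simp [betaTan, if_neg hW]
  · refine (h2.div hr (Real.sqrt_pos.2 h0).ne').congr_of_eventuallyEq ?_
    filter_upwards [hev] with W hW
    simp [betaTan, if_neg hW]

theorem RegularState.contDiffAt_sgnB (h : RegularState d U) : ContDiffAt ℝ ∞ (sgnB d) U := by
  have hc := (contDiff_mag (nrm d)).continuous.continuousAt (x := U)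
  refine (contDiffAt_const (c := sgnB d U)).congr_of_eventuallyEq ?_
  rcases lt_or_gt_of_ne h.2.1 with hn | hn
  · filter_upwards [hc.eventually (gt_mem_nhds hn)] with W hW
    rw [sgnB, sgnB, if_pos hW, if_pos hn]
  · filter_upwards [hc.eventually (lt_mem_nhds hn)] with W hW
    rw [sgnB, sgnB, if_neg hW.not_gt, if_neg hn.not_gt]

/-- The scaled eigenvectors are smooth at regular states. -/
theorem RegularState.contDiffAt_scaledEig (h : RegularState d U) (i j : Fin 10) :
    ContDiffAt ℝ ∞ (fun W => scaledEig d W i j) U :=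
  scaledEig_forall d (P := fun f => ContDiffAt ℝ ∞ f U) (fun _ _ hf hg => hf.add hg)
    (fun _ _ hf hg => hf.mul hg) (fun _ => contDiffAt_const) h.contDiffAt_alphaF
    h.contDiffAt_alphaS (h.contDiffAt_cfSq.sqrt (cfSq_pos h.1 d).ne')
    (h.contDiffAt_csSq.sqrt h.csSq_pos.ne') h.contDiffAt_betaTan h.contDiffAt_sgnB
    contDiff_rho.contDiffAt contDiff_ppar.contDiffAt (contDiffAt_aSq h.1)
    ((contDiffAt_aSq h.1).sqrt (aSq_pos h.1).ne') (contDiff_rho.contDiffAt.sqrt h.1.1.ne')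
    (contDiffAt_jacPrim h.1) (contDiffAt_scaling h.1) i j

theorem RegularState.contDiffAt_eigenvalue (h : RegularState d U) (ch : ℝ) (l : Fin 10) :
    ContDiffAt ℝ ∞ (fun W => eigenvalue d ch W l) U := by
  have hv := contDiffAt_vel h.1.1.ne' (nrm d)
  have ha := h.contDiffAt_alfven
  have hf := h.contDiffAt_cfSq.sqrt (cfSq_pos h.1 d).ne'
  have hs := h.contDiffAt_csSq.sqrt h.csSq_pos.ne'
  fin_cases l
  · exact hv
  · exact hv
  · exact hv.add ha
  · exact hv.sub ha
  · exact hv.add contDiffAt_const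
  · exact hv.sub contDiffAt_const
  · exact hv.add hf
  · exact hv.sub hf
  · exact hv.add hs
  · exact hv.sub hs

/-- Strict differentiability gives a Lipschitz bound for pairs of nearby points, the form needed to
compare neighbouring interfaces. -/
theorem ContDiffAt.isBigO_sub' {F : Type*} [NormedAddCommGroup F] [NormedSpace ℝ F] {G : Type*}
    [NormedAddCommGroup G] [NormedSpace ℝ G] {f : F → G} {a : F} (hf : ContDiffAt ℝ ∞ f a) :
    (fun w : F × F => f w.1 - f w.2) =O[𝓝 (a, a)] fun w => w.1 - w.2 :=
  (hf.hasStrictFDerivAt (by simp)).isBigO_sub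

theorem RegularState.rusanov_isBigO_sub (h : RegularState d U) (ch : ℝ) :
    (fun w : State × State => rusanov d ch w.1 - rusanov d ch w.2) =O[𝓝 (U, U)]
      fun w => w.1 - w.2 := by
  have h1 : (fun w : State × State => ∑ l, |eigenvalue d ch w.1 l - eigenvalue d ch w.2 l|)
      =O[𝓝 (U, U)] fun w => w.1 - w.2 :=
    IsBigO.fun_sum fun l _ =>
      (GLMCGL.ContDiffAt.isBigO_sub' (h.contDiffAt_eigenvalue ch l)).norm_left
  refine IsBigO.trans (IsBigO.of_bound 1 (Eventually.of_forall fun w => ?_)) h1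
  rw [one_mul]
  exact (abs_sup'_sub_sup'_le _ _).trans (le_abs_self _)

/-! ### Invertibility of the scaled eigenvectors at regular states -/

theorem det_jacPrim_ne_zero (h : Positive U) : (jacPrim U).det ≠ 0 := by
  rw [Ne, ← Matrix.exists_mulVec_eq_zero_iff]
  rintro ⟨x, hx, h0⟩
  have hρ := h.1.ne'
  have e := fun i => congrFun h0 i
  have e0 : x 0 = 0 := by
    simpa [jacPrim, Matrix.mulVec, coord] using e 0
  have row : ∀ (v : ℝ) (i : Fin 10), (v • coord 0 + rho U • coord i) ⬝ᵥ x = 0 → x i = 0 := by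
    intro v i h
    rw [add_dotProduct, smul_dotProduct, smul_dotProduct] at h
    simpa [coord, e0, hρ] using h
  have e1 : x 1 = 0 := row (vel U 0) 1 (e 1)
  have e2 : x 2 = 0 := row (vel U 1) 2 (e 2)
  have e3 : x 3 = 0 := row (vel U 2) 3 (e 3)
  have e4 : x 4 = 0 := by simpa [jacPrim, Matrix.mulVec, coord] using e 4
  have e6 : x 6 = 0 := by simpa [jacPrim, Matrix.mulVec, coord] using e 6
  have e7 : x 7 = 0 := by simpa [jacPrim, Matrix.mulVec, coord] using e 7
  have e8 : x 8 = 0 := by simpa [jacPrim, Matrix.mulVec, coord] using e 8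
  have e9 : x 9 = 0 := by simpa [jacPrim, Matrix.mulVec, coord] using e 9
  have hx' : x = pack (x 0) ![x 1, x 2, x 3] (x 4) (x 5) ![x 6, x 7, x 8] (x 9) := by
    ext i; fin_cases i <;> rfl
  have e5 : x 5 = 0 := by
    have := e 5
    change pack ((vel U ⬝ᵥ vel U) / 2) (rho U • vel U) (1 / 2) 1 (mag U) (psi U) ⬝ᵥ x = 0 at this
    rw [hx', pack_dotProduct] at this
    simpa [e0, e1, e2, e3, e4, e6, e7, e8, e9, dotProduct, Fin.sum_univ_three] using this
  apply hx
  ext i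
  fin_cases i <;> assumption

/-- The diagonal entries outside the block are positive; the 2 × 2 block reduces to 10p∥² + 8p∥ρ +
2ρ² > 0. -/
theorem det_scaling_ne_zero (h : Positive U) : (scaling U).det ≠ 0 := by
  rw [Ne, ← Matrix.exists_mulVec_eq_zero_iff]
  rintro ⟨x, hx, h0⟩
  have hκ := scaleRoot_pos h
  obtain ⟨h1, h2, h3⟩ := h
  have hsρ := Real.sqrt_pos.2 h1
  have hst := Real.sqrt_pos.2 h3
  have hs2 : 0 < √(2 * rho U) := Real.sqrt_pos.2 (by positivity)
  have e : ∀ i, (Matrix.diagonal ![1 / (2 * √(2 * rho U)), 1 / (2 * √(2 * rho U)),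
      √(pperp U) / (2 * √(rho U)), √(pperp U) / (2 * rho U),
      √(rho U) * (2 * ppar U + rho U) / (2 * scaleRoot U),
      ppar U * (5 * ppar U + 2 * rho U) / (2 * √(rho U) * scaleRoot U),
      √(pperp U) / (2 * rho U), √(pperp U) / (2 * √(rho U)),
      1 / (2 * √(2 * rho U)), 1 / (2 * √(2 * rho U))] *ᵥ x) i
      + (ppar U * √(rho U) / (2 * scaleRoot U)) *
        ((Matrix.single 4 5 1 *ᵥ x) i + (Matrix.single 5 4 1 *ᵥ x) i) = 0 := by
    intro i
    have := congrFun h0 i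
    rw [scaling, Matrix.add_mulVec, Matrix.smul_mulVec, Matrix.add_mulVec] at this
    exact this
  simp only [Matrix.mulVec_diagonal, Matrix.single_mulVec, Function.update_apply] at e
  have q : ∀ {c y : ℝ}, 0 < c → c * y = 0 → y = 0 := fun hc hy =>
    (mul_eq_zero.1 hy).resolve_left hc.ne'
  have e0 : x 0 = 0 := q (c := 1 / (2 * √(2 * rho U))) (by positivity) (by simpa using e 0)
  have e1 : x 1 = 0 := q (c := 1 / (2 * √(2 * rho U))) (by positivity) (by simpa using e 1)
  have e2 : x 2 = 0 := q (c := √(pperp U) / (2 * √(rho U))) (by positivity) (by simpa using e 2)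
  have e3 : x 3 = 0 := q (c := √(pperp U) / (2 * rho U)) (by positivity) (by simpa using e 3)
  have e6 : x 6 = 0 := q (c := √(pperp U) / (2 * rho U)) (by positivity) (by simpa using e 6)
  have e7 : x 7 = 0 := q (c := √(pperp U) / (2 * √(rho U))) (by positivity) (by simpa using e 7)
  have e8 : x 8 = 0 := q (c := 1 / (2 * √(2 * rho U))) (by positivity) (by simpa using e 8)
  have e9 : x 9 = 0 := q (c := 1 / (2 * √(2 * rho U))) (by positivity) (by simpa using e 9)
  have f4 : √(rho U) * (2 * ppar U + rho U) / (2 * scaleRoot U) * x 4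
      + ppar U * √(rho U) / (2 * scaleRoot U) * x 5 = 0 := by simpa using e 4
  have f5 : ppar U * (5 * ppar U + 2 * rho U) / (2 * √(rho U) * scaleRoot U) * x 5
      + ppar U * √(rho U) / (2 * scaleRoot U) * x 4 = 0 := by simpa using e 5
  have hsq : √(rho U) ^ 2 = rho U := Real.sq_sqrt h1.le
  have g4 : (2 * ppar U + rho U) * x 4 + ppar U * x 5 = 0 := by
    refine q (c := √(rho U) / (2 * scaleRoot U)) (by positivity) ?_
    linear_combination f4
  have g5 : (5 * ppar U + 2 * rho U) * x 5 + rho U * x 4 = 0 := by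
    refine q (c := ppar U / (2 * √(rho U) * scaleRoot U)) (by positivity) ?_
    have : ppar U * √(rho U) / (2 * scaleRoot U)
        = ppar U / (2 * √(rho U) * scaleRoot U) * rho U := by
      nth_rewrite 3 [← hsq]
      field_simp
    rw [this] at f5
    linear_combination f5
  have e4 : x 4 = 0 := by
    refine q (c := (2 * ppar U + rho U) * (5 * ppar U + 2 * rho U) - ppar U * rho U) ?_ ?_
    · have : (2 * ppar U + rho U) * (5 * ppar U + 2 * rho U) - ppar U * rho U
          = 10 * ppar U ^ 2 + 8 * ppar U * rho U + 2 * rho U ^ 2 := by ring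
      rw [this]; positivity
    · linear_combination (5 * ppar U + 2 * rho U) * g4 - ppar U * g5
  have e5 : x 5 = 0 := by
    rw [e4, mul_zero, zero_add] at g4
    exact q h2 g4
  apply hx
  ext i
  fin_cases i <;> assumption

theorem alpha_identities (h : RegularState d U) : alphaF d U ^ 2 + alphaS d U ^ 2 = 1 ∧
    alphaF d U ^ 2 * cfSq d U + alphaS d U ^ 2 * csSq d U = aSq U := by
  have h1 := h.csSq_lt_cfSq
  have h2 := h.speeds_separated
  have h3 : 0 < cfSq d U - csSq d U := sub_pos.2 h1
  rw [alphaF, alphaS, if_neg h1.ne', if_neg h1.ne',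
    Real.sq_sqrt (div_nonneg (sub_pos.2 h2.1).le h3.le),
    Real.sq_sqrt (div_nonneg (sub_pos.2 h2.2).le h3.le)]
  constructor
  · field_simp; ring
  · field_simp; ring

theorem betaTan_sq (d : Fin 2) (U : State) : betaTan d U 0 ^ 2 + betaTan d U 1 ^ 2 = 1 := by
  unfold betaTan
  split_ifs with h
  · simp; norm_num
  · have h0 : 0 < mag U (tng d) ^ 2 + mag U 2 ^ 2 := by
      rcases not_and_or.1 h with h | h <;> positivity
    simp [div_pow, Real.sq_sqrt h0.le]
    field_simp

theorem sgnB_sq (d : Fin 2) (U : State) : sgnB d U ^ 2 = 1 := by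
  unfold sgnB; split_ifs <;> norm_num

/-- Pair the columns of opposite sign. Velocities see only the differences of fast and of slow
coefficients, density, pressures and magnetic field only the sums. The two 2 × 2 systems have
determinants a² and, up to sign, 1 by the identities for α. The Alfvén and GLM pairs decouple, and
the two contact coefficients come last. -/
theorem eq_zero_of_eigenvector_relations {αf αs cf cs β0 β1 σ a r ρ p aS : ℝ} {x : Fin 10 → ℝ}
    (hα : αf ^ 2 + αs ^ 2 = 1) (hαc : αf ^ 2 * cf ^ 2 + αs ^ 2 * cs ^ 2 = aS)
    (hβ : β0 ^ 2 + β1 ^ 2 = 1) (hσ : σ ^ 2 = 1) (ha : 0 < a) (hr : 0 < r) (hρ : 0 < ρ)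
    (haS : 0 < aS)
    (vn : -(x 0 * (αf * cf)) + -(x 1 * (αs * cs)) + x 8 * (αs * cs) + x 9 * (αf * cf) = 0)
    (vt : x 0 * (αs * cs * β0 * σ) + -(x 1 * (αf * cf * β0 * σ)) + -(x 3 * β1) + x 6 * β1
      + x 8 * (αf * cf * β0 * σ) + -(x 9 * (αs * cs * β0 * σ)) = 0)
    (v2 : x 0 * (αs * cs * β1 * σ) + -(x 1 * (αf * cf * β1 * σ)) + x 3 * β0 + -(x 6 * β0)
      + x 8 * (αf * cf * β1 * σ) + -(x 9 * (αs * cs * β1 * σ)) = 0)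
    (bn : -x 2 + x 7 = 0)
    (bt : x 0 * (αs * a * β0 * r) + -(x 1 * (αf * a * β0 * r)) + -(x 3 * (β1 * σ * r))
      + -(x 6 * (β1 * σ * r)) + -(x 8 * (αf * a * β0 * r)) + x 9 * (αs * a * β0 * r) = 0)
    (b2 : x 0 * (αs * a * β1 * r) + -(x 1 * (αf * a * β1 * r)) + x 3 * (β0 * σ * r)
      + x 6 * (β0 * σ * r) + -(x 8 * (αf * a * β1 * r)) + x 9 * (αs * a * β1 * r) = 0)
    (r0 : x 0 * (αf * ρ) + x 1 * (αs * ρ) + x 4 + x 8 * (αs * ρ) + x 9 * (αf * ρ) = 0)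
    (r4 : x 0 * (αf * p) + x 1 * (αs * p) + x 5 + x 8 * (αs * p) + x 9 * (αf * p) = 0)
    (r5 : x 0 * (αf * ρ * aS) + x 1 * (αs * ρ * aS) + x 8 * (αs * ρ * aS)
      + x 9 * (αf * ρ * aS) = 0)
    (r9 : x 2 + x 7 = 0) : x = 0 := by
  have q : ∀ {c y : ℝ}, 0 < c → c * y = 0 → y = 0 := fun hc hy =>
    (mul_eq_zero.1 hy).resolve_left hc.ne'
  -- Projecting the tangential equations onto (β0, β1) isolates the magnetosonic part, and onto the
  -- orthogonal direction the Alfvén part.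
  have hP : -(αs * cs) * (x 9 - x 0) + αf * cf * (x 8 - x 1) = 0 := by
    linear_combination σ * β0 * vt + σ * β1 * v2
      - (-(αs * cs) * (x 9 - x 0) + αf * cf * (x 8 - x 1)) * (hσ + σ ^ 2 * hβ)
  have hE : x 6 - x 3 = 0 := by linear_combination β1 * vt - β0 * v2 - (x 6 - x 3) * hβ
  have hA : x 9 - x 0 = 0 := q haS (by
    linear_combination αf * cf * vn - αs * cs * hP - (x 9 - x 0) * hαc)
  have hB : x 8 - x 1 = 0 := q haS (by
    linear_combination αs * cs * vn + αf * cf * hP - (x 8 - x 1) * hαc)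
  have hQ : αf * (x 0 + x 9) + αs * (x 1 + x 8) = 0 := q (mul_pos hρ haS) (by
    linear_combination r5)
  have hS : αs * (x 0 + x 9) - αf * (x 1 + x 8) = 0 := q (mul_pos ha hr) (by
    linear_combination β0 * bt + β1 * b2
      - a * r * (αs * (x 0 + x 9) - αf * (x 1 + x 8)) * hβ)
  have hF : x 3 + x 6 = 0 := q hr (by
    linear_combination σ * (β0 * b2 - β1 * bt) - r * (x 3 + x 6) * (hσ + σ ^ 2 * hβ))
  have hC : x 0 + x 9 = 0 := by
    linear_combination αf * hQ + αs * hS - (x 0 + x 9) * hα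
  have hD : x 1 + x 8 = 0 := by
    linear_combination αs * hQ - αf * hS - (x 1 + x 8) * hα
  ext i
  fin_cases i <;> simp only [Pi.zero_apply]
  · change x 0 = 0; linarith
  · change x 1 = 0; linarith
  · change x 2 = 0; linarith
  · change x 3 = 0; linarith
  · change x 4 = 0; linear_combination r0 - ρ * hQ
  · change x 5 = 0; linear_combination r4 - p * hQ
  · change x 6 = 0; linarith
  · change x 7 = 0; linarith
  · change x 8 = 0; linarith
  · change x 9 = 0; linarith

theorem det_eigPrim_ne_zero (h : RegularState d U) : (eigPrim d U).det ≠ 0 := by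
  rw [Ne, ← Matrix.exists_mulVec_eq_zero_iff]
  rintro ⟨x, hx, h0⟩
  obtain ⟨hα, hαc⟩ := alpha_identities h
  have hβ := betaTan_sq d U
  have hσ := sgnB_sq d U
  have ha := aSq_pos h.1
  have hsa := Real.sqrt_pos.2 ha
  have hsρ := Real.sqrt_pos.2 h.1.1
  have hcf := Real.sq_sqrt (cfSq_pos h.1 d).le
  have hcs := Real.sq_sqrt h.csSq_pos.le
  have hcomb : ∀ i, x 0 * eigFast d U (-1) i + x 1 * eigSlow d U (-1) i + x 2 * eigGLM d (-1) i
      + x 3 * eigAlfven d U (-1) i + x 4 * coord 0 i + x 5 * coord 4 i + x 6 * eigAlfven d U 1 i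
      + x 7 * eigGLM d 1 i + x 8 * eigSlow d U 1 i + x 9 * eigFast d U 1 i = 0 := by
    intro i
    have := congrFun h0 i
    rw [eigPrim, Matrix.mulVec_transpose, Matrix.vecMul, dotProduct] at this
    simp [Fin.sum_univ_succ] at this
    linarith
  -- Rows are chosen by their role, normal or tangential, so both directions yield the same
  -- relations.
  have vn := hcomb (if d = 0 then 1 else 2)
  have vt := hcomb (if d = 0 then 2 else 1)
  have v2 := hcomb 3
  have bn := hcomb (if d = 0 then 6 else 7)
  have bt := hcomb (if d = 0 then 7 else 6)
  have b2 := hcomb 8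
  have r0 := hcomb 0
  have r4 := hcomb 4
  have r5 := hcomb 5
  have r9 := hcomb 9
  have hρ := h.1.1
  rw [← hcf, ← hcs] at hαc
  fin_cases d <;>
  · simp [eigFast, eigSlow, eigGLM, eigAlfven, pack, frame, nrm, tng, coord]
      at vn vt v2 bn bt b2 r0 r4 r5 r9
    exact hx (eq_zero_of_eigenvector_relations hα hαc hβ hσ hsa hsρ hρ ha vn vt v2 bn bt b2
      r0 r4 r5 r9)

theorem RegularState.det_scaledEig_ne_zero (h : RegularState d U) : (scaledEig d U).det ≠ 0 := by
  rw [scaledEig, Matrix.det_mul, Matrix.det_mul]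
  exact mul_ne_zero (mul_ne_zero (det_jacPrim_ne_zero h.1) (det_eigPrim_ne_zero h))
    (det_scaling_ne_zero h.1)

/-- Excludes the default value zero of `diffusive_eq` near regular states, so that neighbouring
diffusive fluxes are given by the same formula. -/
theorem RegularState.eventually_det_ne_zero (h : RegularState d U) :
    ∀ᶠ W in 𝓝 U, (scaledEig d W).det ≠ 0 := by
  have hc : ContinuousAt (scaledEig d) U :=
    continuousAt_pi.2 fun i => continuousAt_pi.2 fun j => (h.contDiffAt_scaledEig i j).continuousAt
  have hdet : Continuous fun M : Matrix (Fin 10) (Fin 10) ℝ => M.det := continuous_id.matrix_det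
  exact (ContinuousAt.comp (f := scaledEig d) (g := fun M => M.det) hdet.continuousAt
    hc).eventually_ne h.det_scaledEig_ne_zero

end Regular

/-! ## Size of the diffusive terms -/

section Diffusion

open Filter Topology Asymptotics

theorem mulVec_isBigO_mul {α : Type*} {l : Filter α} {n m : ℕ}
    {A : α → Matrix (Fin n) (Fin m) ℝ} {f : α → Fin m → ℝ} {a b : α → ℝ}
    (hA : ∀ i j, (fun x => A x i j) =O[l] a) (hf : f =O[l] b) :
    (fun x => A x *ᵥ f x) =O[l] fun x => a x * b x := by
  rw [isBigO_pi] at hf ⊢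
  intro i
  change (fun x => ∑ j, A x i j * f x j) =O[l] _
  exact IsBigO.fun_sum fun j _ => (hA i j).mul (hf j)

/-- The eigenvector matrix is frozen at the interface for the whole stencil, so differences of
scaled variables are scaled differences of V. -/
theorem fwdDiff_iter_mulVec {n m : ℕ} (A : Matrix (Fin n) (Fin m) ℝ) (f : ℤ → Fin m → ℝ)
    (c : Fin n) (l : ℕ) (s : ℤ) : (fwdDiff (1 : ℤ))^[l] (fun j => (A *ᵥ f j) c) s
      = (A *ᵥ (fwdDiff (1 : ℤ))^[l] f s) c := by
  induction l generalizing s with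
  | zero => rfl
  | succ l ih => rw [fwdDiff_iter_succ_apply, fwdDiff_iter_succ_apply, ih, ih, Matrix.mulVec_sub,
      Pi.sub_apply]

theorem continuousAt_iteratedDeriv_snd {E G : Type*} [NormedAddCommGroup E] [NormedSpace ℝ E]
    [NormedAddCommGroup G] [NormedSpace ℝ G] {z₀ : E} (n : ℕ) : ∀ {F : E × ℝ → G},
    ContDiffAt ℝ n F (z₀, 0) →
      ContinuousAt (fun z => iteratedDeriv n (fun s => F (z, s)) 0) z₀ := by
  induction n with
  | zero =>
    intro F hF
    simp only [iteratedDeriv_zero]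
    exact ContinuousAt.comp (f := fun z : E => (z, (0 : ℝ))) (g := F) hF.continuousAt
      (by fun_prop)
  | succ n ih =>
    intro F hF
    simp only [iteratedDeriv_succ']
    exact ih (contDiffAt_deriv_snd hF)

variable {u : ℝ × ℝ → State} {z₀ : ℝ × ℝ}

theorem tendsto_gridLine (hu : ContDiffAt ℝ ∞ u z₀) (e : ℝ × ℝ) (j : ℤ) :
    Tendsto (fun p => gridLine u e p j) (meshFilter z₀) (𝓝 (u z₀)) := by
  have h1 : Tendsto (fun p : (ℝ × ℝ) × ℝ => p.1 + ((j : ℝ) * p.2) • e) (𝓝 (z₀, 0)) (𝓝 z₀) := by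
    have : Continuous fun p : (ℝ × ℝ) × ℝ => p.1 + ((j : ℝ) * p.2) • e := by fun_prop
    simpa using this.tendsto (z₀, (0 : ℝ))
  exact hu.continuousAt.tendsto.comp (h1.mono_left (meshFilter_le z₀))

theorem IsInterfaceState.contDiffAt {m : State → State → State} (hm : IsInterfaceState m)
    {U : State} (h : Positive U) :
    ContDiffAt ℝ ∞ (fun w : State × State => m w.1 w.2) (U, U) := by
  refine hm.2.2.contDiffAt ?_
  filter_upwards [(continuousAt_fst (p := (U, U))).eventually (eventually_positive h),
    (continuousAt_snd (p := (U, U))).eventually (eventually_positive h)] with w h1 h2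
  exact ⟨h1, h2⟩

/-- The state at the interface `i + 1/2` of a grid line. -/
def interfaceState (m : State → State → State) (u : ℝ × ℝ → State) (e : ℝ × ℝ) (i : ℤ)
    (p : (ℝ × ℝ) × ℝ) : State :=
  m (gridLine u e p i) (gridLine u e p (i + 1))

theorem tendsto_interfaceState {m : State → State → State} (hm : IsInterfaceState m)
    (hu : ContDiffAt ℝ ∞ u z₀) (hp : Positive (u z₀)) (e : ℝ × ℝ) (i : ℤ) :
    Tendsto (interfaceState m u e i) (meshFilter z₀) (𝓝 (u z₀)) := by
  have h1 := (hm.contDiffAt hp).continuousAt.tendsto.comp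
    ((tendsto_gridLine hu e i).prodMk_nhds (tendsto_gridLine hu e (i + 1)))
  simp only [hm.1 _ hp] at h1
  exact h1

/-- The scaled eigenvectors at the interface `i + 1/2` of a grid line. -/
def interfaceEig (d : Fin 2) (m : State → State → State) (u : ℝ × ℝ → State) (e : ℝ × ℝ) (i : ℤ)
    (p : (ℝ × ℝ) × ℝ) : Matrix (Fin 10) (Fin 10) ℝ :=
  scaledEig d (interfaceState m u e i p)

/-- The jumps of the scaled variables at the interface `i + 1/2` of a grid line. -/
def interfaceJump (κ : ENOKind) (k : ℕ) (d : Fin 2) (m : State → State → State)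
    (u : ℝ × ℝ → State) (e : ℝ × ℝ) (i : ℤ) (p : (ℝ × ℝ) × ℝ) : State :=
  fun c => reconJump κ k
    (fun j => ((interfaceEig d m u e i p)ᵀ *ᵥ entropyVar (gridLine u e p j)) c) i

theorem diffusive_gridLine (κ : ENOKind) (k : ℕ) (d : Fin 2) (ch : ℝ) (m : State → State → State)
    (e : ℝ × ℝ) (i : ℤ) (p : (ℝ × ℝ) × ℝ) : diffusive κ k d ch m (gridLine u e p) i =
      if (interfaceEig d m u e i p).det = 0 then 0 else rusanov d ch (interfaceState m u e i p)
        • (interfaceEig d m u e i p *ᵥ interfaceJump κ k d m u e i p) :=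
  diffusive_eq κ k d ch m _ i

theorem contDiffAt_entropyVar_line (hu : ContDiffAt ℝ ∞ u z₀) (hp : Positive (u z₀))
    (e : ℝ × ℝ) (n : ℕ) :
    ContDiffAt ℝ n (fun p : (ℝ × ℝ) × ℝ => entropyVar (u (p.1 + p.2 • e))) (z₀, 0) := by
  have h1 : ContDiffAt ℝ ∞ (fun p : (ℝ × ℝ) × ℝ => entropyVar (u (p.1 + p.2 • e))) (z₀, 0) := by
    refine ContDiffAt.comp (z₀, (0 : ℝ)) (g := entropyVar)
      (f := fun p : (ℝ × ℝ) × ℝ => u (p.1 + p.2 • e)) ?_ (contDiffAt_line hu e)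
    simpa using contDiffAt_entropyVar hp
  exact h1.of_le (by exact_mod_cast le_top)

theorem fwdDiff_entropyVar_isBigO (hu : ContDiffAt ℝ ∞ u z₀) (hp : Positive (u z₀))
    (e : ℝ × ℝ) (n : ℕ) (s : ℤ) :
    (fun p => (fwdDiff (1 : ℤ))^[n] (fun j => entropyVar (gridLine u e p j)) s)
      =O[meshFilter z₀] fun p => p.2 ^ n :=
  (fwdDiff_isBigO (contDiffAt_entropyVar_line hu hp e n) s).mono (meshFilter_le z₀)

theorem interfaceEig_isBigO (d : Fin 2) {m : State → State → State} (hm : IsInterfaceState m)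
    (hu : ContDiffAt ℝ ∞ u z₀) (hp : Positive (u z₀)) (e : ℝ × ℝ) (i : ℤ) (a b : Fin 10) :
    (fun p => interfaceEig d m u e i p a b) =O[meshFilter z₀] fun _ => (1 : ℝ) :=
  (scaledEig_isBigO d hp a b).comp_tendsto (tendsto_interfaceState hm hu hp e i)

/-- Needs only boundedness of the eigenvectors: the jump is controlled by k-th differences of V. -/
theorem interfaceJump_isBigO (κ : ENOKind) {k : ℕ} (hk : k = 2 ∨ k = 3 ∨ k = 4) (d : Fin 2)
    {m : State → State → State} (hm : IsInterfaceState m) (hu : ContDiffAt ℝ ∞ u z₀)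
    (hp : Positive (u z₀)) (e : ℝ × ℝ) (i : ℤ) :
    interfaceJump κ k d m u e i =O[meshFilter z₀] fun p => p.2 ^ k := by
  obtain ⟨C, hC, hJ⟩ := reconJump_abs_le κ hk
  rw [isBigO_pi]
  intro c
  have hs : ∀ s, (fun p => ((interfaceEig d m u e i p)ᵀ *ᵥ
      (fwdDiff (1 : ℤ))^[k] (fun j => entropyVar (gridLine u e p j)) s) c)
      =O[meshFilter z₀] fun p => p.2 ^ k := fun s =>
    isBigO_pi.1 (mulVec_isBigO (fun a b => interfaceEig_isBigO d hm hu hp e i b a)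
      (fwdDiff_entropyVar_isBigO hu hp e k s)) c
  have hsum := (IsBigO.fun_sum (s := Finset.Icc (i - 4) (i + 4)) fun s _ =>
    (hs s).norm_left).const_mul_left C
  refine IsBigO.trans (IsBigO.of_bound 1 (Eventually.of_forall fun p => ?_)) hsum
  rw [one_mul]
  refine (hJ _ i _ fun s hsm => ?_).trans (le_abs_self _)
  rw [fwdDiff_iter_mulVec]
  exact Finset.single_le_sum (f := fun s => ‖((interfaceEig d m u e i p)ᵀ *ᵥ
      (fwdDiff (1 : ℤ))^[k] (fun j => entropyVar (gridLine u e p j)) s) c‖)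
    (fun _ _ => norm_nonneg _) hsm

/-- The diffusive terms are of the order `k`. -/
theorem diffusive_isBigO (κ : ENOKind) {k : ℕ} (hk : k = 2 ∨ k = 3 ∨ k = 4) (d : Fin 2) (ch : ℝ)
    {m : State → State → State} (hm : IsInterfaceState m) (hu : ContDiffAt ℝ ∞ u z₀)
    (hp : Positive (u z₀)) (e : ℝ × ℝ) (i : ℤ) :
    (fun p => diffusive κ k d ch m (gridLine u e p) i) =O[meshFilter z₀] fun p => p.2 ^ k := by
  have h1 := (((continuousAt_rusanov d ch hp).tendsto.comp
    (tendsto_interfaceState hm hu hp e i)).isBigO_one ℝ).smul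
    (mulVec_isBigO (fun a b => interfaceEig_isBigO d hm hu hp e i a b)
      (interfaceJump_isBigO κ hk d hm hu hp e i))
  simp only [smul_eq_mul, one_mul] at h1
  refine IsBigO.trans (IsBigO.of_bound 1 (Eventually.of_forall fun p => ?_)) h1
  rw [one_mul, diffusive_gridLine]
  split_ifs
  · rw [norm_zero]; exact norm_nonneg _
  · exact le_rfl

theorem interfaceState_sub_isBigO {m : State → State → State} (hm : IsInterfaceState m)
    (hu : ContDiffAt ℝ ∞ u z₀) (hp : Positive (u z₀)) (e : ℝ × ℝ) :
    (fun p => interfaceState m u e 0 p - interfaceState m u e (-1) p) =O[meshFilter z₀]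
      fun p => p.2 := by
  have hd : ∀ s : ℤ, (fun p : (ℝ × ℝ) × ℝ => gridLine u e p (s + 1) - gridLine u e p s)
      =O[meshFilter z₀] fun p => p.2 := fun s => by
    have := (fwdDiff_isBigO (n := 1)
      ((contDiffAt_line hu e).of_le (by exact_mod_cast le_top)) s).mono (meshFilter_le z₀)
    simpa [fwdDiff, gridLine] using this
  have e1 := hd (-1)
  have e2 := hd 0
  rw [neg_add_cancel] at e1
  rw [zero_add] at e2
  have h1 := (ContDiffAt.isBigO_sub' (hm.contDiffAt hp)).comp_tendsto
    (((tendsto_gridLine hu e 0).prodMk_nhds (tendsto_gridLine hu e 1)).prodMk_nhds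
    ((tendsto_gridLine hu e (-1)).prodMk_nhds (tendsto_gridLine hu e 0)))
  simp only [Function.comp_def, Prod.mk_sub_mk] at h1
  simp only [interfaceState, neg_add_cancel, zero_add]
  exact h1.trans (e1.prod_left e2)

theorem interfaceEig_sub_isBigO {d : Fin 2} {m : State → State → State} (hm : IsInterfaceState m)
    (hu : ContDiffAt ℝ ∞ u z₀) (hr : RegularState d (u z₀)) (e : ℝ × ℝ) (a b : Fin 10) :
    (fun p => (interfaceEig d m u e 0 p - interfaceEig d m u e (-1) p) a b) =O[meshFilter z₀]
      fun p => p.2 := by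
  have h1 := (ContDiffAt.isBigO_sub' (hr.contDiffAt_scaledEig a b)).comp_tendsto
    ((tendsto_interfaceState hm hu hr.1 e 0).prodMk_nhds
      (tendsto_interfaceState hm hu hr.1 e (-1)))
  exact h1.trans (interfaceState_sub_isBigO hm hu hr.1 e)

/-- A nonzero limit fixes the sign of the l-th differences for small mesh sizes; this is how the
regularity assumption enters. -/
theorem tendsto_scaled_fwdDiff {d : Fin 2} {m : State → State → State} (hm : IsInterfaceState m)
    (hu : ContDiffAt ℝ ∞ u z₀) (hr : RegularState d (u z₀)) (e : ℝ × ℝ) (i : ℤ) (l : ℕ) (s : ℤ)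
    (c : Fin 10) :
    Tendsto (fun p => (p.2 ^ l)⁻¹ * (fwdDiff (1 : ℤ))^[l] (fun j =>
      ((interfaceEig d m u e i p)ᵀ *ᵥ entropyVar (gridLine u e p j)) c) s) (meshFilter z₀)
      (𝓝 (((scaledEig d (u z₀))ᵀ *ᵥ
        iteratedDeriv l (fun r : ℝ => entropyVar (u (z₀ + r • e))) 0) c)) := by
  have hV : Tendsto (fun p : (ℝ × ℝ) × ℝ => (p.2 ^ l)⁻¹ •
      (fwdDiff (1 : ℤ))^[l] (fun j => entropyVar (gridLine u e p j)) s) (meshFilter z₀)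
      (𝓝 (iteratedDeriv l (fun r : ℝ => entropyVar (u (z₀ + r • e))) 0)) := by
    have h1 := ((fwdDiff_taylor_isBigO (contDiffAt_entropyVar_line hu hr.1 e (l + 1)) s).mono
      (meshFilter_le z₀))
    have h2 := (isBigO_refl (fun p : (ℝ × ℝ) × ℝ => (p.2 ^ l)⁻¹) (meshFilter z₀)).smul h1
    have h3 : Tendsto (fun p : (ℝ × ℝ) × ℝ => p.2) (meshFilter z₀) (𝓝 0) :=
      tendsto_snd.mono_right nhdsWithin_le_nhds
    have h4 : Tendsto (fun p : (ℝ × ℝ) × ℝ => (p.2 ^ l)⁻¹ • p.2 ^ (l + 1)) (meshFilter z₀)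
        (𝓝 0) := by
      refine h3.congr' ?_
      filter_upwards [meshFilter_pos z₀] with p hp
      rw [smul_eq_mul, pow_succ]
      field_simp
    have h5 := h2.trans_tendsto h4
    have h6 := (continuousAt_iteratedDeriv_snd l
      (contDiffAt_entropyVar_line hu hr.1 e l)).tendsto.comp (tendsto_fst_meshFilter z₀)
    have h7 := h5.add h6
    rw [zero_add] at h7
    refine h7.congr' ?_
    filter_upwards [meshFilter_pos z₀] with p hp
    have : p.2 ^ l ≠ 0 := (pow_pos hp l).ne'
    rw [smul_sub, smul_smul, inv_mul_cancel₀ this, one_smul]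
    exact sub_add_cancel _ _
  have hR : ∀ a, Tendsto (fun p => interfaceEig d m u e i p a c) (meshFilter z₀)
      (𝓝 (scaledEig d (u z₀) a c)) := fun a =>
    (hr.contDiffAt_scaledEig a c).continuousAt.tendsto.comp (tendsto_interfaceState hm hu hr.1 e i)
  have hsum := tendsto_finsetSum (Finset.univ : Finset (Fin 10)) fun a _ =>
    (hR a).mul (tendsto_pi_nhds.1 hV a)
  refine hsum.congr fun p => ?_
  rw [fwdDiff_iter_mulVec]
  simp only [Matrix.mulVec, dotProduct, Finset.mul_sum, Matrix.transpose_apply, Pi.smul_apply,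
    smul_eq_mul]
  exact Finset.sum_congr rfl fun a _ => by ring

/-- With frozen signs both jumps are the same Lipschitz function of two k-th differences, taken one
index apart, so it suffices to compare those differences. -/
theorem interfaceJump_sub_isBigO (κ : ENOKind) {k : ℕ} (hk : k = 2 ∨ k = 3 ∨ k = 4) {d : Fin 2}
    {m : State → State → State} (hm : IsInterfaceState m) (hu : ContDiffAt ℝ ∞ u z₀)
    (hr : RegularState d (u z₀)) (e : ℝ × ℝ)
    (hD : ∀ l : ℕ, 1 ≤ l → l < k → ∀ c : Fin 10, ((scaledEig d (u z₀))ᵀ *ᵥ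
      iteratedDeriv l (fun r : ℝ => entropyVar (u (z₀ + r • e))) 0) c ≠ 0) :
    (fun p => interfaceJump κ k d m u e 0 p - interfaceJump κ k d m u e (-1) p)
      =O[meshFilter z₀] fun p => p.2 ^ (k + 1) := by
  rw [isBigO_pi]
  intro c
  set X : ℕ → ℝ := fun l => ((scaledEig d (u z₀))ᵀ *ᵥ
      iteratedDeriv l (fun r : ℝ => entropyVar (u (z₀ + r • e))) 0) c
  set σ : ℕ → ℝ := fun l => if 0 < X l then 1 else -1 with hσd
  have hσ : ∀ l, σ l = 1 ∨ σ l = -1 := fun l => by simp only [hσd]; split_ifs <;> simp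
  have hσX : ∀ l, 1 ≤ l → l < k → 0 < σ l * X l := fun l h1 h2 => by
    have := hD l h1 h2 c
    simp only [hσd]
    split_ifs with h
    · simpa using h
    · have : X l < 0 := lt_of_le_of_ne (not_lt.1 h) this
      linarith
  obtain ⟨c₁, c₂, r, -, -, hrec⟩ := reconJump_of_sign κ hk σ hσ
  have hsign : ∀ i : ℤ, ∀ᶠ p in meshFilter z₀, ∀ l ∈ Finset.Ico 1 k,
      ∀ s ∈ Finset.Icc (i - 5) (i + 5), 0 < σ l * (fwdDiff (1 : ℤ))^[l] (fun j =>
        ((interfaceEig d m u e i p)ᵀ *ᵥ entropyVar (gridLine u e p j)) c) s := by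
    intro i
    rw [Finset.eventually_all]
    intro l hl
    rw [Finset.eventually_all]
    intro s _
    obtain ⟨hl1, hl2⟩ := Finset.mem_Ico.1 hl
    have ht := (tendsto_scaled_fwdDiff hm hu hr e i l s c).const_mul (σ l)
    filter_upwards [ht.eventually (lt_mem_nhds (hσX l hl1 hl2)), meshFilter_pos z₀] with p h1 h2
    have h3 := mul_pos (pow_pos h2 l) h1
    have h4 : p.2 ^ l ≠ 0 := (pow_pos h2 l).ne'
    rwa [mul_left_comm, mul_inv_cancel_left₀ h4] at h3
  -- Moving the index by one costs a difference of order k + 1; changing the matrix costs O(h) times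
  -- a difference of order k.
  have hdiff : ∀ s : ℤ, (fun p => ((interfaceEig d m u e 0 p)ᵀ *ᵥ
        (fwdDiff (1 : ℤ))^[k] (fun j => entropyVar (gridLine u e p j)) (s + 1)) c
      - ((interfaceEig d m u e (-1) p)ᵀ *ᵥ
        (fwdDiff (1 : ℤ))^[k] (fun j => entropyVar (gridLine u e p j)) s) c)
      =O[meshFilter z₀] fun p => p.2 ^ (k + 1) := by
    intro s
    have h1 := isBigO_pi.1 (mulVec_isBigO (A := fun p => (interfaceEig d m u e 0 p)ᵀ)
      (fun a b => interfaceEig_isBigO d hm hu hr.1 e 0 b a)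
      (fwdDiff_entropyVar_isBigO hu hr.1 e (k + 1) s)) c
    have h2 := isBigO_pi.1 (mulVec_isBigO_mul
      (A := fun p => (interfaceEig d m u e 0 p - interfaceEig d m u e (-1) p)ᵀ)
      (fun a b => interfaceEig_sub_isBigO hm hu hr e b a)
      (fwdDiff_entropyVar_isBigO hu hr.1 e k s)) c
    simp only [← pow_succ'] at h2
    refine (h1.add h2).congr_left fun p => ?_
    rw [fwdDiff_iter_succ_apply, Matrix.transpose_sub, Matrix.sub_mulVec, Matrix.mulVec_sub,
      Pi.sub_apply, Pi.sub_apply]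
    ring
  have hmax : ∀ {f g : (ℝ × ℝ) × ℝ → ℝ}, (fun p => f p - g p) =O[meshFilter z₀]
      (fun p => p.2 ^ (k + 1)) → (fun p => max (f p) 0 - max (g p) 0) =O[meshFilter z₀]
      fun p => p.2 ^ (k + 1) := fun hfg =>
    IsBigO.trans (IsBigO.of_bound 1 (Eventually.of_forall fun p => by
      rw [one_mul]
      exact abs_max_sub_max_le_abs _ _ _)) hfg
  have h1 := (hmax (((hdiff (r - 2)).const_mul_left (σ (k - 1))).congr_left
    fun p => mul_sub _ _ _)).const_mul_left c₁
  have h2 := (hmax ((((hdiff (r - 1)).const_mul_left (-σ (k - 1)))).congr_left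
    fun p => mul_sub _ _ _)).const_mul_left c₂
  refine (h1.add h2).congr' ?_ .rfl
  filter_upwards [hsign 0, hsign (-1)] with p s0 s1
  have e0 := hrec _ 0 fun l hl1 hl2 s hs => s0 l (Finset.mem_Ico.2 ⟨hl1, hl2⟩) s hs
  have e1 := hrec _ (-1) fun l hl1 hl2 s hs => s1 l (Finset.mem_Ico.2 ⟨hl1, hl2⟩) s hs
  simp only [fwdDiff_iter_mulVec] at e0 e1
  rw [Pi.sub_apply, interfaceJump, interfaceJump, e0, e1, show r - 2 + 1 = 0 + r - 1 by ring,
    show r - 1 + 1 = 0 + r by ring, show -1 + r - 1 = r - 2 by ring,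
    show -1 + r = r - 1 by ring]
  simp only [neg_mul]
  ring

/-- At regular points the diffusive terms at neighbouring interfaces agree up to the order
`k + 1`. -/
theorem diffusive_sub_isBigO (κ : ENOKind) {k : ℕ} (hk : k = 2 ∨ k = 3 ∨ k = 4) {d : Fin 2}
    (ch : ℝ) {m : State → State → State} (hm : IsInterfaceState m) (hu : ContDiffAt ℝ ∞ u z₀)
    (hr : RegularState d (u z₀)) (e : ℝ × ℝ)
    (hD : ∀ l : ℕ, 1 ≤ l → l < k → ∀ c : Fin 10, ((scaledEig d (u z₀))ᵀ *ᵥ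
      iteratedDeriv l (fun r : ℝ => entropyVar (u (z₀ + r • e))) 0) c ≠ 0) :
    (fun p => diffusive κ k d ch m (gridLine u e p) 0
      - diffusive κ k d ch m (gridLine u e p) (-1)) =O[meshFilter z₀] fun p => p.2 ^ (k + 1) := by
  have hp := hr.1
  have t0 := tendsto_interfaceState hm hu hp e 0
  have t1 := tendsto_interfaceState hm hu hp e (-1)
  have hs : (fun p => rusanov d ch (interfaceState m u e 0 p)
      - rusanov d ch (interfaceState m u e (-1) p)) =O[meshFilter z₀] fun p => p.2 :=
    ((hr.rusanov_isBigO_sub ch).comp_tendsto (t0.prodMk_nhds t1)).trans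
      (interfaceState_sub_isBigO hm hu hp e)
  have hs1 : (fun p => rusanov d ch (interfaceState m u e (-1) p)) =O[meshFilter z₀]
      fun _ => (1 : ℝ) := ((continuousAt_rusanov d ch hp).tendsto.comp t1).isBigO_one ℝ
  have hJ := interfaceJump_isBigO κ hk d hm hu hp e 0
  -- The product of speed, matrix and jump is changed one factor at a time; each change gains one
  -- power of h.
  have a1 := hs.smul (mulVec_isBigO (fun a b => interfaceEig_isBigO d hm hu hp e 0 a b) hJ)
  have a2 := hs1.smul (mulVec_isBigO_mul (fun a b => interfaceEig_sub_isBigO hm hu hr e a b) hJ)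
  have a3 := hs1.smul (mulVec_isBigO (A := interfaceEig d m u e (-1)) (fun a b => interfaceEig_isBigO d hm hu hp e (-1) a b)
    (interfaceJump_sub_isBigO κ hk hm hu hr e hD))
  simp only [smul_eq_mul, one_mul, ← pow_succ'] at a1 a2 a3
  refine ((a1.add a2).add a3).congr' ?_ .rfl
  filter_upwards [t0.eventually hr.eventually_det_ne_zero,
    t1.eventually hr.eventually_det_ne_zero] with p d0 d1
  change (interfaceEig d m u e 0 p).det ≠ 0 at d0
  change (interfaceEig d m u e (-1) p).det ≠ 0 at d1
  rw [diffusive_gridLine, diffusive_gridLine, if_neg d0, if_neg d1, Matrix.sub_mulVec,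
    Matrix.mulVec_sub]
  module

end Diffusion

/-! ## Truncation errors -/

section Truncation

open Filter Topology Asymptotics

/-- Each estimate holds on a neighbourhood of its base point times an interval of mesh sizes;
finitely many such neighbourhoods cover K. -/
theorem exists_bound_of_isBigO {K : Set (ℝ × ℝ)} (hK : IsCompact K) {F : Type*}
    [NormedAddCommGroup F] {f : (ℝ × ℝ) × ℝ → F} {k : ℕ}
    (hf : ∀ z ∈ K, f =O[meshFilter z] fun p => p.2 ^ k) :
    ∃ C > 0, ∃ δ > 0, ∀ z ∈ K, ∀ h ∈ Set.Ioo (0 : ℝ) δ, ‖f (z, h)‖ ≤ C * h ^ k := by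
  refine hK.induction_on (p := fun s => ∃ C > 0, ∃ δ > 0, ∀ z ∈ s, ∀ h ∈ Set.Ioo (0 : ℝ) δ,
    ‖f (z, h)‖ ≤ C * h ^ k) ⟨1, one_pos, 1, one_pos, by simp⟩ ?_ ?_ ?_
  · rintro s t hst ⟨C, hC, δ, hδ, H⟩
    exact ⟨C, hC, δ, hδ, fun z hz => H z (hst hz)⟩
  · rintro s t ⟨C, hC, δ, hδ, H⟩ ⟨C', hC', δ', hδ', H'⟩
    refine ⟨max C C', lt_max_of_lt_left hC, min δ δ', lt_min hδ hδ', fun z hz h hh => ?_⟩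
    have hk : 0 ≤ h ^ k := (pow_pos hh.1 k).le
    rcases hz with hz | hz
    · exact (H z hz h ⟨hh.1, hh.2.trans_le (min_le_left _ _)⟩).trans
        (mul_le_mul_of_nonneg_right (le_max_left _ _) hk)
    · exact (H' z hz h ⟨hh.1, hh.2.trans_le (min_le_right _ _)⟩).trans
        (mul_le_mul_of_nonneg_right (le_max_right _ _) hk)
  · intro z hz
    obtain ⟨C, hC, hb⟩ := (hf z hz).exists_pos
    obtain ⟨s, hs, t, ht, hst⟩ := Filter.mem_prod_iff.1 hb.bound
    obtain ⟨δ, hδ, hδt⟩ := mem_nhdsGT_iff_exists_Ioo_subset.1 ht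
    refine ⟨s, mem_nhdsWithin_of_mem_nhds hs, C, hC, δ, hδ, fun y hy h hh => ?_⟩
    have h1 : ‖f (y, h)‖ ≤ C * ‖h ^ k‖ := hst (Set.mk_mem_prod hy (hδt hh))
    rwa [Real.norm_of_nonneg (pow_pos hh.1 k).le] at h1

theorem diffusive_shift (κ : ENOKind) {k : ℕ} (hk : k = 2 ∨ k = 3 ∨ k = 4) (d : Fin 2) (ch : ℝ)
    (m : State → State → State) (u : ℤ → State) (a i : ℤ) :
    diffusive κ k d ch m (fun j => u (j + a)) i = diffusive κ k d ch m u (i + a) := by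
  have h1 : ∀ (R : Matrix (Fin 10) (Fin 10) ℝ) (c : Fin 10),
      reconJump κ k (fun j => (Rᵀ *ᵥ entropyVar (u (j + a))) c) i
        = reconJump κ k (fun j => (Rᵀ *ᵥ entropyVar (u j)) c) (i + a) := fun R c =>
    reconJump_shift κ hk (fun j => (Rᵀ *ᵥ entropyVar (u j)) c) a i
  rw [diffusive_eq, diffusive_eq, add_right_comm i 1 a]
  simp only [h1]

theorem gridLine_add_smul (u : ℝ × ℝ → State) (e z : ℝ × ℝ) (h : ℝ) (a : ℤ) :
    gridLine u e (z + ((a : ℝ) * h) • e, h) = fun j => gridLine u e (z, h) (j + a) := by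
  funext j
  simp only [gridLine]
  congr 1
  push_cast
  module

/-- The error of the numerical flux in direction `e` caused by the diffusive terms, as a function
of the interface point. -/
def diffusiveError (κ : ENOKind) (k : ℕ) (d : Fin 2) (ch : ℝ) (m : State → State → State)
    (u : ℝ × ℝ → State) (e : ℝ × ℝ) (h : ℝ) (p : ℝ × ℝ) : State :=
  -(1 / 2 : ℝ) • diffusive κ k d ch m (gridLine u e (p - (h / 2) • e, h)) 0

theorem diffusiveError_add (κ : ENOKind) (k : ℕ) (d : Fin 2) (ch : ℝ) (m : State → State → State)
    (u : ℝ × ℝ → State) (e : ℝ × ℝ) (h : ℝ) (z : ℝ × ℝ) :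
    diffusiveError κ k d ch m u e h (z + (h / 2) • e)
      = -(1 / 2 : ℝ) • diffusive κ k d ch m (gridLine u e (z, h)) 0 := by
  rw [diffusiveError, add_sub_cancel_right]

/-- The left interface of z is the right interface of z - h e. Translation invariance makes the two
descriptions agree, so one function of the interface point serves both sides. -/
theorem diffusiveError_sub (κ : ENOKind) {k : ℕ} (hk : k = 2 ∨ k = 3 ∨ k = 4) (d : Fin 2) (ch : ℝ)
    (m : State → State → State) (u : ℝ × ℝ → State) (e : ℝ × ℝ) (h : ℝ) (z : ℝ × ℝ) :
    diffusiveError κ k d ch m u e h (z - (h / 2) • e)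
      = -(1 / 2 : ℝ) • diffusive κ k d ch m (gridLine u e (z, h)) (-1) := by
  have h1 : z - (h / 2) • e - (h / 2) • e = z + (((-1 : ℤ) : ℝ) * h) • e := by
    push_cast
    module
  rw [diffusiveError, h1, gridLine_add_smul, diffusive_shift κ hk, zero_add]

/-- The truncation error in direction `e`. -/
def lineError (κ : ENOKind) (k : ℕ) (d : Fin 2) (ch : ℝ) (m : State → State → State)
    (u : ℝ × ℝ → State) (e : ℝ × ℝ) (p : (ℝ × ℝ) × ℝ) : State :=
  schemePart κ k d ch m p.2 (gridLine u e p) 0 - pdePart d ch (fun s => u (p.1 + s • e)) 0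

/-- The truncation error in direction `e` without the contribution of the diffusive terms. -/
def conservativeError (κ : ENOKind) (k : ℕ) (d : Fin 2) (ch : ℝ) (m : State → State → State)
    (u : ℝ × ℝ → State) (e : ℝ × ℝ) (p : (ℝ × ℝ) × ℝ) : State :=
  schemePart κ k d ch m p.2 (gridLine u e p) 0
    + (1 / 2 : ℝ) • (p.2⁻¹ • (diffusive κ k d ch m (gridLine u e p) 0
      - diffusive κ k d ch m (gridLine u e p) (-1)))
    - pdePart d ch (fun s => u (p.1 + s • e)) 0

theorem lineError_eq (κ : ENOKind) (k : ℕ) (d : Fin 2) (ch : ℝ) (m : State → State → State)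
    (u : ℝ × ℝ → State) (e : ℝ × ℝ) (p : (ℝ × ℝ) × ℝ) :
    lineError κ k d ch m u e p = conservativeError κ k d ch m u e p
      - (1 / 2 : ℝ) • (p.2⁻¹ • (diffusive κ k d ch m (gridLine u e p) 0
        - diffusive κ k d ch m (gridLine u e p) (-1))) := by
  rw [lineError, conservativeError]
  abel

theorem lineError_eq_flux_difference (κ : ENOKind) {k : ℕ} (hk : k = 2 ∨ k = 3 ∨ k = 4) (d : Fin 2)
    (ch : ℝ) (m : State → State → State) (u : ℝ × ℝ → State) (e : ℝ × ℝ) (h : ℝ) (z : ℝ × ℝ) :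
    lineError κ k d ch m u e (z, h)
      = h⁻¹ • (diffusiveError κ k d ch m u e h (z + (h / 2) • e)
        - diffusiveError κ k d ch m u e h (z - (h / 2) • e))
        + conservativeError κ k d ch m u e (z, h) := by
  rw [lineError_eq, diffusiveError_add, diffusiveError_sub κ hk]
  module

theorem pdePart_comp_const_add (d : Fin 2) (ch : ℝ) (f : ℝ → State) (a : ℝ) :
    pdePart d ch (fun s => f (a + s)) 0 = pdePart d ch f a := by
  simp only [pdePart]
  rw [deriv_comp_const_add (f := fun r => flux d ch (f r)),
    deriv_comp_const_add (f := fun r => mag (f r) (nrm d)),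
    deriv_comp_const_add (f := fun r => psi (f r)), deriv_comp_const_add (f := f), add_zero]

theorem truncationError_eq (κ : ENOKind) (k : ℕ) (ch : ℝ) (m : Fin 2 → State → State → State)
    (hx hy : ℝ) (u : ℝ × ℝ → State) (z : ℝ × ℝ) :
    truncationError κ k ch m hx hy u z = lineError κ k 0 ch (m 0) u (1, 0) (z, hx)
      + lineError κ k 1 ch (m 1) u (0, 1) (z, hy) := by
  have g0 : gridLine u (1, 0) (z, hx) = fun l : ℤ => u (z.1 + l * hx, z.2 + (0 : ℤ) * hy) := by
    funext l
    simp only [gridLine]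
    congr 1
    ext <;> simp
  have g1 : gridLine u (0, 1) (z, hy) = fun l : ℤ => u (z.1 + (0 : ℤ) * hx, z.2 + l * hy) := by
    funext l
    simp only [gridLine]
    congr 1
    ext <;> simp
  have p0 : pdePart 0 ch (fun s => u (z + s • ((1 : ℝ), (0 : ℝ)))) 0
      = pdePart 0 ch (fun s => u (s, z.2)) z.1 := by
    rw [← pdePart_comp_const_add 0 ch _ z.1]
    congr 1
    funext s
    congr 1
    ext <;> simp
  have p1 : pdePart 1 ch (fun s => u (z + s • ((0 : ℝ), (1 : ℝ)))) 0
      = pdePart 1 ch (fun s => u (z.1, s)) z.2 := by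
    rw [← pdePart_comp_const_add 1 ch _ z.2]
    congr 1
    funext s
    congr 1
    ext <;> simp
  simp only [truncationError, schemeOp, pdeOp, lineError, g0, g1, p0, p1]
  abel

variable {u : ℝ × ℝ → State} {z₀ : ℝ × ℝ}

theorem conservativeError_isBigO (κ : ENOKind) {k : ℕ} (hk : k = 2 ∨ k = 3 ∨ k = 4) (d : Fin 2)
    (ch : ℝ) (m : State → State → State) (hu : ContDiffAt ℝ ∞ u z₀) (ha : Admissible (u z₀))
    (e : ℝ × ℝ) :
    conservativeError κ k d ch m u e =O[meshFilter z₀] fun p => p.2 ^ k :=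
  schemePart_sub_pdePart_isBigO κ hk d ch m hu ha e

/-- Dividing by the mesh size costs one power, which is why neighbouring diffusive terms must agree
to order k + 1. -/
theorem lineError_isBigO (κ : ENOKind) {k : ℕ} (hk : k = 2 ∨ k = 3 ∨ k = 4) {d : Fin 2} (ch : ℝ)
    {m : State → State → State} (hm : IsInterfaceState m) (hu : ContDiffAt ℝ ∞ u z₀)
    (ha : Admissible (u z₀)) (e : ℝ × ℝ) (hr : RegularAt k d (fun s => u (z₀ + s • e)) 0) :
    lineError κ k d ch m u e =O[meshFilter z₀] fun p => p.2 ^ k := by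
  obtain ⟨r1, r2, r3⟩ := hr
  simp only [zero_smul, add_zero] at r1 r2 r3
  have h1 := conservativeError_isBigO κ hk d ch m hu ha e
  have h2 := (GLMCGL.IsBigO.inv_smul
    (diffusive_sub_isBigO κ hk ch hm hu ⟨ha.1, r1, r2⟩ e r3)).const_smul_left (1 / 2 : ℝ)
  exact (h1.sub h2).congr_left fun p => (lineError_eq κ k d ch m u e p).symm

theorem regularAt_comp_const_add {k : ℕ} {d : Fin 2} {f : ℝ → State} {a : ℝ}
    (h : RegularAt k d f a) : RegularAt k d (fun s => f (a + s)) 0 := by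
  obtain ⟨h1, h2, h3⟩ := h
  refine ⟨by simpa using h1, by simpa using h2, fun l hl hlk c => ?_⟩
  have := h3 l hl hlk c
  rw [iteratedDeriv_comp_const_add (f := fun r => entropyVar (f r))]
  simpa using this

theorem RegularAt.along_fst {k : ℕ} {d : Fin 2} {z : ℝ × ℝ}
    (h : RegularAt k d (fun s => u (s, z.2)) z.1) :
    RegularAt k d (fun s => u (z + s • ((1 : ℝ), (0 : ℝ)))) 0 := by
  convert regularAt_comp_const_add h using 3
  ext <;> simp

theorem RegularAt.along_snd {k : ℕ} {d : Fin 2} {z : ℝ × ℝ}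
    (h : RegularAt k d (fun s => u (z.1, s)) z.2) :
    RegularAt k d (fun s => u (z + s • ((0 : ℝ), (1 : ℝ)))) 0 := by
  convert regularAt_comp_const_add h using 3
  ext <;> simp

theorem exists_bound_truncation_terms (κ : ENOKind) {k : ℕ} (hk : k = 2 ∨ k = 3 ∨ k = 4)
    (d : Fin 2) (ch : ℝ) {m : State → State → State} (hm : IsInterfaceState m)
    {K : Set (ℝ × ℝ)} (hK : IsCompact K) (hu : ∀ z ∈ K, ContDiffAt ℝ ∞ u z)
    (ha : ∀ z ∈ K, Admissible (u z)) (e : ℝ × ℝ) :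
    ∃ C > 0, ∃ δ > 0, ∀ z ∈ K, ∀ h ∈ Set.Ioo (0 : ℝ) δ,
      ‖diffusiveError κ k d ch m u e h (z + (h / 2) • e)‖ ≤ C * h ^ k ∧
      ‖diffusiveError κ k d ch m u e h (z - (h / 2) • e)‖ ≤ C * h ^ k ∧
      ‖conservativeError κ k d ch m u e (z, h)‖ ≤ C * h ^ k := by
  obtain ⟨C, hC, δ, hδ, H⟩ := exists_bound_of_isBigO hK fun z hz =>
    (((diffusive_isBigO κ hk d ch hm (hu z hz) (ha z hz).1 e 0).const_smul_left
      (-(1 / 2 : ℝ))).prod_left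
    ((diffusive_isBigO κ hk d ch hm (hu z hz) (ha z hz).1 e (-1)).const_smul_left
      (-(1 / 2 : ℝ)))).prod_left (conservativeError_isBigO κ hk d ch m (hu z hz) (ha z hz) e)
  refine ⟨C, hC, δ, hδ, fun z hz h hh => ?_⟩
  have h1 := H z hz h hh
  rw [norm_prod_le_iff, norm_prod_le_iff] at h1
  rw [diffusiveError_add, diffusiveError_sub κ hk]
  exact ⟨h1.1.1, h1.1.2, h1.2⟩

theorem exists_flux_errors (κ : ENOKind) {k : ℕ} (hk : k = 2 ∨ k = 3 ∨ k = 4) (ch : ℝ)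
    {m : Fin 2 → State → State → State} (hm : ∀ d, IsInterfaceState (m d))
    {K : Set (ℝ × ℝ)} (hK : IsCompact K) (hu : ∀ z ∈ K, ContDiffAt ℝ ∞ u z)
    (ha : ∀ z ∈ K, Admissible (u z)) :
    ∃ C > 0, ∃ δ > 0, ∃ f g r : ℝ → ℝ → ℝ × ℝ → State,
      ∀ hx ∈ Set.Ioo 0 δ, ∀ hy ∈ Set.Ioo 0 δ, ∀ z ∈ K,
        truncationError κ k ch m hx hy u z
          = hx⁻¹ • (f hx hy (z.1 + hx / 2, z.2) - f hx hy (z.1 - hx / 2, z.2))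
            + hy⁻¹ • (g hx hy (z.1, z.2 + hy / 2) - g hx hy (z.1, z.2 - hy / 2))
            + r hx hy z ∧
        ‖f hx hy (z.1 + hx / 2, z.2)‖ ≤ C * hx ^ k ∧
        ‖f hx hy (z.1 - hx / 2, z.2)‖ ≤ C * hx ^ k ∧
        ‖g hx hy (z.1, z.2 + hy / 2)‖ ≤ C * hy ^ k ∧
        ‖g hx hy (z.1, z.2 - hy / 2)‖ ≤ C * hy ^ k ∧
        ‖r hx hy z‖ ≤ C * (hx ^ k + hy ^ k) := by
  obtain ⟨C₀, hC₀, δ₀, hδ₀, H₀⟩ :=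
    exists_bound_truncation_terms κ hk 0 ch (hm 0) hK hu ha (1, 0)
  obtain ⟨C₁, hC₁, δ₁, hδ₁, H₁⟩ :=
    exists_bound_truncation_terms κ hk 1 ch (hm 1) hK hu ha (0, 1)
  refine ⟨max C₀ C₁, lt_max_of_lt_left hC₀, min δ₀ δ₁, lt_min hδ₀ hδ₁,
    fun hx _ => diffusiveError κ k 0 ch (m 0) u (1, 0) hx,
    fun _ hy => diffusiveError κ k 1 ch (m 1) u (0, 1) hy,
    fun hx hy z => conservativeError κ k 0 ch (m 0) u (1, 0) (z, hx)
      + conservativeError κ k 1 ch (m 1) u (0, 1) (z, hy), fun hx hhx hy hhy z hz => ?_⟩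
  obtain ⟨f1, f2, r1⟩ := H₀ z hz hx ⟨hhx.1, hhx.2.trans_le (min_le_left _ _)⟩
  obtain ⟨g1, g2, r2⟩ := H₁ z hz hy ⟨hhy.1, hhy.2.trans_le (min_le_right _ _)⟩
  have x1 : (z.1 + hx / 2, z.2) = z + (hx / 2) • ((1 : ℝ), (0 : ℝ)) := by ext <;> simp
  have x2 : (z.1 - hx / 2, z.2) = z - (hx / 2) • ((1 : ℝ), (0 : ℝ)) := by ext <;> simp
  have y1 : (z.1, z.2 + hy / 2) = z + (hy / 2) • ((0 : ℝ), (1 : ℝ)) := by ext <;> simp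
  have y2 : (z.1, z.2 - hy / 2) = z - (hy / 2) • ((0 : ℝ), (1 : ℝ)) := by ext <;> simp
  simp only [x1, x2, y1, y2]
  have b0 : C₀ * hx ^ k ≤ max C₀ C₁ * hx ^ k :=
    mul_le_mul_of_nonneg_right (le_max_left _ _) (pow_pos hhx.1 k).le
  have b1 : C₁ * hy ^ k ≤ max C₀ C₁ * hy ^ k :=
    mul_le_mul_of_nonneg_right (le_max_right _ _) (pow_pos hhy.1 k).le
  refine ⟨?_, f1.trans b0, f2.trans b0, g1.trans b1, g2.trans b1, ?_⟩
  · rw [truncationError_eq, lineError_eq_flux_difference κ hk, lineError_eq_flux_difference κ hk]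
    abel
  · rw [mul_add]
    exact norm_add_le_of_le (r1.trans b0) (r2.trans b1)

theorem exists_bound_truncationError (κ : ENOKind) {k : ℕ} (hk : k = 2 ∨ k = 3 ∨ k = 4) (ch : ℝ)
    {m : Fin 2 → State → State → State} (hm : ∀ d, IsInterfaceState (m d))
    {K : Set (ℝ × ℝ)} (hK : IsCompact K) (hu : ∀ z ∈ K, ContDiffAt ℝ ∞ u z)
    (ha : ∀ z ∈ K, Admissible (u z))
    (hr : ∀ z ∈ K, RegularAt k 0 (fun s => u (s, z.2)) z.1 ∧
      RegularAt k 1 (fun s => u (z.1, s)) z.2) :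
    ∃ C > 0, ∃ δ > 0, ∀ hx ∈ Set.Ioo 0 δ, ∀ hy ∈ Set.Ioo 0 δ, ∀ z ∈ K,
      ‖truncationError κ k ch m hx hy u z‖ ≤ C * (hx ^ k + hy ^ k) := by
  obtain ⟨C₀, hC₀, δ₀, hδ₀, H₀⟩ := exists_bound_of_isBigO hK fun z hz =>
    lineError_isBigO κ hk ch (hm 0) (hu z hz) (ha z hz) (1, 0) (hr z hz).1.along_fst
  obtain ⟨C₁, hC₁, δ₁, hδ₁, H₁⟩ := exists_bound_of_isBigO hK fun z hz =>
    lineError_isBigO κ hk ch (hm 1) (hu z hz) (ha z hz) (0, 1) (hr z hz).2.along_snd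
  refine ⟨max C₀ C₁, lt_max_of_lt_left hC₀, min δ₀ δ₁, lt_min hδ₀ hδ₁,
    fun hx hhx hy hhy z hz => ?_⟩
  rw [truncationError_eq, mul_add]
  refine norm_add_le_of_le ((H₀ z hz hx ⟨hhx.1, hhx.2.trans_le (min_le_left _ _)⟩).trans ?_)
    ((H₁ z hz hy ⟨hhy.1, hhy.2.trans_le (min_le_right _ _)⟩).trans ?_)
  · exact mul_le_mul_of_nonneg_right (le_max_left _ _) (pow_pos hhx.1 k).le
  · exact mul_le_mul_of_nonneg_right (le_max_right _ _) (pow_pos hhy.1 k).le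

end Truncation

/-- The cell entropy inequality. -/
theorem entropy_inequality (κ : ENOKind) {k : ℕ} (hk : k = 2 ∨ k = 3 ∨ k = 4) (ch : ℝ)
    (m : Fin 2 → State → State → State) {hx hy : ℝ} (hhx : 0 < hx) (hhy : 0 < hy)
    {U : ℝ → ℤ → ℤ → State} {I : Set ℝ} (hU : IsSolution κ k ch m hx hy U I) {t : ℝ} (ht : t ∈ I)
    (i j : ℤ) :
    ∃ e : ℝ, HasDerivAt (fun s => entropy (U s i j)) e t ∧
      e + (1 / hx) * (esEntropyFlux κ k 0 ch (m 0) (fun l => U t l j) i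
            - esEntropyFlux κ k 0 ch (m 0) (fun l => U t l j) (i - 1))
        + (1 / hy) * (esEntropyFlux κ k 1 ch (m 1) (fun l => U t i l) j
            - esEntropyFlux κ k 1 ch (m 1) (fun l => U t i l) (j - 1)) ≤ 0 := by
  refine ⟨_, hasDerivAt_entropy (hU t ht i j).2 (hU t ht i j).1.1, ?_⟩
  have h0 := le_entropyVar_dotProduct_schemePart κ hk 0 ch (m 0) hhx (fun l => U t l j)
    (fun l => (hU t ht l j).1.1) i
  have h1 := le_entropyVar_dotProduct_schemePart κ hk 1 ch (m 1) hhy (fun l => U t i l)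
    (fun l => (hU t ht i l).1.1) j
  rw [dotProduct_neg, schemeOp, dotProduct_add]
  linarith

end GLMCGL

end

/-! ### Accuracy and entropy stability of the scheme -/

theorem theorem1 (k : ℕ) (hk : k = 2 ∨ k = 3 ∨ k = 4) (κ : GLMCGL.ENOKind) (ch : ℝ)
    (m : Fin 2 → GLMCGL.State → GLMCGL.State → GLMCGL.State)
    (hm : ∀ d, GLMCGL.IsInterfaceState (m d)) :
    -- the scheme is accurate of order `k`
    (∀ (Ω K : Set (ℝ × ℝ)) (u : ℝ × ℝ → GLMCGL.State), IsOpen Ω → IsCompact K → K ⊆ Ω →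
      ContDiffOn ℝ ∞ u Ω → (∀ z ∈ Ω, GLMCGL.Admissible (u z)) →
      -- on all smooth fields, up to differences of numerical flux errors of order `k`
      (∃ C > 0, ∃ δ > 0, ∃ f g r : ℝ → ℝ → ℝ × ℝ → GLMCGL.State,
        ∀ hx ∈ Set.Ioo 0 δ, ∀ hy ∈ Set.Ioo 0 δ, ∀ z ∈ K,
          GLMCGL.truncationError κ k ch m hx hy u z
            = hx⁻¹ • (f hx hy (z.1 + hx / 2, z.2) - f hx hy (z.1 - hx / 2, z.2))
              + hy⁻¹ • (g hx hy (z.1, z.2 + hy / 2) - g hx hy (z.1, z.2 - hy / 2))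
              + r hx hy z ∧
          ‖f hx hy (z.1 + hx / 2, z.2)‖ ≤ C * hx ^ k ∧
          ‖f hx hy (z.1 - hx / 2, z.2)‖ ≤ C * hx ^ k ∧
          ‖g hx hy (z.1, z.2 + hy / 2)‖ ≤ C * hy ^ k ∧
          ‖g hx hy (z.1, z.2 - hy / 2)‖ ≤ C * hy ^ k ∧
          ‖r hx hy z‖ ≤ C * (hx ^ k + hy ^ k)) ∧
      -- pointwise, wherever the reconstruction is regular
      ((∀ z ∈ K, GLMCGL.RegularAt k 0 (fun s => u (s, z.2)) z.1 ∧
          GLMCGL.RegularAt k 1 (fun s => u (z.1, s)) z.2) →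
        ∃ C > 0, ∃ δ > 0, ∀ hx ∈ Set.Ioo 0 δ, ∀ hy ∈ Set.Ioo 0 δ, ∀ z ∈ K,
          ‖GLMCGL.truncationError κ k ch m hx hy u z‖ ≤ C * (hx ^ k + hy ^ k))) ∧
    -- the scheme is entropy stable
    (∀ (hx hy : ℝ), 0 < hx → 0 < hy → ∀ (U : ℝ → ℤ → ℤ → GLMCGL.State) (I : Set ℝ),
      GLMCGL.IsSolution κ k ch m hx hy U I → ∀ t ∈ I, ∀ i j : ℤ,
        ∃ e : ℝ, HasDerivAt (fun s => GLMCGL.entropy (U s i j)) e t ∧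
          e + (1 / hx) * (GLMCGL.esEntropyFlux κ k 0 ch (m 0) (fun l => U t l j) i
                - GLMCGL.esEntropyFlux κ k 0 ch (m 0) (fun l => U t l j) (i - 1))
            + (1 / hy) * (GLMCGL.esEntropyFlux κ k 1 ch (m 1) (fun l => U t i l) j
                - GLMCGL.esEntropyFlux κ k 1 ch (m 1) (fun l => U t i l) (j - 1)) ≤ 0) := by
  refine ⟨fun Ω K u hΩ hK hKΩ hu ha => ?_, fun hx hy hhx hhy U I hU t ht i j =>
    GLMCGL.entropy_inequality κ hk ch m hhx hhy hU ht i j⟩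
  have hu' : ∀ z ∈ K, ContDiffAt ℝ ∞ u z := fun z hz =>
    hu.contDiffAt (hΩ.mem_nhds (hKΩ hz))
  have ha' : ∀ z ∈ K, GLMCGL.Admissible (u z) := fun z hz => ha z (hKΩ hz)
  exact ⟨GLMCGL.exists_flux_errors κ hk ch hm hK hu' ha',
    GLMCGL.exists_bound_truncationError κ hk ch hm hK hu' ha'⟩
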